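/- Let $n,p$ be integers with $1\le p\le n/2$, let $V\subset\mathbb R^{n-2p}\times\mathbb R^p$ be open with coordinates $z=(x,u)$, let $\Delta=\sum_A\partial^2/\partial (x^A)^2$ be the flat Laplacian in the $x$-variables only, and let $H=H(x,u)$ be a smooth function on $V$. Consider, for $h=h(\varrho,x,u)$ (primes denote $\partial/\partial\varrho$), $$2\varrho h''+(2-n)h'-\Delta(H+h)=0,\qquad h\to0\ \text{ as }\varrho\downarrow0. \qquad (*)$$ Solutions are meant in the following two senses. (F) *Formal solutions* ($H$ smooth): formal series $\sum_{r,j}a_{r,j}(z)\,\varrho^{r}(\log\varrho)^j$ with real exponents $r$ from a well-ordered set, finitely many powers of $\log \varrho$ for each $r$, smooth coefficients $a_{r,j}$ on $V$, and (this is $h\to0$) only exponents $r>0$, which satisfy $(*)$ as formal series. Equalities are equalities of formal series on $V$, and "function $\alpha$" means smooth function on $V$. (A) *Solutions for small $\varrho>0$* ($H$ real analytic on $V$): functions $h$ such that, near every point of $V$ and for small $\varrho>0$, $h$ is smooth and satisfies $(*)$, and $z\mapsto h(\varrho,z)$ is real analytic, locally uniformly as $\varrho\downarrow0$: near each point of $V$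 there are $C,R$ with $\|D_z^kh(\varrho,z)\|\le CR^kk!$ for all $k\ge 0$ and all small $\varrho>0$; and $h(\varrho,z)\to 0$ as $\varrho\downarrow0$ for every $z\in V$. Equalities hold near every point of $V$ for small $\varrho>0$, with all series convergent there, and "function $\alpha$" means real analytic function on $V$. 1. Let $n$ be odd. In both senses, the solutions are exactly $$h=\sum_{k=1}^\infty\frac{\Delta^kH}{k!\prod_{i=1}^k(2i-n)}\varrho^k+\varrho^{n/2}\Big(\alpha+\sum_{k=1}^\infty\frac{\Delta^k\alpha}{k!\prod_{i=1}^k(2i+n)}\varrho^k\Big),$$ where $\alpha=\alpha(x,u)$ is an arbitrary function. If $H$ is analytic, then there is a unique solution (as a germ along $\{0\}\times V$) that is smooth and analytic in $\varrho$ in a (two-sided) neighbourhood of $\varrho=0$ with $h|_{\varrho=0}=0$; it is given by $\alpha\equiv0$. 2. Let $n=2s$ be even. Put $$c_n=-\frac1{(s-1)!\prod_{i=0}^{s-1}(2i-n)},\qquad q_0=0,\qquad q_k=\sum_{i=1}^k\frac{n+4i}{i(n+2i)}\quad(k\ge1).$$ In both senses, the solutions are exactly $$h=\sum_{k=1}^{s-1}\frac{\Delta^kH}{k!\prod_{i=1}^k(2i-n)}\varrho^k+\varrho^s\Big(\alpha+\sum_{k=1}^\infty\frac{\Delta^k\alpha}{k!\prod_{i=1}^k(2i+n)}\varrho^k\Big)$$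 $$\qquad+c_n\varrho^s\sum_{k=0}^\infty(\log\varrho-q_k)\frac{\Delta^{s+k}H}{k!\prod_{i=1}^k(2i+n)}\varrho^k+c_n\varrho^s\,Q*\sum_{k=0}^\infty\frac{\Delta^{s+k}H}{k!\prod_{i=1}^k(2i+n)}\varrho^k,$$ where $\alpha=\alpha(x,u)$ is an arbitrary function and $Q=Q(x,u)$ is an arbitrary function that can be convolved with $f=\Delta^sH$, and $*$ is the convolution in the $x$-variables, $(Q*f)(x,u)=\int Q(y,u)f(x-y,u)\,dy$ (taken termwise in (F)). Here "can be convolved" means: for $(x,u)\in V$ the integrand vanishes unless $(x-y,u)\in V$ (precisely, $Q(y,u)\neq0$ implies $(x-y,u)\in V$); the integrand is smooth in $z=(x,u)\in V$, and its $z$-derivatives are measurable in $y$; and, locally in $z$, the $z$-derivatives of each order $k$ are dominated by an integrable function $g_k(y)$, where in case (A) the neighbourhood of $z$ does not depend on $k$ and $\int g_k\le CR^kk!$ for some $C,R$. (For instance, $Q=0$ is allowed.) Moreover, for smooth $H$, there is a solution that is smooth and analytic in $\varrho$ in a (two-sided) neighbourhood of $\varrho=0$ with $h|_{\varrho=0}=0$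 if and only if $\Delta^sH\equiv0$ on $V$. If $H$ is analytic and $\Delta^sH\equiv0$, then the solutions that are analytic in $(\varrho,x,u)$ near $\varrho=0$ with $h|_{\varrho=0}=0$ are exactly the functions $$h=\sum_{k=1}^{s-1}\frac{\Delta^kH}{k!\prod_{i=1}^k(2i-n)}\varrho^k+\varrho^s\Big(\alpha+\sum_{k=1}^\infty\frac{\Delta^k\alpha}{k!\prod_{i=1}^k(2i+n)}\varrho^k\Big)$$ with $\alpha$ an arbitrary analytic function on $V$, and $h$ determines $\alpha$. -/

import Mathlib

open Filter Topology MeasureTheory Set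
open scoped ContDiff Convolution Nat

noncomputable section

namespace PPWave

/-- The space of the variables `z = (x, u)`, with `x ∈ ℝ^d` and `u ∈ ℝ^p`. -/
abbrev Z (d p : ℕ) : Type := EuclideanSpace ℝ (Fin d) × EuclideanSpace ℝ (Fin p)

/-- The flat Laplacian in the `x`-variables; `u` is a parameter. -/
def xLap {d p : ℕ} (f : Z d p → ℝ) : Z d p → ℝ :=
  fun z => Laplacian.laplacian (fun x => f (x, z.2)) z.1

/-- `k! ∏_{i=1}^k (2i - n)`. -/
def minusDen (n k : ℕ) : ℝ := (k ! : ℝ) * ∏ i ∈ Finset.Icc 1 k, (2 * (i : ℝ) - n)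

/-- `k! ∏_{i=1}^k (2i + n)`. -/
def plusDen (n k : ℕ) : ℝ := (k ! : ℝ) * ∏ i ∈ Finset.Icc 1 k, (2 * (i : ℝ) + n)

/-- The constant `c_n` for `n = 2s`. -/
def cConst (s : ℕ) : ℝ :=
  -1 / (((s - 1)! : ℝ) * ∏ i ∈ Finset.range s, (2 * (i : ℝ) - ((2 * s : ℕ) : ℝ)))

/-- The constants `q_k`; `q_0 = 0`. -/
def qConst (n k : ℕ) : ℝ :=
  ∑ i ∈ Finset.Icc 1 k, ((n : ℝ) + 4 * i) / ((i : ℝ) * ((n : ℝ) + 2 * i))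

/-- The convolution of two functions with respect to the `x`-variables. -/
def xConv {d p : ℕ} (Q f : Z d p → ℝ) : Z d p → ℝ :=
  fun z => ((fun y => Q (y, z.2)) ⋆[ContinuousLinearMap.mul ℝ ℝ, volume]
    (fun y => f (y, z.2))) z.1

/-- The integrand of `(Q ∗ f)(z) = ∫ Q(y, u) f(x - y, u) dy`, as a function of `z = (x, u)`. -/
def convKernel {d p : ℕ} (Q f : Z d p → ℝ) (y : EuclideanSpace ℝ (Fin d)) : Z d p → ℝ :=
  fun z => Q (y, z.2) * f (z.1 - y, z.2)

/-- The part common to the two notions below of functions `Q` that can be convolved with a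
function `f` given on `V`: the convolution only uses values of `f` on `V`, and the integrand
is smooth in `z` and measurable in `y`, with its `z`-derivatives. -/
def ConvolvableBase {d p : ℕ} (V : Set (Z d p)) (Q f : Z d p → ℝ) : Prop :=
  (∀ z ∈ V, ∀ y, Q (y, z.2) ≠ 0 → (z.1 - y, z.2) ∈ V) ∧
  (∀ z ∈ V, ∀ y, ContDiffAt ℝ ∞ (convKernel Q f y) z) ∧
  (∀ z ∈ V, ∀ k : ℕ, AEStronglyMeasurable (fun y => iteratedFDeriv ℝ k (convKernel Q f y) z))

/-- `Q` can be convolved with `f`, smooth version: locally in `z`, each `z`-derivative of the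
integrand of `Q ∗ f` is dominated by an integrable function. -/
def SmoothConvolvable {d p : ℕ} (V : Set (Z d p)) (Q f : Z d p → ℝ) : Prop :=
  ConvolvableBase V Q f ∧
  ∀ z ∈ V, ∀ k : ℕ, ∃ g : EuclideanSpace ℝ (Fin d) → ℝ, Integrable g ∧
    ∀ᶠ w in 𝓝 z, ∀ y, ‖iteratedFDeriv ℝ k (convKernel Q f y) w‖ ≤ g y

/-- `Q` can be convolved with `f`, analytic version: locally in `z`, the `z`-derivatives of the
integrand of `Q ∗ f` are dominated by integrable functions whose integrals satisfy Cauchy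
estimates. -/
def AnalyticConvolvable {d p : ℕ} (V : Set (Z d p)) (Q f : Z d p → ℝ) : Prop :=
  ConvolvableBase V Q f ∧
  ∀ z ∈ V, ∃ (C R : ℝ) (g : ℕ → EuclideanSpace ℝ (Fin d) → ℝ),
    (∀ k, Integrable (g k) ∧ ∫ y, g k y ≤ C * R ^ k * (k ! : ℝ)) ∧
    ∀ᶠ w in 𝓝 z, ∀ k y, ‖iteratedFDeriv ℝ k (convKernel Q f y) w‖ ≤ g k y

/-! Functions of `(ϱ, z)`. -/

/-- The equation `2 ϱ h'' + (2 - n) h' - Δ(H + h) = 0` at the point `(ϱ, z)`. -/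
def PDEAt {d p : ℕ} (n : ℕ) (H : Z d p → ℝ) (h : ℝ → Z d p → ℝ) (ϱ : ℝ) (z : Z d p) : Prop :=
  2 * ϱ * iteratedDeriv 2 (fun r => h r z) ϱ + (2 - (n : ℝ)) * deriv (fun r => h r z) ϱ
    - xLap (fun w => H w + h ϱ w) z = 0

/-- Solutions for small `ϱ > 0` with `h → 0` as `ϱ ↓ 0`: near every point of `V` and for small
`ϱ > 0`, `h` is smooth and solves the equation, and `z ↦ h(ϱ, z)` is real analytic, locally
uniformly in `z` and in `ϱ ↓ 0` (Cauchy estimates). -/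
def IsSolution {d p : ℕ} (n : ℕ) (V : Set (Z d p)) (H : Z d p → ℝ)
    (h : ℝ → Z d p → ℝ) : Prop :=
  ∀ z ∈ V,
    (∀ᶠ q in 𝓝[>] (0 : ℝ) ×ˢ 𝓝 z,
      ContDiffAt ℝ ∞ (Function.uncurry h) q ∧ PDEAt n H h q.1 q.2) ∧
    Tendsto (fun ϱ => h ϱ z) (𝓝[>] 0) (𝓝 0) ∧
    ∃ C R : ℝ, ∀ᶠ q in 𝓝[>] (0 : ℝ) ×ˢ 𝓝 z, ∀ k : ℕ,
      ‖iteratedFDeriv ℝ k (h q.1) q.2‖ ≤ C * R ^ k * (k ! : ℝ)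

/-- Smooth solutions in a two-sided neighbourhood of `ϱ = 0` that are analytic in `ϱ` there,
with `h = 0` at `ϱ = 0`. -/
def IsRhoAnalyticSolution {d p : ℕ} (n : ℕ) (V : Set (Z d p)) (H : Z d p → ℝ)
    (h : ℝ → Z d p → ℝ) : Prop :=
  ∀ z ∈ V,
    (∀ᶠ q in 𝓝 (0 : ℝ) ×ˢ 𝓝 z, ContDiffAt ℝ ∞ (Function.uncurry h) q ∧
      AnalyticAt ℝ (fun r => h r q.2) q.1 ∧ PDEAt n H h q.1 q.2) ∧
    h 0 z = 0

/-- Solutions in a two-sided neighbourhood of `ϱ = 0` that are analytic in all variables at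
`ϱ = 0`, with `h = 0` at `ϱ = 0`. -/
def IsAnalyticSolution {d p : ℕ} (n : ℕ) (V : Set (Z d p)) (H : Z d p → ℝ)
    (h : ℝ → Z d p → ℝ) : Prop :=
  ∀ z ∈ V, AnalyticAt ℝ (Function.uncurry h) (0, z) ∧
    (∀ᶠ q in 𝓝 (0 : ℝ) ×ˢ 𝓝 z, PDEAt n H h q.1 q.2) ∧ h 0 z = 0

/-- For `n` odd: near each point of `V`, and for `ϱ` in the filter `l` (that is, for small
`ϱ > 0` or for small `|ϱ|`), all series converge and
`h = ∑_{k≥1} Δ^k H ϱ^k / (k! ∏(2i-n)) + ϱ^{n/2} ∑_{k≥0} Δ^k α ϱ^k / (k! ∏(2i+n))`. -/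
def HasOddExpansion {d p : ℕ} (n : ℕ) (V : Set (Z d p)) (H α : Z d p → ℝ) (l : Filter ℝ)
    (h : ℝ → Z d p → ℝ) : Prop :=
  ∀ z ∈ V, ∀ᶠ q in l ×ˢ 𝓝 z, ∃ A B : ℝ,
    HasSum (fun k : ℕ => (xLap^[k + 1] H) q.2 / minusDen n (k + 1) * q.1 ^ (k + 1)) A ∧
    HasSum (fun k : ℕ => (xLap^[k] α) q.2 / plusDen n k * q.1 ^ k) B ∧
    h q.1 q.2 = A + q.1 ^ ((n : ℝ) / 2) * B

/-- The function `∑_{k≥0} Δ^{s+k} H ϱ^k / (k! ∏(2i+n))` of `z`, for `n = 2s`. -/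
def tailSum {d p : ℕ} (s : ℕ) (H : Z d p → ℝ) (ϱ : ℝ) : Z d p → ℝ :=
  fun z => ∑' k : ℕ, (xLap^[s + k] H) z / plusDen (2 * s) k * ϱ ^ k

/-- For `n = 2s`: near each point of `V`, and for `ϱ` in the filter `l`, all series and the
convolution integral converge and
`h = ∑_{k=1}^{s-1} Δ^k H ϱ^k / (k! ∏(2i-n)) + ϱ^s ∑_{k≥0} Δ^k α ϱ^k / (k! ∏(2i+n))`
`  + c_n ϱ^s ∑_{k≥0} (log ϱ - q_k) Δ^{s+k} H ϱ^k / (k! ∏(2i+n))`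
`  + c_n ϱ^s Q ∗ ∑_{k≥0} Δ^{s+k} H ϱ^k / (k! ∏(2i+n))`. -/
def HasEvenExpansion {d p : ℕ} (s : ℕ) (V : Set (Z d p)) (H α Q : Z d p → ℝ) (l : Filter ℝ)
    (h : ℝ → Z d p → ℝ) : Prop :=
  ∀ z ∈ V, ∀ᶠ q in l ×ˢ 𝓝 z, ∃ B L : ℝ,
    HasSum (fun k : ℕ => (xLap^[k] α) q.2 / plusDen (2 * s) k * q.1 ^ k) B ∧
    HasSum (fun k : ℕ => (Real.log q.1 - qConst (2 * s) k) *
      ((xLap^[s + k] H) q.2 / plusDen (2 * s) k) * q.1 ^ k) L ∧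
    (∀ᵐ y, Q (y, q.2.2) ≠ 0 → Summable (fun k : ℕ =>
      (xLap^[s + k] H) (q.2.1 - y, q.2.2) / plusDen (2 * s) k * q.1 ^ k)) ∧
    ConvolutionExistsAt (fun y => Q (y, q.2.2)) (fun y => tailSum s H q.1 (y, q.2.2)) q.2.1
      (ContinuousLinearMap.mul ℝ ℝ) volume ∧
    h q.1 q.2 =
      (∑ k ∈ Finset.Icc 1 (s - 1), (xLap^[k] H) q.2 / minusDen (2 * s) k * q.1 ^ k)
      + q.1 ^ s * B + cConst s * q.1 ^ s * L
      + cConst s * q.1 ^ s * xConv Q (tailSum s H q.1) q.2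

/-! Formal solutions: formal series `∑ a_{r,j}(z) ϱ^r (log ϱ)^j` with real exponents `r` and
polynomial dependence on `log ϱ` at each exponent. -/

/-- `a r j z` is the coefficient of `ϱ^r (log ϱ)^j`. -/
abbrev FormalSeries (d p : ℕ) : Type := ℝ → ℕ → Z d p → ℝ

/-- Well-ordered set of exponents, finitely many powers of `log ϱ` at each exponent, and
coefficients that are smooth on `V`. -/
def IsLogSeries {d p : ℕ} (V : Set (Z d p)) (a : FormalSeries d p) : Prop :=
  (∀ r j, ContDiffOn ℝ ∞ (a r j) V) ∧
  {r : ℝ | ∃ j, ∃ z ∈ V, a r j z ≠ 0}.IsPWO ∧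
  ∀ r, ∃ J : ℕ, ∀ j, J ≤ j → ∀ z ∈ V, a r j z = 0

/-- Termwise derivative in `ϱ`. -/
def formalDeriv {d p : ℕ} (a : FormalSeries d p) : FormalSeries d p :=
  fun r j z => (r + 1) * a (r + 1) j z + ((j : ℝ) + 1) * a (r + 1) (j + 1) z

/-- Multiplication by `ϱ`. -/
def formalMulRho {d p : ℕ} (a : FormalSeries d p) : FormalSeries d p :=
  fun r j z => a (r - 1) j z

open Classical in
/-- The formal series `∑_{k≥0} c_k ϱ^{m+k} (log ϱ)^j`. -/
def powerSeriesAt {d p : ℕ} (m : ℝ) (j : ℕ) (c : ℕ → Z d p → ℝ) : FormalSeries d p :=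
  fun r i z => if i = j ∧ ∃ k : ℕ, r = m + k then c ⌊r - m⌋₊ z else 0

/-- A function of `z`, as a formal series that is constant in `ϱ`. -/
def formalConst {d p : ℕ} (H : Z d p → ℝ) : FormalSeries d p :=
  fun r j z => if r = 0 ∧ j = 0 then H z else 0

/-- Formal solutions of `2 ϱ h'' + (2 - n) h' - Δ(H + h) = 0` with `h → 0` as `ϱ ↓ 0`, that is,
with positive exponents only. -/
def IsFormalSolution {d p : ℕ} (n : ℕ) (V : Set (Z d p)) (H : Z d p → ℝ)
    (a : FormalSeries d p) : Prop :=
  IsLogSeries V a ∧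
  (∀ r ≤ 0, ∀ j, ∀ z ∈ V, a r j z = 0) ∧
  ∀ r j, ∀ z ∈ V,
    2 * formalMulRho (formalDeriv (formalDeriv a)) r j z + (2 - (n : ℝ)) * formalDeriv a r j z
      - xLap (fun w => formalConst H r j w + a r j w) z = 0

/-- `∑_{k≥1} Δ^k H ϱ^k / (k! ∏(2i-n)) + ϱ^{n/2} ∑_{k≥0} Δ^k α ϱ^k / (k! ∏(2i+n))`,
as a formal series. -/
def oddFormal {d p : ℕ} (n : ℕ) (H α : Z d p → ℝ) : FormalSeries d p :=
  powerSeriesAt 1 0 (fun k z => (xLap^[k + 1] H) z / minusDen n (k + 1)) +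
  powerSeriesAt ((n : ℝ) / 2) 0 (fun k z => (xLap^[k] α) z / plusDen n k)

/-- The formula for `n = 2s`, as a formal series. -/
def evenFormal {d p : ℕ} (s : ℕ) (H α Q : Z d p → ℝ) : FormalSeries d p :=
  powerSeriesAt 1 0 (fun k z =>
    if k + 1 ≤ s - 1 then (xLap^[k + 1] H) z / minusDen (2 * s) (k + 1) else 0) +
  powerSeriesAt (s : ℝ) 0 (fun k z => (xLap^[k] α) z / plusDen (2 * s) k) +
  powerSeriesAt (s : ℝ) 1 (fun k z =>
    cConst s * ((xLap^[s + k] H) z / plusDen (2 * s) k)) +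
  powerSeriesAt (s : ℝ) 0 (fun k z =>
    cConst s * (-qConst (2 * s) k) * ((xLap^[s + k] H) z / plusDen (2 * s) k)) +
  powerSeriesAt (s : ℝ) 0 (fun k z =>
    cConst s * (xConv Q (xLap^[s + k] H) z / plusDen (2 * s) k))

end PPWave

end

noncomputable section

namespace PPWave

/-! Write L_β y = 2ϱy'' + βy' (`radialOp`), so that the equation reads L_{2-n} h = Δ(H + h). The
powers of ϱ annihilated by L_{2-n} have exponents 0 and n/2, and L_{2-n}(ϱ^{n/2} y) = ϱ^{n/2}
L_{2+n} y. The condition h → 0 rules out a free term at exponent 0, so exactly one function remains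
free: the coefficient α of ϱ^{n/2}.

Existence. For a series ∑ c_k ϱ^k Δ^k f the equation becomes a scalar recursion for c_k
(`FactorialDecay.eventually_pde`). Cauchy estimates bound Δ^k f by C A^k (2k)!, while the
coefficients are O(B^k / (2k)!), so the series converge for small ϱ and may be differentiated
termwise. For n odd the recursion never divides by 0. For n = 2s it breaks down at ϱ^s: the
truncated polynomial leaves a multiple of ϱ^{s-1} Δ^s H, which a logarithmic series removes. The q_k
solve the recursion driven by the cross terms of the logarithm (`eventually_logSeries`), and c_n
matches the constants (`cConst_mul`). Convolution in x commutes with Δ and, under the domination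
hypotheses, with the sum. The Q-term therefore only replaces α by α + c_n Q ∗ Δ^s H, and Q = 0
already yields every solution.

Completeness for small ϱ > 0. The difference y of two solutions solves the homogeneous equation,
tends to 0, and has Cauchy estimates in z uniform in ϱ. Each z-derivative of y is a scalar function
of ϱ whose L_{2-n} is a z-derivative of order two higher. Barriers improve y = O(ϱ^{i/2}) to
O(ϱ^{(i+1)/2}) up to order n/2 (`HomFamily.exists_rpow_bound`); these are finitely many steps, so
the Cauchy estimates survive. Then χ = ϱ^{-n/2} y is bounded and solves L_{2+n} χ = Δχ. Boundedness
excludes the singular homogeneous behaviour ϱ^{-n/2}, so χ is Lipschitz in ϱ and has an analytic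
limit α (`HomFamily.analyticAt_limUnder`). The difference of χ and the α-series vanishes at ϱ = 0;
integrating the equation N times bounds it by C(const·ϱ)^N, hence it is 0 (`HomFamily.eq_zero`).

Formal series. At the least exponent m where two formal solutions differ, the Laplacian terms agree
and the indicial polynomial m(2m - n) decides. Descending in the power of log ϱ shows that only the
log-free coefficient at m = n/2 is free (`IsFormalSolution.eqOn`).

Analyticity in ϱ. The ϱ-derivatives g_k at ϱ = 0 of g = H + h satisfy (2 - n + 2k) g_{k+1} = Δ g_k
(`eventually_rhoDeriv_succ`). For n odd this determines all of them. For n = 2s the factor vanishes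
at k = s - 1, which forces Δ^s H = 0 and leaves g_s, that is α, free. -/

theorem two_le_infty : (2 : ℕ∞ω) ≤ ∞ := WithTop.coe_le_coe.2 (le_top : (2 : ℕ∞) ≤ ⊤)

/-! ### Directional derivatives on a normed space -/

section DirectionalDerivative

variable {E : Type*} [NormedAddCommGroup E] [NormedSpace ℝ E]

/-- The derivative of `f` in the direction `w`. -/
def dirDeriv (w : E) (f : E → ℝ) : E → ℝ := fun z => fderiv ℝ f z w

theorem contDiffAt_dirDeriv {f : E → ℝ} {z : E} {m n : ℕ∞ω} (hf : ContDiffAt ℝ n f z)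
    (hmn : m + 1 ≤ n) (w : E) : ContDiffAt ℝ m (dirDeriv w f) z :=
  (hf.fderiv_right hmn).clm_apply contDiffAt_const

theorem contDiffAt_infty_dirDeriv {f : E → ℝ} {z : E} (hf : ContDiffAt ℝ ∞ f z) (w : E) :
    ContDiffAt ℝ ∞ (dirDeriv w f) z :=
  contDiffAt_dirDeriv hf (by simp) w

theorem analyticAt_dirDeriv {f : E → ℝ} {z : E} (hf : AnalyticAt ℝ f z) (w : E) :
    AnalyticAt ℝ (dirDeriv w f) z :=
  (ContinuousLinearMap.analyticAt (ContinuousLinearMap.apply ℝ ℝ w) _).comp hf.fderiv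

theorem dirDeriv_congr {f g : E → ℝ} {z : E} (h : f =ᶠ[𝓝 z] g) (w : E) :
    dirDeriv w f =ᶠ[𝓝 z] dirDeriv w g := by
  filter_upwards [h.fderiv (𝕜 := ℝ)] with x hx
  simp only [dirDeriv, hx]

theorem dirDeriv_dirDeriv_eq {f : E → ℝ} {z : E} (hf : ContDiffAt ℝ 2 f z) (v w : E) :
    dirDeriv v (dirDeriv w f) z = fderiv ℝ (fderiv ℝ f) z v w := by
  have hd : DifferentiableAt ℝ (fderiv ℝ f) z :=
    (hf.fderiv_right (m := 1) (by norm_num)).differentiableAt (by norm_num)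
  have h := hd.hasFDerivAt.clm_apply (hasFDerivAt_const w z)
  change fderiv ℝ (fun y => fderiv ℝ f y w) z v = _
  rw [h.fderiv]
  simp

theorem dirDeriv_comm {f : E → ℝ} {z : E} (hf : ContDiffAt ℝ 2 f z) (v w : E) :
    dirDeriv v (dirDeriv w f) z = dirDeriv w (dirDeriv v f) z := by
  rw [dirDeriv_dirDeriv_eq hf, dirDeriv_dirDeriv_eq hf]
  exact hf.isSymmSndFDerivAt (by simp) v w

theorem dirDeriv_add {f g : E → ℝ} {z : E} (hf : DifferentiableAt ℝ f z)
    (hg : DifferentiableAt ℝ g z) (w : E) :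
    dirDeriv w (fun x => f x + g x) z = dirDeriv w f z + dirDeriv w g z := by
  simp only [dirDeriv]
  rw [fderiv_fun_add hf hg]; rfl

theorem dirDeriv_const_mul {f : E → ℝ} {z : E} (hf : DifferentiableAt ℝ f z) (c : ℝ) (w : E) :
    dirDeriv w (fun x => c * f x) z = c * dirDeriv w f z := by
  simp only [dirDeriv]
  rw [fderiv_const_mul hf]; rfl

theorem dirDeriv_sum {ι : Type*} (s : Finset ι) {f : ι → E → ℝ} {z : E}
    (hf : ∀ i ∈ s, DifferentiableAt ℝ (f i) z) (w : E) :
    dirDeriv w (fun x => ∑ i ∈ s, f i x) z = ∑ i ∈ s, dirDeriv w (f i) z := by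
  simp only [dirDeriv]
  rw [fderiv_fun_sum hf]; simp

theorem norm_iteratedFDeriv_dirDeriv_le {f : E → ℝ} {z : E} (hf : ContDiffAt ℝ ∞ f z) (w : E)
    (m : ℕ) : ‖iteratedFDeriv ℝ m (dirDeriv w f) z‖ ≤ ‖w‖ * ‖iteratedFDeriv ℝ (m + 1) f z‖ := by
  have h1 : ContDiffAt ℝ ∞ (fderiv ℝ f) z := hf.fderiv_right (by simp)
  have h2 := ContinuousLinearMap.norm_iteratedFDeriv_comp_left
    (ContinuousLinearMap.apply ℝ ℝ w) h1 (n := m) (by exact_mod_cast le_top)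
  rw [norm_iteratedFDeriv_fderiv] at h2
  refine h2.trans ?_
  gcongr
  refine ContinuousLinearMap.opNorm_le_bound _ (norm_nonneg _) fun L => ?_
  simpa [mul_comm] using L.le_opNorm w

end DirectionalDerivative

/-! ### The Laplacian in the x-variables and its iterates -/

section Laplacian

variable {d p : ℕ}

/-- The unit vector of `x`-space in the `i`-th direction. -/
def xUnit (i : Fin d) : Z d p := (EuclideanSpace.basisFun (Fin d) ℝ i, 0)

theorem norm_xUnit (i : Fin d) : ‖(xUnit i : Z d p)‖ = 1 := by
  simp [xUnit, Prod.norm_def]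

/-- The slicewise Laplacian is rewritten through directional derivatives on the whole space;
smoothness in z = (x, u), commutation and norm bounds are then inherited from `dirDeriv`. -/
theorem xLap_eq_sum {f : Z d p → ℝ} {z : Z d p} (hf : ContDiffAt ℝ 2 f z) :
    xLap f z = ∑ i, dirDeriv (xUnit i) (dirDeriv (xUnit i) f) z := by
  unfold xLap
  rw [InnerProductSpace.laplacian_eq_iteratedFDeriv_orthonormalBasis _
    (EuclideanSpace.basisFun (Fin d) ℝ)]
  refine Finset.sum_congr rfl fun i _ => ?_
  rw [iteratedFDeriv_two_apply, dirDeriv_dirDeriv_eq hf]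
  have hemb : ∀ x : EuclideanSpace ℝ (Fin d), HasFDerivAt (fun x => (x, z.2))
      (ContinuousLinearMap.inl ℝ _ (EuclideanSpace ℝ (Fin p))) x := fun x =>
    hasFDerivAt_prodMk_left x z.2
  have hc : Continuous fun x : EuclideanSpace ℝ (Fin d) => (x, z.2) := by fun_prop
  have hev : ∀ᶠ x in 𝓝 z.1, DifferentiableAt ℝ f (x, z.2) := by
    have := (hf.eventually (by simp))
    exact (hc.tendsto z.1).eventually (this.mono fun y hy => hy.differentiableAt (by norm_num))
  have h1 : fderiv ℝ (fun x => f (x, z.2)) =ᶠ[𝓝 z.1] fun x =>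
      (fderiv ℝ f (x, z.2)).comp (ContinuousLinearMap.inl ℝ _ (EuclideanSpace ℝ (Fin p))) := by
    filter_upwards [hev] with x hx
    exact (hx.hasFDerivAt.comp x (hemb x)).fderiv
  rw [h1.fderiv_eq]
  have hd : DifferentiableAt ℝ (fderiv ℝ f) z :=
    (hf.fderiv_right (m := 1) (by norm_num)).differentiableAt (by norm_num)
  have h2 : HasFDerivAt (fun x => fderiv ℝ f (x, z.2))
      ((fderiv ℝ (fderiv ℝ f) z).comp (ContinuousLinearMap.inl ℝ _ _)) z.1 :=
    HasFDerivAt.comp z.1 (g := fderiv ℝ f) hd.hasFDerivAt (hemb z.1)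
  have h3 := h2.clm_comp (hasFDerivAt_const
    (ContinuousLinearMap.inl ℝ (EuclideanSpace ℝ (Fin d)) (EuclideanSpace ℝ (Fin p))) z.1)
  rw [h3.fderiv]
  simp [xUnit]

theorem xLap_congr {f g : Z d p → ℝ} {z : Z d p} (h : f =ᶠ[𝓝 z] g) :
    xLap f =ᶠ[𝓝 z] xLap g := by
  filter_upwards [h.eventually_nhds] with w hw
  unfold xLap
  have hc : Continuous fun x : EuclideanSpace ℝ (Fin d) => (x, w.2) := by fun_prop
  have h1 : (fun x => f (x, w.2)) =ᶠ[𝓝 w.1] fun x => g (x, w.2) :=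
    (hc.tendsto w.1).eventually hw
  exact (InnerProductSpace.laplacian_congr_nhds h1).self_of_nhds

theorem xLap_iterate_congr {f g : Z d p → ℝ} {z : Z d p} (h : f =ᶠ[𝓝 z] g) (k : ℕ) :
    xLap^[k] f =ᶠ[𝓝 z] xLap^[k] g := by
  induction k with
  | zero => simpa using h
  | succ k ih => rw [Function.iterate_succ_apply', Function.iterate_succ_apply']; exact xLap_congr ih

theorem xLap_eqOn {f g : Z d p → ℝ} {U : Set (Z d p)} (hU : IsOpen U) (h : EqOn f g U) :
    EqOn (xLap f) (xLap g) U := fun _ hz =>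
  (xLap_congr (h.eventuallyEq_of_mem (hU.mem_nhds hz))).self_of_nhds

theorem xLap_iterate_eqOn {f g : Z d p → ℝ} {U : Set (Z d p)} (hU : IsOpen U) (h : EqOn f g U)
    (k : ℕ) : EqOn (xLap^[k] f) (xLap^[k] g) U := fun _ hz =>
  (xLap_iterate_congr (h.eventuallyEq_of_mem (hU.mem_nhds hz)) k).self_of_nhds

theorem xLap_eventuallyEq_sum {f : Z d p → ℝ} {z : Z d p} (hf : ContDiffAt ℝ 2 f z) :
    xLap f =ᶠ[𝓝 z] fun w => ∑ i, dirDeriv (xUnit i) (dirDeriv (xUnit i) f) w :=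
  (hf.eventually (by simp)).mono fun _ hw => xLap_eq_sum hw

theorem contDiffAt_xLap {f : Z d p → ℝ} {z : Z d p} (hf : ContDiffAt ℝ ∞ f z) :
    ContDiffAt ℝ ∞ (xLap f) z :=
  (ContDiffAt.sum fun i _ => contDiffAt_infty_dirDeriv (contDiffAt_infty_dirDeriv hf _)
    (xUnit i)).congr_of_eventuallyEq (xLap_eventuallyEq_sum (hf.of_le two_le_infty))

theorem contDiffAt_xLap_iterate {f : Z d p → ℝ} {z : Z d p} (hf : ContDiffAt ℝ ∞ f z) (k : ℕ) :
    ContDiffAt ℝ ∞ (xLap^[k] f) z := by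
  induction k with
  | zero => simpa using hf
  | succ k ih => rw [Function.iterate_succ_apply']; exact contDiffAt_xLap ih

theorem analyticAt_xLap {f : Z d p → ℝ} {z : Z d p} (hf : AnalyticAt ℝ f z) :
    AnalyticAt ℝ (xLap f) z :=
  (Finset.analyticAt_fun_sum _ fun i _ => analyticAt_dirDeriv (analyticAt_dirDeriv hf _)
    (xUnit i)).congr (xLap_eventuallyEq_sum hf.contDiffAt).symm

theorem analyticAt_xLap_iterate {f : Z d p → ℝ} {z : Z d p} (hf : AnalyticAt ℝ f z) (k : ℕ) :
    AnalyticAt ℝ (xLap^[k] f) z := by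
  induction k with
  | zero => simpa using hf
  | succ k ih => rw [Function.iterate_succ_apply']; exact analyticAt_xLap ih

theorem xLap_add {f g : Z d p → ℝ} {z : Z d p} (hf : ContDiffAt ℝ 2 f z)
    (hg : ContDiffAt ℝ 2 g z) : xLap (fun w => f w + g w) z = xLap f z + xLap g z := by
  have hc : ContDiff ℝ 2 fun x : EuclideanSpace ℝ (Fin d) => (x, z.2) := by fun_prop
  exact ContDiffAt.laplacian_add (f₁ := fun x => f (x, z.2)) (f₂ := fun x => g (x, z.2))
    (ContDiffAt.comp z.1 hf hc.contDiffAt) (ContDiffAt.comp z.1 hg hc.contDiffAt)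

theorem xLap_const_mul {f : Z d p → ℝ} {z : Z d p} (hf : ContDiffAt ℝ 2 f z) (c : ℝ) :
    xLap (fun w => c * f w) z = c * xLap f z := by
  have hc : ContDiff ℝ 2 fun x : EuclideanSpace ℝ (Fin d) => (x, z.2) := by fun_prop
  exact InnerProductSpace.laplacian_smul (f := fun x => f (x, z.2)) c
    (ContDiffAt.comp z.1 hf hc.contDiffAt)

@[simp] theorem xLap_zero : xLap (fun _ : Z d p => (0 : ℝ)) = fun _ => 0 := by
  funext z
  simp [xLap, InnerProductSpace.laplacian_const]

@[simp] theorem xLap_iterate_zero (k : ℕ) : xLap^[k] (fun _ : Z d p => (0 : ℝ)) = fun _ => 0 := by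
  induction k with
  | zero => rfl
  | succ k ih => rw [Function.iterate_succ_apply', ih, xLap_zero]

theorem xLap_iterate_add {f g : Z d p → ℝ} {z : Z d p} (hf : ContDiffAt ℝ ∞ f z)
    (hg : ContDiffAt ℝ ∞ g z) (k : ℕ) :
    xLap^[k] (fun w => f w + g w) z = xLap^[k] f z + xLap^[k] g z := by
  induction k generalizing f g with
  | zero => rfl
  | succ k ih =>
    have h : xLap (fun w => f w + g w) =ᶠ[𝓝 z] fun w => xLap f w + xLap g w := by
      filter_upwards [(hf.of_le two_le_infty).eventually (by simp), (hg.of_le two_le_infty).eventually (by simp)]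
        with w h1 h2 using xLap_add h1 h2
    rw [Function.iterate_succ_apply, (xLap_iterate_congr h k).self_of_nhds,
      ih (contDiffAt_xLap hf) (contDiffAt_xLap hg)]
    rfl

theorem xLap_iterate_const_mul {f : Z d p → ℝ} {z : Z d p} (hf : ContDiffAt ℝ ∞ f z) (c : ℝ)
    (k : ℕ) : xLap^[k] (fun w => c * f w) z = c * xLap^[k] f z := by
  induction k generalizing f with
  | zero => rfl
  | succ k ih =>
    have h : xLap (fun w => c * f w) =ᶠ[𝓝 z] fun w => c * xLap f w := by
      filter_upwards [(hf.of_le two_le_infty).eventually (by simp)] with w h1 using xLap_const_mul h1 c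
    rw [Function.iterate_succ_apply, (xLap_iterate_congr h k).self_of_nhds,
      ih (contDiffAt_xLap hf)]
    rfl

/-- There are d unit directions, and each second directional derivative costs two orders of
differentiation and no constant. -/
theorem norm_iteratedFDeriv_xLap_le {f : Z d p → ℝ} {z : Z d p} (hf : ContDiffAt ℝ ∞ f z)
    (m : ℕ) : ‖iteratedFDeriv ℝ m (xLap f) z‖ ≤ d * ‖iteratedFDeriv ℝ (m + 2) f z‖ := by
  have h1 : ∀ i : Fin d, ContDiffAt ℝ m (dirDeriv (xUnit i) (dirDeriv (xUnit i) f)) z := fun i =>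
    (contDiffAt_infty_dirDeriv (contDiffAt_infty_dirDeriv hf _) _).of_le (by exact_mod_cast le_top)
  rw [((xLap_eventuallyEq_sum (hf.of_le two_le_infty)).iteratedFDeriv ℝ m).self_of_nhds,
    iteratedFDeriv_fun_sum_apply fun i _ => h1 i]
  refine (norm_sum_le _ _).trans ?_
  refine (Finset.sum_le_card_nsmul _ _ ‖iteratedFDeriv ℝ (m + 2) f z‖ fun i _ => ?_).trans ?_
  · have ha := norm_iteratedFDeriv_dirDeriv_le (contDiffAt_infty_dirDeriv hf (xUnit i)) (xUnit i) m
    have hb := norm_iteratedFDeriv_dirDeriv_le hf (xUnit i) (m + 1)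
    rw [norm_xUnit, one_mul] at ha hb
    exact ha.trans hb
  · simp

theorem norm_iteratedFDeriv_xLap_iterate_le {f : Z d p → ℝ} {z : Z d p} (hf : ContDiffAt ℝ ∞ f z)
    (m k : ℕ) : ‖iteratedFDeriv ℝ m (xLap^[k] f) z‖ ≤
      (d : ℝ) ^ k * ‖iteratedFDeriv ℝ (m + 2 * k) f z‖ := by
  induction k generalizing m with
  | zero => simp
  | succ k ih =>
    rw [Function.iterate_succ_apply']
    refine (norm_iteratedFDeriv_xLap_le (contDiffAt_xLap_iterate hf k) m).trans ?_
    calc (d : ℝ) * ‖iteratedFDeriv ℝ (m + 2) (xLap^[k] f) z‖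
        ≤ d * (d ^ k * ‖iteratedFDeriv ℝ (m + 2 + 2 * k) f z‖) := by gcongr; exact ih _
      _ = _ := by rw [show m + 2 + 2 * k = m + 2 * (k + 1) by ring]; ring

end Laplacian

/-! ### Cauchy estimates and real analyticity -/

section CauchyEstimates

variable {E : Type*} [NormedAddCommGroup E] [NormedSpace ℝ E]
  {G : Type*} [NormedAddCommGroup G] [NormedSpace ℝ G]

/-- `f` is smooth on `U` and its derivatives satisfy Cauchy estimates with constants `C`, `R`. -/
def CauchyOn (U : Set E) (f : E → ℝ) (C R : ℝ) : Prop :=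
  ContDiffOn ℝ ∞ f U ∧ ∀ z ∈ U, ∀ m : ℕ, ‖iteratedFDeriv ℝ m f z‖ ≤ C * R ^ m * (m ! : ℝ)

namespace CauchyOn

variable {U : Set E} {f g : E → ℝ} {C R C' R' : ℝ}

theorem contDiffAt (h : CauchyOn U f C R) (hU : IsOpen U) {z : E} (hz : z ∈ U) :
    ContDiffAt ℝ ∞ f z := h.1.contDiffAt (hU.mem_nhds hz)

theorem mono_set (h : CauchyOn U f C R) {U' : Set E} (hU : U' ⊆ U) : CauchyOn U' f C R :=
  ⟨h.1.mono hU, fun z hz => h.2 z (hU hz)⟩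

theorem mono (h : CauchyOn U f C R) (hC : C ≤ C') (hC' : 0 ≤ C') (hR : 0 ≤ R) (hR' : R ≤ R') :
    CauchyOn U f C' R' :=
  ⟨h.1, fun z hz m => (h.2 z hz m).trans (by gcongr)⟩

theorem abs_le (h : CauchyOn U f C R) {z : E} (hz : z ∈ U) : |f z| ≤ C := by
  simpa using h.2 z hz 0

theorem congr (h : CauchyOn U f C R) (hU : IsOpen U) (hfg : EqOn g f U) : CauchyOn U g C R :=
  ⟨h.1.congr hfg, fun z hz m => by
    rw [((hfg.eventuallyEq_of_mem (hU.mem_nhds hz)).iteratedFDeriv ℝ m).self_of_nhds]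
    exact h.2 z hz m⟩

theorem const_mul (hU : IsOpen U) (hf : CauchyOn U f C R) (c : ℝ) :
    CauchyOn U (fun z => c * f z) (|c| * C) R := by
  refine ⟨contDiffOn_const.mul hf.1, fun z hz m => ?_⟩
  have h1 : ContDiffAt ℝ m f z := (hf.contDiffAt hU hz).of_le (by exact_mod_cast le_top)
  have h2 : iteratedFDeriv ℝ m (fun z => c * f z) z = c • iteratedFDeriv ℝ m f z :=
    iteratedFDeriv_const_smul_apply (a := c) h1
  rw [h2, norm_smul, Real.norm_eq_abs]
  nlinarith [hf.2 z hz m, abs_nonneg c]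

/-- In the Leibniz formula the binomial coefficient and the two factorials combine to m!. The
remaining sum of R^i R'^(m-i) is dominated termwise by the binomial expansion of (R + R')^m. -/
theorem mul (hU : IsOpen U) (hf : CauchyOn U f C R) (hg : CauchyOn U g C' R')
    (hC : 0 ≤ C) (hC' : 0 ≤ C') (hR : 0 ≤ R) (hR' : 0 ≤ R') :
    CauchyOn U (fun z => f z * g z) (C * C') (R + R') := by
  refine ⟨hf.1.mul hg.1, fun z hz m => ?_⟩
  have h := norm_iteratedFDerivWithin_mul_le hf.1 hg.1 hU.uniqueDiffOn hz (n := m)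
    (by exact_mod_cast le_top)
  simp only [iteratedFDerivWithin_of_isOpen _ hU hz] at h
  refine h.trans ?_
  rw [add_pow, Finset.mul_sum, Finset.sum_mul]
  refine Finset.sum_le_sum fun i hi => ?_
  have hi' : i ≤ m := Nat.lt_succ_iff.1 (Finset.mem_range.1 hi)
  have hch : (m.choose i : ℝ) * i ! * (m - i)! = m ! := by
    exact_mod_cast Nat.choose_mul_factorial_mul_factorial hi'
  have hone : (1 : ℝ) ≤ m.choose i := by exact_mod_cast Nat.choose_pos hi'
  calc (m.choose i : ℝ) * ‖iteratedFDeriv ℝ i f z‖ * ‖iteratedFDeriv ℝ (m - i) g z‖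
      ≤ (m.choose i : ℝ) * (C * R ^ i * i !) * (C' * R' ^ (m - i) * (m - i)!) := by
        gcongr
        · exact hf.2 z hz i
        · exact hg.2 z hz (m - i)
    _ = (C * C' * (R ^ i * R' ^ (m - i))) * ((m.choose i : ℝ) * i ! * (m - i)!) := by ring
    _ = (C * C' * (R ^ i * R' ^ (m - i) * 1)) * m ! := by rw [hch]; ring
    _ ≤ C * C' * (R ^ i * R' ^ (m - i) * m.choose i) * m ! := by gcongr

end CauchyOn

theorem norm_iteratedFDeriv_comp_clm_le {U : Set E} (hU : IsOpen U) {f : E → ℝ}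
    (hf : ContDiffOn ℝ ∞ f U) (L : G →L[ℝ] E) (hL : ‖L‖ ≤ 1) {x : G} (hx : L x ∈ U) (m : ℕ) :
    ‖iteratedFDeriv ℝ m (fun y => f (L y)) x‖ ≤ ‖iteratedFDeriv ℝ m f (L x)‖ := by
  have hU' : IsOpen (L ⁻¹' U) := hU.preimage L.continuous
  have h := L.iteratedFDerivWithin_comp_right hf hU.uniqueDiffOn hU'.uniqueDiffOn hx
    (i := m) (by exact_mod_cast le_top)
  rw [iteratedFDerivWithin_of_isOpen _ hU hx, iteratedFDerivWithin_of_isOpen _ hU' hx] at h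
  change ‖iteratedFDeriv ℝ m (f ∘ L) x‖ ≤ _
  rw [h]
  refine (ContinuousMultilinearMap.norm_compContinuousLinearMap_le _ _).trans ?_
  refine mul_le_of_le_one_right (norm_nonneg _) ?_
  exact Finset.prod_le_one (fun _ _ => norm_nonneg _) fun _ _ => hL

theorem CauchyOn.comp_clm {U : Set E} (hU : IsOpen U) {f : E → ℝ} {C R : ℝ}
    (h : CauchyOn U f C R) (L : G →L[ℝ] E) (hL : ‖L‖ ≤ 1) :
    CauchyOn (L ⁻¹' U) (fun y => f (L y)) C R :=
  ⟨h.1.comp L.contDiff.contDiffOn fun _ hx => hx, fun _ hx m =>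
    (norm_iteratedFDeriv_comp_clm_le hU h.1 L hL hx m).trans (h.2 _ hx m)⟩

theorem norm_iteratedFDeriv_slice_le {W : Set (G × E)} (hW : IsOpen W) {f : G × E → ℝ}
    (hf : ContDiffOn ℝ ∞ f W) {q : G × E} (hq : q ∈ W) (m : ℕ) :
    ‖iteratedFDeriv ℝ m (fun z => f (q.1, z)) q.2‖ ≤ ‖iteratedFDeriv ℝ m f q‖ := by
  have h1 : ∀ y : E, f (q.1, y) = f ((q.1, (0 : E)) + ContinuousLinearMap.inr ℝ G E y) := by
    intro y; simp
  have hc : ContDiff ℝ ∞ fun w : G × E => (q.1, (0 : E)) + w := by fun_prop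
  have h2 := norm_iteratedFDeriv_comp_clm_le
    (U := (fun w => (q.1, (0 : E)) + w) ⁻¹' W) (hW.preimage hc.continuous)
    (f := fun w => f ((q.1, (0 : E)) + w)) (hf.comp hc.contDiffOn fun _ h => h)
    (ContinuousLinearMap.inr ℝ G E) (ContinuousLinearMap.norm_inr_le_one ℝ G E) (x := q.2)
    (by simpa using hq) m
  rw [iteratedFDeriv_comp_add_left] at h2
  simp only [h1]
  simpa using h2

theorem CauchyOn.slice {W : Set (G × E)} (hW : IsOpen W) {f : G × E → ℝ} {C R : ℝ}
    (h : CauchyOn W f C R) {q : G × E} (hq : q ∈ W) (m : ℕ) :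
    ‖iteratedFDeriv ℝ m (fun z => f (q.1, z)) q.2‖ ≤ C * R ^ m * (m ! : ℝ) :=
  (norm_iteratedFDeriv_slice_le hW h.1 hq m).trans (h.2 q hq m)

/-- The derivative of order m is m! times a binomial coefficient times x^(k-m). Bounding the
coefficient by 2^k gives a constant geometric in k, which is small when ε is. -/
theorem cauchyOn_pow {ε : ℝ} (hε : 0 < ε) (k : ℕ) :
    CauchyOn {x : ℝ | |x| < ε} (fun x => x ^ k) ((2 * ε) ^ k) (1 / ε) := by
  refine ⟨(contDiff_id.pow k).contDiffOn, fun x hx m => ?_⟩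
  have hx' : |x| ≤ ε := le_of_lt hx
  rw [norm_iteratedFDeriv_eq_norm_iteratedDeriv, iteratedDeriv_pow]
  rcases lt_or_ge k m with hkm | hkm
  · rw [Nat.descFactorial_of_lt hkm]
    simp only [Nat.cast_zero, zero_mul, norm_zero]
    positivity
  · rw [Nat.descFactorial_eq_factorial_mul_choose, norm_mul, norm_pow, Real.norm_eq_abs,
      Real.norm_eq_abs, Nat.cast_mul, abs_of_nonneg (by positivity)]
    have h1 : (k.choose m : ℝ) ≤ 2 ^ k := by exact_mod_cast Nat.choose_le_two_pow k m
    have h2 : ε ^ (k - m) = ε ^ k * (1 / ε) ^ m := by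
      rw [pow_sub₀ _ hε.ne' hkm, one_div, inv_pow]
    calc (m ! : ℝ) * k.choose m * |x| ^ (k - m) ≤ m ! * 2 ^ k * ε ^ (k - m) := by gcongr
      _ = _ := by rw [h2, mul_pow]; ring

/-- The derivatives of a function along a line. -/
theorem iteratedDerivWithin_line {U : Set E} (hU : IsOpen U) {f : E → ℝ} (hf : ContDiffOn ℝ ∞ f U)
    {z v : E} (hzv : ∀ t ∈ Icc (0 : ℝ) 1, z + t • v ∈ U) (k : ℕ) {t : ℝ} (ht : t ∈ Icc (0 : ℝ) 1) :
    iteratedDerivWithin k (fun t : ℝ => f (z + t • v)) (Icc 0 1) t =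
      iteratedFDeriv ℝ k f (z + t • v) fun _ => v := by
  induction k generalizing t with
  | zero => simp
  | succ k ih =>
    rw [iteratedDerivWithin_succ, derivWithin_congr (fun s hs => ih hs) (ih ht)]
    have hud : UniqueDiffWithinAt ℝ (Icc (0 : ℝ) 1) t := uniqueDiffOn_Icc zero_lt_one t ht
    have h1 : ContDiffAt ℝ ∞ f (z + t • v) := hf.contDiffAt (hU.mem_nhds (hzv t ht))
    have h2 : DifferentiableAt ℝ (iteratedFDeriv ℝ k f) (z + t • v) :=
      h1.differentiableAt_iteratedFDeriv (by exact_mod_cast ENat.natCast_lt_top k)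
    have h3 : HasDerivAt (fun t : ℝ => z + t • v) v t := by
      simpa using ((hasDerivAt_id t).smul_const v).const_add z
    have h4 := h2.hasFDerivAt.comp_hasDerivAt t h3
    have h5 := ((ContinuousMultilinearMap.apply ℝ (fun _ : Fin k => E) ℝ
      (fun _ => v)).hasFDerivAt.comp_hasDerivAt t h4)
    have h6 := h5.hasDerivWithinAt.derivWithin hud
    rw [iteratedFDeriv_succ_apply_left]
    exact h6

/-- Functions satisfying Cauchy estimates are the sums of their Taylor series. -/
theorem CauchyOn.hasSum_taylor {U : Set E} (hU : IsOpen U) {f : E → ℝ} {C R : ℝ}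
    (h : CauchyOn U f C R) (hR : 0 ≤ R) {z v : E}
    (hzv : ∀ t ∈ Icc (0 : ℝ) 1, z + t • v ∈ U) (hv : R * ‖v‖ < 1) :
    HasSum (fun k : ℕ => (k ! : ℝ)⁻¹ * iteratedFDeriv ℝ k f z fun _ => v) (f (z + v)) := by
  set q : ℝ := R * ‖v‖ with hq
  have hq0 : 0 ≤ q := by positivity
  have hz : z ∈ U := by simpa using hzv 0 (by simp)
  have hbd : ∀ y ∈ U, ∀ k : ℕ, ‖iteratedFDeriv ℝ k f y fun _ => v‖ ≤ C * q ^ k * k ! := by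
    intro y hy k
    refine (ContinuousMultilinearMap.le_opNorm _ _).trans ?_
    rw [Finset.prod_const, Finset.card_univ, Fintype.card_fin]
    calc _ ≤ C * R ^ k * k ! * ‖v‖ ^ k := by gcongr; exact h.2 y hy k
      _ = _ := by rw [hq, mul_pow]; ring
  have hgeo : Summable fun k : ℕ => C * q ^ k := (summable_geometric_of_lt_one hq0 hv).mul_left C
  have hsum : Summable fun k : ℕ => (k ! : ℝ)⁻¹ * iteratedFDeriv ℝ k f z fun _ => v := by
    refine Summable.of_norm_bounded hgeo fun k => ?_
    rw [norm_mul, norm_inv, Real.norm_natCast, inv_mul_le_iff₀ (by positivity), mul_comm (k ! : ℝ)]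
    exact hbd z hz k
  refine (hsum.hasSum_iff_tendsto_nat).2 ?_
  -- The Taylor polynomial of degree n has n + 1 terms. The next derivative is at most C q^(n+1)
  -- (n+1)!, so the remainder is at most C q^(n+1) (n+1), which tends to 0.
  rw [← tendsto_add_atTop_iff_nat 1]
  have hline : ContDiff ℝ ∞ fun t : ℝ => z + t • v := by fun_prop
  refine tendsto_iff_norm_sub_tendsto_zero.2 (squeeze_zero (fun _ => norm_nonneg _)
    (g := fun n : ℕ => C * q ^ (n + 1) * (n + 1 : ℕ)) (fun n => ?_) ?_)
  · have h1 := taylor_mean_remainder_bound (f := fun t : ℝ => f (z + t • v)) (a := 0) (b := 1)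
      (x := 1) (n := n) (C := C * q ^ (n + 1) * (n + 1)!) zero_le_one
      (ContDiffOn.of_le (h.1.comp hline.contDiffOn hzv) (by exact_mod_cast le_top)) (by simp)
      (fun y hy => by
        rw [iteratedDerivWithin_line hU h.1 hzv _ hy]
        exact hbd _ (hzv y hy) _)
    rw [taylor_within_apply] at h1
    simp only [sub_zero, one_pow, mul_one, one_smul, smul_eq_mul] at h1
    have h2 : ∀ k, iteratedDerivWithin k (fun t : ℝ => f (z + t • v)) (Icc 0 1) 0 =
        iteratedFDeriv ℝ k f z fun _ => v := fun k => by
      rw [iteratedDerivWithin_line hU h.1 hzv k (by simp)]; simp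
    simp only [h2] at h1
    rw [norm_sub_rev]
    refine h1.trans (le_of_eq ?_)
    rw [Nat.factorial_succ]
    push_cast
    field_simp
  · have h1 := (tendsto_self_mul_const_pow_of_lt_one hq0 hv).const_mul C
    rw [mul_zero] at h1
    have h2 := (tendsto_add_atTop_iff_nat 1).2 h1
    refine h2.congr fun n => by ring

/-- Only an expansion about the single centre z is required, so this also applies to limits of
functions whose Taylor data are known at one point. The radius is cut to 1/(R+1) to make R r ≤ 1. -/
theorem analyticAt_of_hasSum {f : E → ℝ} {P : FormalMultilinearSeries ℝ E ℝ} {C R δ : ℝ} {z : E}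
    (hR : 0 ≤ R) (hδ : 0 < δ) (hP : ∀ k, ‖P k‖ ≤ C * R ^ k)
    (h : ∀ v : E, ‖v‖ < δ → HasSum (fun k : ℕ => P k fun _ => v) (f (z + v))) :
    AnalyticAt ℝ f z := by
  have hC : 0 ≤ C := by simpa using (norm_nonneg _).trans (hP 0)
  set r : ℝ := min δ (1 / (R + 1)) with hr
  have hr0 : 0 < r := lt_min hδ (by positivity)
  have hRr : R * r ≤ 1 := by
    calc R * r ≤ (R + 1) * (1 / (R + 1)) := by gcongr; linarith; exact min_le_right _ _
      _ = 1 := by field_simp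
  refine ⟨P, ENNReal.ofReal r, ?_, by simpa using hr0, ?_⟩
  · have := P.le_radius_of_bound C (r := r.toNNReal) fun n => by
      rw [Real.coe_toNNReal _ hr0.le]
      calc ‖P n‖ * r ^ n ≤ C * R ^ n * r ^ n := by gcongr; exact hP n
        _ = C * (R * r) ^ n := by rw [mul_pow]; ring
        _ ≤ C * 1 := by gcongr; exact pow_le_one₀ (by positivity) hRr
        _ = C := mul_one C
    exact this
  · intro y hy
    refine h y (lt_of_lt_of_le ?_ (min_le_left _ _ : r ≤ δ))
    rw [Metric.mem_eball, edist_zero_right, ← ofReal_norm] at hy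
    exact (ENNReal.ofReal_lt_ofReal_iff hr0).1 hy

theorem ball_segment {z v : E} {δ : ℝ} (hv : ‖v‖ < δ) {t : ℝ} (ht : t ∈ Icc (0 : ℝ) 1) :
    z + t • v ∈ Metric.ball z δ := by
  rw [Metric.mem_ball, dist_eq_norm, add_sub_cancel_left, norm_smul, Real.norm_eq_abs,
    abs_of_nonneg ht.1]
  exact (mul_le_of_le_one_left (norm_nonneg _) ht.2).trans_lt hv

theorem CauchyOn.analyticAt {U : Set E} (hU : IsOpen U) {f : E → ℝ} {C R : ℝ}
    (h : CauchyOn U f C R) (hR : 0 ≤ R) {z : E} (hz : z ∈ U) :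
    AnalyticAt ℝ f z := by
  obtain ⟨δ, hδ, hball⟩ := Metric.isOpen_iff.1 hU z hz
  refine analyticAt_of_hasSum (P := fun k => (k ! : ℝ)⁻¹ • iteratedFDeriv ℝ k f z) (C := C) hR
    (lt_min hδ (by positivity : 0 < 1 / (R + 1))) (fun k => ?_) fun v hv => ?_
  · rw [norm_smul, norm_inv, Real.norm_natCast, inv_mul_le_iff₀ (by positivity),
      mul_comm (k ! : ℝ)]
    exact h.2 z hz k
  · refine h.hasSum_taylor hU hR
      (fun t ht => hball (ball_segment (hv.trans_le (min_le_left _ _)) ht)) ?_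
    calc R * ‖v‖ ≤ R * (1 / (R + 1)) := by
          gcongr; exact hv.le.trans (min_le_right _ _)
      _ < 1 := by rw [mul_one_div, div_lt_one (by positivity)]; linarith

/-- Real analytic functions satisfy Cauchy estimates locally. -/
theorem exists_cauchyOn_of_analyticAt {f : E → ℝ} {z : E} (hf : AnalyticAt ℝ f z) :
    ∃ δ C R : ℝ, 0 < δ ∧ 0 ≤ C ∧ 0 ≤ R ∧ CauchyOn (Metric.ball z δ) f C R := by
  obtain ⟨P, r, hP⟩ := hf
  -- One r0 is spent on moving the centre to a nearby point, the other on the variable of the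
  -- re-expanded series; the total stays inside the radius of convergence.
  obtain ⟨r0, hr0, hr0'⟩ : ∃ r0 : NNReal, 0 < r0 ∧ (r0 + r0 : ENNReal) < r := by
    obtain ⟨a, ha0, ha⟩ := ENNReal.lt_iff_exists_nnreal_btwn.1 hP.r_pos
    refine ⟨a / 2, half_pos (by exact_mod_cast ha0), ?_⟩
    rw [← ENNReal.coe_add, add_halves]; exact ha
  have hrad : (r0 + r0 : ENNReal) < P.radius := hr0'.trans_le hP.r_le
  have hr0r : (r0 : ENNReal) < r := lt_of_le_of_lt le_self_add hr0'
  have hS := P.changeOriginSeries_summable_aux₁ hrad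
  set S := ∑' s : Σ k l : ℕ, { s : Finset (Fin (k + l)) // s.card = l },
      ‖P (s.1 + s.2.1)‖₊ * r0 ^ s.2.1 * r0 ^ s.1 with hSdef
  have hball : ∀ y ∈ Metric.ball z (r0 : ℝ), ‖y - z‖₊ < r0 := fun y hy => by
    rw [Metric.mem_ball, dist_eq_norm] at hy; exact_mod_cast hy
  refine ⟨r0, S, 1 / r0, by exact_mod_cast hr0, S.2, by positivity, ?_, ?_⟩
  · intro y hy
    refine ((hP.analyticAt_of_mem ?_).contDiffAt).contDiffWithinAt
    rw [Metric.mem_eball, edist_eq_enorm_sub]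
    exact lt_trans (by exact_mod_cast hball y hy) hr0r
  · intro y hy m
    have hy' := hball y hy
    have hyr : (‖y - z‖₊ : ENNReal) < r := lt_trans (by exact_mod_cast hy') hr0r
    have h1 := hP.changeOrigin hyr
    rw [add_sub_cancel] at h1
    have h2 : ‖P.changeOrigin (y - z) m‖₊ * r0 ^ m ≤ S := by
      have h3 := P.nnnorm_changeOrigin_le m (x := y - z) (hyr.trans_le hP.r_le)
      have h4 := (NNReal.summable_sigma.1 hS).1 m
      have h5 := (NNReal.summable_sigma.1 hS).2
      have h6 : ∑' s : Σ l : ℕ, { s : Finset (Fin (m + l)) // s.card = l },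
          ‖P (m + s.1)‖₊ * r0 ^ s.1 * r0 ^ m ≤ S := by
        rw [hSdef, hS.tsum_sigma' (fun k => (NNReal.summable_sigma.1 hS).1 k)]
        exact h5.le_tsum m fun _ _ => zero_le
      refine le_trans ?_ h6
      rw [NNReal.tsum_mul_right]
      gcongr
      refine h3.trans ?_
      have h7 := P.changeOriginSeries_summable_aux₂
        (lt_of_le_of_lt le_self_add hrad : (r0 : ENNReal) < P.radius) m
      have h8 := P.changeOriginSeries_summable_aux₂
        (r := ‖y - z‖₊) (hyr.trans_le hP.r_le) m
      exact h8.tsum_le_tsum (fun s => by gcongr) h7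
    have h3 : ‖P.changeOrigin (y - z) m‖ ≤ S * (1 / r0) ^ m := by
      have : ‖P.changeOrigin (y - z) m‖ * (r0 : ℝ) ^ m ≤ S := by exact_mod_cast h2
      rw [one_div, inv_pow, ← div_eq_mul_inv, le_div_iff₀ (by positivity)]
      exact this
    refine ContinuousMultilinearMap.opNorm_le_bound (by positivity) fun v => ?_
    -- The iterated derivative sums the coefficient over all permutations of its arguments; their
    -- number supplies the m! of the Cauchy estimate.
    rw [h1.iteratedFDeriv_eq_sum_of_completeSpace]
    refine (norm_sum_le _ _).trans ?_
    refine (Finset.sum_le_card_nsmul _ _ (S * (1 / r0) ^ m * ∏ i, ‖v i‖) fun σ _ => ?_).trans ?_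
    · refine (ContinuousMultilinearMap.le_opNorm _ _).trans ?_
      rw [Equiv.prod_comp σ fun i => ‖v i‖]
      gcongr
    · rw [Finset.card_univ, Fintype.card_perm, Fintype.card_fin, nsmul_eq_mul]
      apply le_of_eq; ring

end CauchyEstimates

theorem factorial_add_le (m k : ℕ) : ((m + k)! : ℝ) ≤ 2 ^ (m + k) * (m ! * k !) := by
  have h := Nat.add_choose_mul_factorial_mul_factorial m k
  have h2 : (((m + k).choose k : ℕ) : ℝ) ≤ 2 ^ (m + k) := by
    exact_mod_cast Nat.choose_le_two_pow (m + k) k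
  have h3 : ((m + k)! : ℝ) = ((m + k).choose k : ℕ) * (m ! * k !) := by
    rw [← h]; push_cast; ring
  rw [h3]; gcongr

/-- Here (m + 2k)! is split as 2^(m+2k) m! (2k)!: the factor 2^m doubles R, 4^k joins the geometric
constant, and (2k)! is the growth that the coefficients of the solution series have to beat. -/
theorem CauchyOn.xLap_iterate {d p : ℕ} {U : Set (Z d p)} (hU : IsOpen U) {f : Z d p → ℝ}
    {C R : ℝ} (h : CauchyOn U f C R) (hC : 0 ≤ C) (hR : 0 ≤ R) (k : ℕ) :
    CauchyOn U (xLap^[k] f) (C * (4 * d * R ^ 2) ^ k * (2 * k)!) (2 * R) := by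
  refine ⟨fun z hz => (contDiffAt_xLap_iterate (h.contDiffAt hU hz) k).contDiffWithinAt,
    fun z hz m => ?_⟩
  refine (norm_iteratedFDeriv_xLap_iterate_le (h.contDiffAt hU hz) m k).trans ?_
  calc (d : ℝ) ^ k * ‖iteratedFDeriv ℝ (m + 2 * k) f z‖
      ≤ d ^ k * (C * R ^ (m + 2 * k) * (2 ^ (m + 2 * k) * (m ! * (2 * k)!))) := by
        gcongr
        refine (h.2 z hz _).trans ?_
        gcongr
        exact factorial_add_le m (2 * k)
    _ = _ := by rw [pow_add, pow_add, pow_mul, pow_mul, mul_pow, mul_pow, mul_pow]; norm_num; ring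

/-! ### Differentiation under the integral sign to all orders -/

section ParametricIntegral

variable {X : Type*} [MeasurableSpace X] {μ : Measure X}
  {E : Type*} [NormedAddCommGroup E] [NormedSpace ℝ E]

/-- A family of functions that are smooth on `U`, whose derivatives are measurable in the parameter
and locally dominated by integrable functions. -/
structure DominatedFamily (μ : Measure X) (U : Set E) (K : X → E → ℝ) : Prop where
  contDiffAt : ∀ z ∈ U, ∀ x, ContDiffAt ℝ ∞ (K x) z
  measurable : ∀ z ∈ U, ∀ k : ℕ, AEStronglyMeasurable (fun x => iteratedFDeriv ℝ k (K x) z) μ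
  bound : ∀ z ∈ U, ∀ k : ℕ, ∃ g : X → ℝ, Integrable g μ ∧
    ∀ᶠ w in 𝓝 z, ∀ x, ‖iteratedFDeriv ℝ k (K x) w‖ ≤ g x

namespace DominatedFamily

variable {U : Set E} {K : X → E → ℝ}

theorem integrable (h : DominatedFamily μ U K) {z : E} (hz : z ∈ U) (k : ℕ) :
    Integrable (fun x => iteratedFDeriv ℝ k (K x) z) μ := by
  obtain ⟨g, hg, hb⟩ := h.bound z hz k
  exact hg.mono' (h.measurable z hz k) (Eventually.of_forall fun x => hb.self_of_nhds x)

/-- The bound of order k + 1 dominates the derivative of the order-k integrand; currying is a linear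
isometry and passes through the integral. -/
theorem hasFDerivAt (h : DominatedFamily μ U K) (hU : IsOpen U) {z : E} (hz : z ∈ U) (k : ℕ) :
    HasFDerivAt (fun w => ∫ x, iteratedFDeriv ℝ k (K x) w ∂μ)
      ((∫ x, iteratedFDeriv ℝ (k + 1) (K x) z ∂μ).curryLeft) z := by
  obtain ⟨g, hg, hb⟩ := h.bound z hz (k + 1)
  let I := continuousMultilinearCurryLeftEquiv ℝ (fun _ : Fin (k + 1) => E) ℝ
  have hI : ∀ x, ∀ w, fderiv ℝ (iteratedFDeriv ℝ k (K x)) w =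
      I (iteratedFDeriv ℝ (k + 1) (K x) w) := fun x w => by
    rw [iteratedFDeriv_succ_eq_comp_left]; simp [I]
  have hs : {w | w ∈ U ∧ ∀ x, ‖iteratedFDeriv ℝ (k + 1) (K x) w‖ ≤ g x} ∈ 𝓝 z :=
    (hU.eventually_mem hz).and hb
  have key := hasFDerivAt_integral_of_dominated_of_fderiv_le (μ := μ) (𝕜 := ℝ)
    (F := fun w x => iteratedFDeriv ℝ k (K x) w)
    (F' := fun w x => fderiv ℝ (iteratedFDeriv ℝ k (K x)) w) (bound := g) hs
    (by filter_upwards [hU.mem_nhds hz] with w hw using h.measurable w hw k)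
    (h.integrable hz k)
    (by
      simp only [hI]
      exact I.continuous.comp_aestronglyMeasurable (h.measurable z hz (k + 1)))
    (Eventually.of_forall fun x w hw => by
      rw [norm_fderiv_iteratedFDeriv]; exact hw.2 x) hg
    (Eventually.of_forall fun x w hw =>
      ((h.contDiffAt w hw.1 x).differentiableAt_iteratedFDeriv
        (by exact_mod_cast ENat.natCast_lt_top k)).hasFDerivAt)
  have hint : ∫ x, fderiv ℝ (iteratedFDeriv ℝ k (K x)) z ∂μ =
      I (∫ x, iteratedFDeriv ℝ (k + 1) (K x) z ∂μ) := by
    let L : (E [×(k + 1)]→L[ℝ] ℝ) →L[ℝ] (E →L[ℝ] E [×k]→L[ℝ] ℝ) :=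
      I.toContinuousLinearEquiv.toContinuousLinearMap
    have h1 := ContinuousLinearMap.integral_comp_comm (𝕜 := ℝ) (E := E [×(k + 1)]→L[ℝ] ℝ)
      (Fₗ := E →L[ℝ] E [×k]→L[ℝ] ℝ) L (h.integrable hz (k + 1))
    exact (integral_congr_ae (Eventually.of_forall fun x => hI x z)).trans h1
  rw [hint] at key
  exact key

/-- The integrated derivatives form a Taylor series, which gives smoothness and the formula for
every derivative at once. -/
theorem hasFTaylorSeriesUpToOn (h : DominatedFamily μ U K) (hU : IsOpen U) :
    HasFTaylorSeriesUpToOn ∞ (fun z => ∫ x, K x z ∂μ)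
      (fun z k => ∫ x, iteratedFDeriv ℝ k (K x) z ∂μ) U where
  zero_eq z hz := by
    have := ContinuousMultilinearMap.integral_apply (h.integrable hz 0) 0
    simpa [ContinuousMultilinearMap.curry0] using this
  fderivWithin k _ z hz := (h.hasFDerivAt hU hz k).hasFDerivWithinAt
  cont k _ z hz := (h.hasFDerivAt hU hz k).continuousAt.continuousWithinAt

theorem contDiffOn (h : DominatedFamily μ U K) (hU : IsOpen U) :
    ContDiffOn ℝ ∞ (fun z => ∫ x, K x z ∂μ) U :=
  fun z hz => (h.hasFTaylorSeriesUpToOn hU).contDiffOn z hz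

theorem iteratedFDeriv_integral (h : DominatedFamily μ U K) (hU : IsOpen U) {z : E} (hz : z ∈ U)
    (k : ℕ) : iteratedFDeriv ℝ k (fun z => ∫ x, K x z ∂μ) z =
      ∫ x, iteratedFDeriv ℝ k (K x) z ∂μ := by
  rw [← iteratedFDerivWithin_of_isOpen _ hU hz]
  exact ((h.hasFTaylorSeriesUpToOn hU).eq_iteratedFDerivWithin_of_uniqueDiffOn
    (by exact_mod_cast le_top) hU.uniqueDiffOn hz).symm

theorem integral_dirDeriv (h : DominatedFamily μ U K) (hU : IsOpen U) {z : E} (hz : z ∈ U)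
    (w : E) : dirDeriv w (fun z => ∫ x, K x z ∂μ) z = ∫ x, dirDeriv w (K x) z ∂μ := by
  have h1 := h.iteratedFDeriv_integral hU hz 1
  have h2 := congrArg (fun L => L (fun _ => w)) h1
  rw [ContinuousMultilinearMap.integral_apply (h.integrable hz 1)] at h2
  simp only [iteratedFDeriv_one_apply] at h2
  exact h2

theorem dirDeriv (h : DominatedFamily μ U K) (hU : IsOpen U) (w : E) :
    DominatedFamily μ U fun x => dirDeriv w (K x) where
  contDiffAt z hz x := contDiffAt_infty_dirDeriv (h.contDiffAt z hz x) w
  measurable z hz k := by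
    let I := continuousMultilinearCurryRightEquiv' ℝ k E ℝ
    let L := ContinuousLinearMap.compContinuousMultilinearMapL ℝ (fun _ : Fin k => E) (E →L[ℝ] ℝ) ℝ
      (ContinuousLinearMap.apply ℝ ℝ w)
    have h1 : ∀ x, iteratedFDeriv ℝ k (PPWave.dirDeriv w (K x)) z =
        L (I (iteratedFDeriv ℝ (k + 1) (K x) z)) := fun x => by
      have h2 : ContDiffAt ℝ ∞ (fderiv ℝ (K x)) z := (h.contDiffAt z hz x).fderiv_right (by simp)
      have h3 := ContinuousLinearMap.iteratedFDeriv_comp_left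
        (ContinuousLinearMap.apply ℝ ℝ w) h2 (i := k) (by exact_mod_cast le_top)
      rw [iteratedFDeriv_succ_eq_comp_right]
      simp only [Function.comp_apply, I, L, LinearIsometryEquiv.apply_symm_apply]
      exact h3
    simp only [h1]
    exact (L.continuous.comp I.continuous).comp_aestronglyMeasurable (h.measurable z hz (k + 1))
  bound z hz k := by
    obtain ⟨g, hg, hb⟩ := h.bound z hz (k + 1)
    refine ⟨fun x => ‖w‖ * g x, hg.const_mul _, ?_⟩
    filter_upwards [hb, hU.mem_nhds hz] with y hy hyU x
    refine (norm_iteratedFDeriv_dirDeriv_le (h.contDiffAt y hyU x) w k).trans ?_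
    gcongr
    exact hy x

end DominatedFamily

section

variable {d p : ℕ} {U : Set (Z d p)} {K : X → Z d p → ℝ}

theorem DominatedFamily.xLap (h : DominatedFamily μ U K) (hU : IsOpen U) :
    DominatedFamily μ U fun x => xLap (K x) where
  contDiffAt z hz x := contDiffAt_xLap (h.contDiffAt z hz x)
  measurable z hz k := by
    have h1 : ∀ x, iteratedFDeriv ℝ k (PPWave.xLap (K x)) z = ∑ i : Fin d,
        iteratedFDeriv ℝ k (PPWave.dirDeriv (xUnit i) (PPWave.dirDeriv (xUnit i) (K x))) z :=
      fun x => by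
        have hx := h.contDiffAt z hz x
        rw [((xLap_eventuallyEq_sum (hx.of_le two_le_infty)).iteratedFDeriv ℝ k).self_of_nhds,
          iteratedFDeriv_fun_sum_apply fun i _ => (contDiffAt_infty_dirDeriv
            (contDiffAt_infty_dirDeriv hx _) _).of_le (by exact_mod_cast le_top)]
    simp only [h1]
    exact Finset.aestronglyMeasurable_fun_sum _ fun i _ =>
      ((h.dirDeriv hU (xUnit i)).dirDeriv hU (xUnit i)).measurable z hz k
  bound z hz k := by
    obtain ⟨g, hg, hb⟩ := h.bound z hz (k + 2)
    refine ⟨fun x => d * g x, hg.const_mul _, ?_⟩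
    filter_upwards [hb, hU.mem_nhds hz] with w hw hwU x
    refine (norm_iteratedFDeriv_xLap_le (h.contDiffAt w hwU x) k).trans ?_
    gcongr
    exact hw x

theorem DominatedFamily.integrable_apply (h : DominatedFamily μ U K) {z : Z d p} (hz : z ∈ U) :
    Integrable (fun x => K x z) μ := by
  have h1 := (ContinuousMultilinearMap.apply ℝ (fun _ : Fin 0 => Z d p) ℝ 0).integrable_comp
    (h.integrable hz 0)
  simpa using h1

theorem DominatedFamily.xLap_integral (h : DominatedFamily μ U K) (hU : IsOpen U) {z : Z d p}
    (hz : z ∈ U) :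
    PPWave.xLap (fun z => ∫ x, K x z ∂μ) z = ∫ x, PPWave.xLap (K x) z ∂μ := by
  rw [xLap_eq_sum (((h.contDiffOn hU).contDiffAt (hU.mem_nhds hz)).of_le two_le_infty)]
  have h1 : ∀ x, PPWave.xLap (K x) z = ∑ i : Fin d,
      PPWave.dirDeriv (xUnit i) (PPWave.dirDeriv (xUnit i) (K x)) z := fun x =>
    xLap_eq_sum ((h.contDiffAt z hz x).of_le two_le_infty)
  simp only [h1]
  rw [integral_finsetSum _ fun i _ =>
    ((h.dirDeriv hU (xUnit i)).dirDeriv hU (xUnit i)).integrable_apply hz]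
  refine Finset.sum_congr rfl fun i _ => ?_
  have h2 : PPWave.dirDeriv (xUnit i) (fun z => ∫ x, K x z ∂μ) =ᶠ[𝓝 z]
      fun z => ∫ x, PPWave.dirDeriv (xUnit i) (K x) z ∂μ := by
    filter_upwards [hU.mem_nhds hz] with w hw using h.integral_dirDeriv hU hw _
  rw [(dirDeriv_congr h2 _).self_of_nhds]
  exact (h.dirDeriv hU (xUnit i)).integral_dirDeriv hU hz _

theorem DominatedFamily.xLap_iterate (h : DominatedFamily μ U K) (hU : IsOpen U) (k : ℕ) :
    DominatedFamily μ U fun x => PPWave.xLap^[k] (K x) := by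
  induction k with
  | zero => simpa using h
  | succ k ih => simpa only [Function.iterate_succ_apply'] using ih.xLap hU

theorem DominatedFamily.xLap_iterate_integral (h : DominatedFamily μ U K) (hU : IsOpen U)
    (k : ℕ) : EqOn (PPWave.xLap^[k] fun z => ∫ x, K x z ∂μ)
      (fun z => ∫ x, PPWave.xLap^[k] (K x) z ∂μ) U := by
  induction k with
  | zero => intro z _; rfl
  | succ k ih =>
    intro z hz
    rw [Function.iterate_succ_apply', xLap_eqOn hU ih hz,
      (h.xLap_iterate hU k).xLap_integral hU hz]
    simp only [Function.iterate_succ_apply']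

end

end ParametricIntegral

/-! ### Termwise differentiation of series -/

section SeriesOfFunctions

variable {E : Type*} [NormedAddCommGroup E] [NormedSpace ℝ E]

theorem integrable_count_geometric (c : ℝ) {θ : ℝ} (h0 : 0 ≤ θ) (h1 : θ < 1) :
    Integrable (fun k : ℕ => c * θ ^ k) Measure.count :=
  integrable_count_iff.2 ((summable_geometric_of_lt_one h0 h1).mul_left c).norm

/-- A series is an integral against counting measure, so the theorems on parametric integrals apply,
with the geometric sequence θ^k as dominating function. -/
theorem dominatedFamily_count {U : Set E} (hU : IsOpen U) {K : ℕ → E → ℝ} {C R θ : ℝ}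
    (h0 : 0 ≤ θ) (h1 : θ < 1) (h : ∀ k, CauchyOn U (K k) (C * θ ^ k) R) :
    DominatedFamily Measure.count U K where
  contDiffAt _ hz k := (h k).contDiffAt hU hz
  measurable _ _ _ := .of_discrete
  bound z hz m := by
    refine ⟨fun k => (C * R ^ m * m !) * θ ^ k, integrable_count_geometric _ h0 h1, ?_⟩
    filter_upwards [hU.mem_nhds hz] with w hw k
    refine ((h k).2 w hw m).trans (le_of_eq ?_)
    ring

theorem summable_of_cauchyOn {U : Set E} {K : ℕ → E → ℝ} {C R θ : ℝ}
    (h0 : 0 ≤ θ) (h1 : θ < 1) (h : ∀ k, CauchyOn U (K k) (C * θ ^ k) R) {z : E} (hz : z ∈ U) :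
    Summable fun k => K k z :=
  Summable.of_norm_bounded ((summable_geometric_of_lt_one h0 h1).mul_left C) fun k => by
    simpa using (h k).abs_le hz

theorem integral_count_eq_tsum {F : Type*} [NormedAddCommGroup F] [NormedSpace ℝ F]
    [CompleteSpace F] {f : ℕ → F} (hf : Integrable f Measure.count) :
    ∫ k, f k ∂Measure.count = ∑' k, f k := by
  rw [integral_countable hf]
  simp [Measure.real]

theorem cauchyOn_tsum {U : Set E} (hU : IsOpen U) {K : ℕ → E → ℝ} {C R θ : ℝ}
    (h0 : 0 ≤ θ) (h1 : θ < 1) (h : ∀ k, CauchyOn U (K k) (C * θ ^ k) R) :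
    CauchyOn U (fun z => ∑' k, K k z) (C / (1 - θ)) R := by
  have hD := dominatedFamily_count hU h0 h1 h
  have heq : EqOn (fun z => ∑' k, K k z) (fun z => ∫ k, K k z ∂Measure.count) U := fun z hz => by
    refine (integral_count_eq_tsum (f := fun k => K k z) ?_).symm
    exact integrable_count_iff.2 (summable_of_cauchyOn h0 h1 h hz).norm
  refine CauchyOn.congr ⟨hD.contDiffOn hU, fun z hz m => ?_⟩ hU heq
  rw [hD.iteratedFDeriv_integral hU hz]
  refine (norm_integral_le_integral_norm _).trans ?_
  have hi := integrable_count_geometric (C * R ^ m * m !) h0 h1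
  refine (integral_mono (hD.integrable hz m).norm hi fun k => ?_).trans (le_of_eq ?_)
  · refine ((h k).2 z hz m).trans (le_of_eq ?_)
    ring
  · rw [integral_count_eq_tsum hi, tsum_mul_left, tsum_geometric_of_lt_one h0 h1]
    ring

theorem dirDeriv_tsum {U : Set E} (hU : IsOpen U) {K : ℕ → E → ℝ} {C R θ : ℝ}
    (h0 : 0 ≤ θ) (h1 : θ < 1) (h : ∀ k, CauchyOn U (K k) (C * θ ^ k) R) {z : E} (hz : z ∈ U)
    (w : E) : HasSum (fun k => dirDeriv w (K k) z) (dirDeriv w (fun z => ∑' k, K k z) z) := by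
  have hD := dominatedFamily_count hU h0 h1 h
  have heq : EqOn (fun z => ∑' k, K k z) (fun z => ∫ k, K k z ∂Measure.count) U := fun z hz => by
    refine (integral_count_eq_tsum (f := fun k => K k z) ?_).symm
    exact integrable_count_iff.2 (summable_of_cauchyOn h0 h1 h hz).norm
  have hi : Integrable (fun k => dirDeriv w (K k) z) Measure.count := by
    have h2 := (ContinuousMultilinearMap.apply ℝ (fun _ : Fin 1 => E) ℝ
      (fun _ => w)).integrable_comp (hD.integrable hz 1)
    simp only [ContinuousMultilinearMap.apply_apply, iteratedFDeriv_one_apply] at h2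
    exact h2
  rw [(dirDeriv_congr (heq.eventuallyEq_of_mem (hU.mem_nhds hz)) w).self_of_nhds,
    hD.integral_dirDeriv hU hz, integral_count_eq_tsum hi]
  exact (integrable_count_iff.1 hi).of_norm.hasSum

theorem xLap_tsum {d p : ℕ} {U : Set (Z d p)} (hU : IsOpen U) {K : ℕ → Z d p → ℝ} {C R θ : ℝ}
    (h0 : 0 ≤ θ) (h1 : θ < 1) (h : ∀ k, CauchyOn U (K k) (C * θ ^ k) R) {z : Z d p} (hz : z ∈ U) :
    HasSum (fun k => xLap (K k) z) (xLap (fun z => ∑' k, K k z) z) := by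
  have hD := dominatedFamily_count hU h0 h1 h
  have heq : EqOn (fun z => ∑' k, K k z) (fun z => ∫ k, K k z ∂Measure.count) U := fun z hz => by
    refine (integral_count_eq_tsum (f := fun k => K k z) ?_).symm
    exact integrable_count_iff.2 (summable_of_cauchyOn h0 h1 h hz).norm
  have hi := (hD.xLap hU).integrable_apply hz
  rw [xLap_eqOn hU heq hz, hD.xLap_integral hU hz, integral_count_eq_tsum hi]
  exact (integrable_count_iff.1 hi).of_norm.hasSum

end SeriesOfFunctions

/-! ### Power series in ϱ with coefficients depending on z -/

section RhoSeries

variable {E : Type*} [NormedAddCommGroup E] [NormedSpace ℝ E]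

theorem eventually_nhds_zero_prod {E : Type*} [NormedAddCommGroup E] {z₀ : E} {P : ℝ × E → Prop}
    {δ ε : ℝ} (hδ : 0 < δ) (hε : 0 < ε) (h : ∀ q ∈ {r : ℝ | |r| < ε} ×ˢ Metric.ball z₀ δ, P q) :
    ∀ᶠ q in 𝓝 ((0 : ℝ), z₀), P q := by
  have hS : IsOpen {r : ℝ | |r| < ε} := isOpen_lt continuous_abs continuous_const
  filter_upwards [(hS.prod Metric.isOpen_ball).mem_nhds
    (show ((0 : ℝ), z₀) ∈ {r : ℝ | |r| < ε} ×ˢ Metric.ball z₀ δ by simp [hδ, hε])] with q hq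
  exact h q hq

/-- The power series `∑ b_k(z) ϱ^k`. -/
def rhoSeries (b : ℕ → E → ℝ) (r : ℝ) (z : E) : ℝ := ∑' k, b k z * r ^ k

/-- Near `z₀`, the coefficients `b_k` satisfy Cauchy estimates that grow at most geometrically. -/
def GeometricCauchy (z₀ : E) (b : ℕ → E → ℝ) : Prop :=
  ∃ δ C R M : ℝ, 0 < δ ∧ 0 ≤ C ∧ 0 ≤ R ∧ 1 ≤ M ∧
    ∀ k, CauchyOn (Metric.ball z₀ δ) (b k) (C * M ^ k) R

/-- With ε = 1/(4M) in `cauchyOn_pow` the growth M^k meets (2ε)^k and leaves 2^(-k), so the terms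
are summable jointly in (ϱ, z). -/
theorem cauchyOn_rhoSeries_term {U : Set E} (hU : IsOpen U) {b : ℕ → E → ℝ} {C R M : ℝ}
    (hC : 0 ≤ C) (hR : 0 ≤ R) (hM : 1 ≤ M) (h : ∀ k, CauchyOn U (b k) (C * M ^ k) R) (k : ℕ) :
    CauchyOn ({r : ℝ | |r| < 1 / (4 * M)} ×ˢ U) (fun q : ℝ × E => b k q.2 * q.1 ^ k)
      (C * (1 / 2) ^ k) (R + 4 * M) := by
  have hM0 : 0 < M := by linarith
  have hS : IsOpen {r : ℝ | |r| < 1 / (4 * M)} := isOpen_lt continuous_abs continuous_const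
  have h1 := (h k).comp_clm hU (ContinuousLinearMap.snd ℝ ℝ E) (ContinuousLinearMap.norm_snd_le _ _ _)
  have h2 := (cauchyOn_pow (ε := 1 / (4 * M)) (by positivity) k).comp_clm hS
    (ContinuousLinearMap.fst ℝ ℝ E) (ContinuousLinearMap.norm_fst_le _ _ _)
  have hW : IsOpen ({r : ℝ | |r| < 1 / (4 * M)} ×ˢ U) := hS.prod hU
  have h3 := (h1.mono_set (U' := {r : ℝ | |r| < 1 / (4 * M)} ×ˢ U) fun q hq => hq.2).mul hW
    (h2.mono_set fun q hq => hq.1) (by positivity) (by positivity) hR (by positivity)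
  have e1 : C * M ^ k * (2 * (1 / (4 * M))) ^ k = C * (1 / 2) ^ k := by
    rw [mul_assoc, ← mul_pow]; congr 2; field_simp; norm_num
  rw [e1, one_div_one_div] at h3
  exact h3

namespace GeometricCauchy

variable {z₀ : E} {b b' : ℕ → E → ℝ}

theorem analyticAt (h : GeometricCauchy z₀ b) :
    AnalyticAt ℝ (Function.uncurry (rhoSeries b)) (0, z₀) := by
  obtain ⟨δ, C, R, M, hδ, hC, hR, hM, h⟩ := h
  have hS : IsOpen {r : ℝ | |r| < 1 / (4 * M)} := isOpen_lt continuous_abs continuous_const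
  refine (cauchyOn_tsum (hS.prod Metric.isOpen_ball) (by norm_num) (by norm_num)
    (cauchyOn_rhoSeries_term Metric.isOpen_ball hC hR hM h)).analyticAt
    (hS.prod Metric.isOpen_ball) (by positivity) ?_
  have : 0 < M := by linarith
  simp [hδ, this]

theorem eventually_hasSum (h : GeometricCauchy z₀ b) :
    ∀ᶠ q in 𝓝 ((0 : ℝ), z₀), HasSum (fun k => b k q.2 * q.1 ^ k) (rhoSeries b q.1 q.2) := by
  obtain ⟨δ, C, R, M, hδ, hC, hR, hM, h⟩ := h
  refine eventually_nhds_zero_prod hδ (show 0 < 1 / (4 * M) by positivity) fun q hq => ?_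
  exact (summable_of_cauchyOn (by norm_num) (by norm_num)
    (cauchyOn_rhoSeries_term Metric.isOpen_ball hC hR hM h) hq).hasSum

theorem deriv (h : GeometricCauchy z₀ b) :
    GeometricCauchy z₀ fun k z => ((k : ℝ) + 1) * b (k + 1) z := by
  obtain ⟨δ, C, R, M, hδ, hC, hR, hM, h⟩ := h
  -- The index shift costs one factor M, and k + 1 ≤ 2^k doubles the growth rate.
  refine ⟨δ, C * M, R, 2 * M, hδ, by positivity, hR, by linarith, fun k => ?_⟩
  refine ((h (k + 1)).const_mul Metric.isOpen_ball ((k : ℝ) + 1)).mono ?_ (by positivity) hR le_rfl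
  have h2 : (k : ℝ) + 1 ≤ 2 ^ k := by exact_mod_cast Nat.lt_two_pow_self
  rw [abs_of_nonneg (by positivity), mul_pow]
  calc ((k : ℝ) + 1) * (C * M ^ (k + 1)) ≤ 2 ^ k * (C * M ^ (k + 1)) := by gcongr
    _ = _ := by ring

theorem eventually_hasDerivAt (h : GeometricCauchy z₀ b) :
    ∀ᶠ q in 𝓝 ((0 : ℝ), z₀), HasDerivAt (fun r => rhoSeries b r q.2)
      (rhoSeries (fun k z => ((k : ℝ) + 1) * b (k + 1) z) q.1 q.2) q.1 := by
  have hana := h.analyticAt.eventually_analyticAt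
  have hsum := h.deriv.eventually_hasSum
  obtain ⟨δ, C, R, M, hδ, hC, hR, hM, h⟩ := h
  filter_upwards [hana, hsum, eventually_nhds_zero_prod hδ (show 0 < 1 / (4 * M) by positivity)
    fun q hq => hq] with q hq hs hqW
  have hS : IsOpen {r : ℝ | |r| < 1 / (4 * M)} := isOpen_lt continuous_abs continuous_const
  have h1 := dirDeriv_tsum (hS.prod Metric.isOpen_ball) (by norm_num) (by norm_num)
    (cauchyOn_rhoSeries_term Metric.isOpen_ball hC hR hM h) hqW (1, 0)
  have h2 : ∀ k, dirDeriv ((1 : ℝ), (0 : E)) (fun q : ℝ × E => b k q.2 * q.1 ^ k) q =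
      b k q.2 * (k * q.1 ^ (k - 1)) := fun k => by
    have hd := (((h k).contDiffAt Metric.isOpen_ball hqW.2).differentiableAt (by simp)).hasFDerivAt
    have hd1 : HasFDerivAt (fun q : ℝ × E => b k q.2) _ q :=
      HasFDerivAt.comp q hd (hasFDerivAt_snd (𝕜 := ℝ) (E := ℝ) (F := E))
    have hd2 : HasFDerivAt (fun q : ℝ × E => q.1 ^ k) _ q :=
      (hasDerivAt_pow k q.1).comp_hasFDerivAt q (hasFDerivAt_fst (𝕜 := ℝ) (E := ℝ) (F := E))
    simp only [dirDeriv]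
    rw [(hd1.fun_mul hd2).fderiv]
    simp
  simp only [h2] at h1
  have h3 : HasSum (fun k : ℕ => b k q.2 * (k * q.1 ^ (k - 1)))
      (rhoSeries (fun k z => ((k : ℝ) + 1) * b (k + 1) z) q.1 q.2) := by
    -- The term k = 0 carries a factor k and vanishes, so dropping it only shifts the index.
    rw [← hasSum_nat_add_iff' 1]
    simp only [Finset.range_one, Finset.sum_singleton, Nat.cast_zero, zero_mul, mul_zero, sub_zero]
    refine hs.congr_fun fun k => ?_
    simp only [Nat.add_sub_cancel, Nat.cast_add, Nat.cast_one]
    ring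
  have h4 : HasFDerivAt (Function.uncurry (rhoSeries b)) (fderiv ℝ (Function.uncurry (rhoSeries b)) q) q :=
    hq.differentiableAt.hasFDerivAt
  have h5 := h4.comp_hasDerivAt q.1 ((hasDerivAt_id q.1).prodMk (hasDerivAt_const q.1 q.2))
  rw [h3.unique h1]
  exact h5

end GeometricCauchy

end RhoSeries

/-! ### The Laplacian of power series in ϱ -/

section XLaplacian

variable {d p : ℕ} {z₀ : Z d p} {b : ℕ → Z d p → ℝ}

theorem GeometricCauchy.xLap (h : GeometricCauchy z₀ b) :
    GeometricCauchy z₀ fun k => xLap (b k) := by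
  obtain ⟨δ, C, R, M, hδ, hC, hR, hM, h⟩ := h
  refine ⟨δ, C * (4 * d * R ^ 2) * 2, 2 * R, M, hδ, by positivity, by positivity, hM, fun k => ?_⟩
  have h1 := (h k).xLap_iterate Metric.isOpen_ball (by positivity) hR 1
  simp only [Function.iterate_one, pow_one, mul_one, Nat.factorial_two, Nat.cast_ofNat] at h1
  convert h1 using 1
  ring

theorem GeometricCauchy.eventually_xLap (h : GeometricCauchy z₀ b) :
    ∀ᶠ q in 𝓝 ((0 : ℝ), z₀), PPWave.xLap (rhoSeries b q.1) q.2 =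
      rhoSeries (fun k => PPWave.xLap (b k)) q.1 q.2 := by
  have hsum := h.xLap.eventually_hasSum
  obtain ⟨δ, C, R, M, hδ, hC, hR, hM, h⟩ := h
  filter_upwards [hsum, eventually_nhds_zero_prod hδ (show 0 < 1 / (4 * M) by positivity)
    fun q hq => hq] with q hs hq
  have hq1 : |q.1| < 1 / (4 * M) := hq.1
  have hM0 : 0 < M := by linarith
  have h1 : M * |q.1| < 1 := by
    calc M * |q.1| < M * (1 / (4 * M)) := by gcongr
      _ = 1 / 4 := by field_simp
      _ < 1 := by norm_num
  have h2 : ∀ k, CauchyOn (Metric.ball z₀ δ) (fun z => b k z * q.1 ^ k)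
      (C * (M * |q.1|) ^ k) R := fun k => by
    have h3 := (h k).const_mul Metric.isOpen_ball (q.1 ^ k)
    simp only [mul_comm (q.1 ^ k)] at h3
    refine h3.mono (le_of_eq ?_) (by positivity) hR le_rfl
    rw [abs_pow, mul_pow]; ring
  have h4 := xLap_tsum Metric.isOpen_ball (by positivity) h1 h2 hq.2
  refine (h4.unique ?_)
  refine hs.congr_fun fun k => ?_
  have h5 := xLap_const_mul (((h k).contDiffAt Metric.isOpen_ball hq.2).of_le two_le_infty) (q.1 ^ k)
  simp only [mul_comm (q.1 ^ k)] at h5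
  exact h5

/-- The coefficients `c_k Δ^k α` with `α` analytic and `|c_k| ≤ B A^k / (2k)!`. -/
theorem geometricCauchy_xLap_iterate {α : Z d p → ℝ} (hα : AnalyticAt ℝ α z₀) {c : ℕ → ℝ}
    {B A : ℝ} (hB : 0 ≤ B) (hA : 1 ≤ A) (hc : ∀ k, |c k| ≤ B * A ^ k / (2 * k)!) :
    GeometricCauchy z₀ fun k z => c k * xLap^[k] α z := by
  obtain ⟨δ, C, R, hδ, hC, hR, h⟩ := exists_cauchyOn_of_analyticAt hα
  have hA' : 1 ≤ max 1 (4 * d * R ^ 2) := le_max_left _ _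
  refine ⟨δ, B * C, 2 * R, A * max 1 (4 * d * R ^ 2), hδ, by positivity, by positivity,
    one_le_mul_of_one_le_of_one_le hA hA', fun k => ?_⟩
  refine ((h.xLap_iterate Metric.isOpen_ball hC hR k).const_mul Metric.isOpen_ball (c k)).mono ?_
    (by positivity) (by positivity) le_rfl
  calc |c k| * (C * (4 * d * R ^ 2) ^ k * (2 * k)!)
      ≤ (B * A ^ k / (2 * k)!) * (C * (max 1 (4 * d * R ^ 2)) ^ k * (2 * k)!) := by
        gcongr
        · exact hc k
        · exact le_max_right _ _
    _ = _ := by rw [mul_pow]; field_simp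

end XLaplacian

/-! ### The ordinary differential operator in ϱ -/

section RadialOperator

/-- The operator `2 ϱ y'' + β y'`. -/
def radialOp (β : ℝ) (y : ℝ → ℝ) (r : ℝ) : ℝ := 2 * r * iteratedDeriv 2 y r + β * deriv y r

theorem radialOp_eq {β : ℝ} {y y₁ : ℝ → ℝ} {y₂ r : ℝ}
    (h₁ : ∀ᶠ t in 𝓝 r, HasDerivAt y (y₁ t) t) (h₂ : HasDerivAt y₁ y₂ r) :
    radialOp β y r = 2 * r * y₂ + β * y₁ r := by
  have h3 : deriv y =ᶠ[𝓝 r] y₁ := h₁.mono fun t ht => ht.deriv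
  rw [radialOp, iteratedDeriv_succ, iteratedDeriv_one, h3.deriv_eq, h₂.deriv, h3.self_of_nhds]

theorem radialOp_congr {β : ℝ} {y w : ℝ → ℝ} {r : ℝ} (h : y =ᶠ[𝓝 r] w) :
    radialOp β y r = radialOp β w r := by
  rw [radialOp, radialOp, h.deriv_eq, h.iteratedDeriv_eq]

theorem eventually_hasDerivAt_of_contDiffAt {y : ℝ → ℝ} {r : ℝ} (h : ContDiffAt ℝ 2 y r) :
    (∀ᶠ t in 𝓝 r, HasDerivAt y (deriv y t) t) ∧ HasDerivAt (deriv y) (iteratedDeriv 2 y r) r := by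
  refine ⟨(h.eventually (by simp)).mono fun t ht => (ht.differentiableAt (by simp)).hasDerivAt, ?_⟩
  rw [iteratedDeriv_succ, iteratedDeriv_one]
  have h1 : ContDiffAt ℝ 1 (deriv y) r := contDiffAt_dirDeriv h (by norm_num) (1 : ℝ)
  exact (h1.differentiableAt (by simp)).hasDerivAt

theorem radialOp_add {β : ℝ} {y w : ℝ → ℝ} {r : ℝ} (hy : ContDiffAt ℝ 2 y r)
    (hw : ContDiffAt ℝ 2 w r) :
    radialOp β (fun t => y t + w t) r = radialOp β y r + radialOp β w r := by
  obtain ⟨h1, h2⟩ := eventually_hasDerivAt_of_contDiffAt hy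
  obtain ⟨h3, h4⟩ := eventually_hasDerivAt_of_contDiffAt hw
  rw [radialOp_eq (by filter_upwards [h1, h3] with t a b using a.add b) (h2.fun_add h4), radialOp,
    radialOp]
  ring

theorem radialOp_const_mul {β : ℝ} {y : ℝ → ℝ} {r : ℝ} (hy : ContDiffAt ℝ 2 y r) (c : ℝ) :
    radialOp β (fun t => c * y t) r = c * radialOp β y r := by
  obtain ⟨h1, h2⟩ := eventually_hasDerivAt_of_contDiffAt hy
  rw [radialOp_eq (by filter_upwards [h1] with t a using a.const_mul c) (h2.const_mul c), radialOp]
  ring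

/-- The terms in y itself cancel because 2s(s-1) + (2-2s)s = 0, and the cross term 4s y' turns 2 -
2s into 2 + 2s. For natural exponents this holds at every real r, as needed on both sides of ϱ = 0.
-/
theorem radialOp_pow_mul (s : ℕ) {y : ℝ → ℝ} {r : ℝ} (hy : ContDiffAt ℝ 2 y r) :
    radialOp (2 - 2 * s) (fun t => t ^ s * y t) r = r ^ s * radialOp (2 + 2 * s) y r := by
  obtain ⟨h1, h2⟩ := eventually_hasDerivAt_of_contDiffAt hy
  have h3 : ∀ t : ℝ, HasDerivAt (fun t : ℝ => (s : ℝ) * t ^ (s - 1))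
      (s * (((s - 1 : ℕ) : ℝ) * t ^ (s - 1 - 1))) t := fun t =>
    (hasDerivAt_pow (s - 1) t).const_mul _
  rw [radialOp_eq (by filter_upwards [h1] with t a using (hasDerivAt_pow s t).mul a)
    (((h3 r).fun_mul h1.self_of_nhds).fun_add ((hasDerivAt_pow s r).fun_mul h2)), radialOp]
  -- The exponent s - 1 - 1 is truncated subtraction, so s = 0 and s = 1 are separate.
  rcases s with _ | _ | s
  · simp
  · simp; ring
  · simp only [Nat.add_sub_cancel]
    push_cast
    ring

theorem radialOp_rpow_mul (ν : ℝ) {y : ℝ → ℝ} {r : ℝ} (hr : 0 < r) (hy : ContDiffAt ℝ 2 y r) :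
    radialOp (2 - 2 * ν) (fun t => t ^ ν * y t) r = r ^ ν * radialOp (2 + 2 * ν) y r := by
  obtain ⟨h1, h2⟩ := eventually_hasDerivAt_of_contDiffAt hy
  have h3 : ∀ μ : ℝ, ∀ t : ℝ, 0 < t → HasDerivAt (fun t : ℝ => t ^ μ) (μ * t ^ (μ - 1)) t :=
    fun μ t ht => Real.hasDerivAt_rpow_const (Or.inl ht.ne')
  rw [radialOp_eq (by
      filter_upwards [h1, lt_mem_nhds hr] with t a ht using (h3 ν t ht).mul a)
    ((((h3 (ν - 1) r hr).const_mul ν).fun_mul h1.self_of_nhds).fun_add ((h3 ν r hr).fun_mul h2)), radialOp]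
  have e1 : r ^ (ν - 1) = r ^ ν / r := Real.rpow_sub_one hr.ne' ν
  have e2 : r ^ (ν - 1 - 1) = r ^ ν / r / r := by rw [Real.rpow_sub_one hr.ne', e1]
  rw [e1, e2]
  field_simp
  ring

/-- The cross term is 2·2r·(1/r) y' = 4y', and the operator applied to log alone gives 2r·(-1/r²) +
β/r = (β - 2)/r. -/
theorem radialOp_log_mul {β : ℝ} {y : ℝ → ℝ} {r : ℝ} (hr : 0 < r) (hy : ContDiffAt ℝ 2 y r) :
    radialOp β (fun t => Real.log t * y t) r =
      Real.log r * radialOp β y r + 4 * deriv y r + (β - 2) * y r / r := by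
  obtain ⟨h1, h2⟩ := eventually_hasDerivAt_of_contDiffAt hy
  rw [radialOp_eq (by
      filter_upwards [h1, lt_mem_nhds hr] with t a ht using (Real.hasDerivAt_log ht.ne').mul a)
    (((hasDerivAt_inv hr.ne').fun_mul h1.self_of_nhds).fun_add
      ((Real.hasDerivAt_log hr.ne').fun_mul h2)),
    radialOp]
  field_simp
  ring

end RadialOperator

/-! ### The equation for series ∑ c_k ϱ^k Δ^k α -/

section RadialSeries

variable {d p : ℕ} {z₀ : Z d p}

theorem GeometricCauchy.eventually_radialOp {b : ℕ → Z d p → ℝ} (h : GeometricCauchy z₀ b)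
    (β : ℝ) : ∀ᶠ q in 𝓝 ((0 : ℝ), z₀),
      HasSum (fun k : ℕ => (2 * (k : ℝ) + β) * ((k + 1) * b (k + 1) q.2) * q.1 ^ k)
        (radialOp β (fun r => rhoSeries b r q.2) q.1) := by
  filter_upwards [h.eventually_hasDerivAt.eventually_nhds, h.deriv.eventually_hasDerivAt,
    h.deriv.eventually_hasSum, h.deriv.deriv.eventually_hasSum] with q h1 h2 h3 h4
  have hc : Tendsto (fun t : ℝ => (t, q.2)) (𝓝 q.1) (𝓝 q) :=
    (Continuous.prodMk_left q.2).tendsto q.1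
  rw [radialOp_eq (hc.eventually h1) h2]
  have h5 : HasSum (fun k : ℕ => 2 * (k : ℝ) * ((k + 1) * b (k + 1) q.2) * q.1 ^ k)
      (2 * q.1 * rhoSeries (fun k z => ((k : ℝ) + 1) * (((k + 1 : ℕ) : ℝ) + 1) * b (k + 1 + 1) z)
        q.1 q.2) := by
    rw [← hasSum_nat_add_iff' 1]
    simp only [Finset.range_one, Finset.sum_singleton, Nat.cast_zero, zero_mul, mul_zero, sub_zero]
    have h6 := h4.mul_left (2 * q.1)
    simp only [← mul_assoc] at h6 ⊢
    refine h6.congr_fun fun k => ?_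
    push_cast
    ring
  have h7 := h5.add (h3.mul_left β)
  simp only [← mul_assoc] at h7 ⊢
  refine h7.congr_fun fun k => ?_
  ring

/-- The series `∑ c_k ϱ^k Δ^k α`. -/
def lapSeries (c : ℕ → ℝ) (α : Z d p → ℝ) : ℝ → Z d p → ℝ :=
  rhoSeries fun k z => c k * xLap^[k] α z

/-- Coefficients that are `O(A^k / (2k)!)`. -/
def FactorialDecay (c : ℕ → ℝ) : Prop :=
  ∃ B A : ℝ, 0 ≤ B ∧ 1 ≤ A ∧ ∀ k, |c k| ≤ B * A ^ k / (2 * k)!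

theorem FactorialDecay.geometricCauchy {c : ℕ → ℝ} (hc : FactorialDecay c) {α : Z d p → ℝ}
    (hα : AnalyticAt ℝ α z₀) : GeometricCauchy z₀ fun k z => c k * xLap^[k] α z := by
  obtain ⟨B, A, hB, hA, h⟩ := hc
  exact geometricCauchy_xLap_iterate hα hB hA h

/-- Since each term carries Δ^k α, both operators produce multiples of ϱ^k Δ^(k+1) α, and the
partial differential equation becomes a scalar recursion for c. All explicit series are checked
through it. -/
theorem FactorialDecay.eventually_pde {c : ℕ → ℝ} (hc : FactorialDecay c) {α : Z d p → ℝ}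
    (hα : AnalyticAt ℝ α z₀) (β : ℝ) : ∀ᶠ q in 𝓝 ((0 : ℝ), z₀),
      HasSum (fun k : ℕ => ((2 * (k : ℝ) + β) * ((k + 1) * c (k + 1)) - c k) *
        xLap^[k + 1] α q.2 * q.1 ^ k)
        (radialOp β (fun r => lapSeries c α r q.2) q.1 - xLap (lapSeries c α q.1) q.2) := by
  have hG := hc.geometricCauchy hα
  have hcd : ∀ᶠ q in 𝓝 ((0 : ℝ), z₀), AnalyticAt ℝ α q.2 :=
    (continuous_snd.tendsto ((0 : ℝ), z₀)).eventually hα.eventually_analyticAt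
  filter_upwards [hG.eventually_radialOp β, hG.eventually_xLap, hG.xLap.eventually_hasSum, hcd]
    with q h1 h2 h3 h4
  rw [← h2] at h3
  refine (h1.sub h3).congr_fun fun k => ?_
  have h5 : xLap (fun z => c k * xLap^[k] α z) q.2 = c k * xLap^[k + 1] α q.2 := by
    rw [xLap_const_mul ((contDiffAt_xLap_iterate h4.contDiffAt k).of_le two_le_infty),
      Function.iterate_succ_apply']
  rw [h5]
  ring

end RadialSeries

/-! ### Size of the explicit coefficients -/

section Coefficients

theorem factorial_two_mul_le (k : ℕ) : ((2 * k)! : ℝ) ≤ 4 ^ k * (k ! * k !) := by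
  have := factorial_add_le k k
  rw [← two_mul, pow_mul] at this
  norm_num at this
  exact this

theorem plusDen_succ (n k : ℕ) : plusDen n (k + 1) = plusDen n k * ((k + 1) * (2 * (k + 1) + n)) := by
  simp only [plusDen, Finset.prod_Icc_succ_top (Nat.le_add_left 1 k), Nat.factorial_succ]
  push_cast; ring

theorem minusDen_succ (n k : ℕ) :
    minusDen n (k + 1) = minusDen n k * ((k + 1) * (2 * (k + 1) - n)) := by
  simp only [minusDen, Finset.prod_Icc_succ_top (Nat.le_add_left 1 k), Nat.factorial_succ]
  push_cast; ring

@[simp] theorem plusDen_zero (n : ℕ) : plusDen n 0 = 1 := by simp [plusDen]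

@[simp] theorem minusDen_zero (n : ℕ) : minusDen n 0 = 1 := by simp [minusDen]

@[simp] theorem qConst_zero (n : ℕ) : qConst n 0 = 0 := by simp [qConst]

theorem qConst_succ (n k : ℕ) : qConst n (k + 1) = qConst n k +
    ((n : ℝ) + 4 * (k + 1)) / ((k + 1) * ((n : ℝ) + 2 * (k + 1))) := by
  simp only [qConst, Finset.sum_Icc_succ_top (Nat.le_add_left 1 k)]
  push_cast; ring

/-- Each factor 2(k+1) + n is at least k + 1. As (2k)! ≤ 4^k (k!)², this yields the decay 4^k /
(2k)!. -/
theorem factorial_mul_le_plusDen (n k : ℕ) : (k ! : ℝ) * k ! ≤ plusDen n k := by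
  induction k with
  | zero => simp
  | succ k ih =>
    rw [plusDen_succ, Nat.factorial_succ]
    push_cast
    calc ((k : ℝ) + 1) * k ! * ((k + 1) * k !) = (k ! * k !) * ((k + 1) * (k + 1)) := by ring
      _ ≤ plusDen n k * ((k + 1) * (2 * (k + 1) + n)) := by
        have : (0 : ℝ) ≤ n := Nat.cast_nonneg n
        have hk : (0 : ℝ) ≤ k := Nat.cast_nonneg k
        refine mul_le_mul ih ?_ (by positivity) (le_trans (by positivity) ih)
        exact mul_le_mul_of_nonneg_left (by linarith) (by positivity)

theorem plusDen_pos (n k : ℕ) : 0 < plusDen n k :=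
  lt_of_lt_of_le (by positivity) (factorial_mul_le_plusDen n k)

theorem inv_plusDen_le (n k : ℕ) : (plusDen n k)⁻¹ ≤ 4 ^ k / (2 * k)! := by
  rw [inv_le_comm₀ (plusDen_pos n k) (by positivity), inv_div, div_le_iff₀ (by positivity)]
  calc ((2 * k)! : ℝ) ≤ 4 ^ k * (k ! * k !) := factorial_two_mul_le k
    _ ≤ 4 ^ k * plusDen n k := by gcongr; exact factorial_mul_le_plusDen n k
    _ = _ := mul_comm _ _

theorem factorialDecay_plusDen (n : ℕ) : FactorialDecay fun k => (plusDen n k)⁻¹ :=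
  ⟨1, 4, zero_le_one, by norm_num, fun k => by
    rw [abs_of_nonneg (inv_nonneg.2 (plusDen_pos n k).le), one_mul]
    exact inv_plusDen_le n k⟩

/-- Every summand of q_k is at most 2, so q_k ≤ 2k; the weaker geometric bound fits the form of
`FactorialDecay`. -/
theorem abs_qConst_le (n k : ℕ) : |qConst n k| ≤ 2 * 2 ^ k := by
  have h : ∀ k, 0 ≤ qConst n k ∧ qConst n k ≤ 2 * k := by
    intro k
    induction k with
    | zero => simp
    | succ k ih =>
      rw [qConst_succ]
      have hn : (0 : ℝ) ≤ n := Nat.cast_nonneg n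
      have hk : (0 : ℝ) ≤ k := Nat.cast_nonneg k
      have h1 : 0 ≤ ((n : ℝ) + 4 * (k + 1)) / ((k + 1) * ((n : ℝ) + 2 * (k + 1))) := by positivity
      have h2 : ((n : ℝ) + 4 * (k + 1)) / ((k + 1) * ((n : ℝ) + 2 * (k + 1))) ≤ 2 := by
        rw [div_le_iff₀ (by positivity)]
        nlinarith [mul_nonneg hn hk, mul_nonneg hk hk]
      push_cast
      constructor <;> linarith [ih.1, ih.2]
  rw [abs_of_nonneg (h k).1]
  refine (h k).2.trans ?_
  gcongr
  exact_mod_cast Nat.lt_two_pow_self.le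

theorem factorialDecay_qConst (n : ℕ) : FactorialDecay fun k => qConst n k * (plusDen n k)⁻¹ :=
  ⟨2, 8, by norm_num, by norm_num, fun k => by
    rw [abs_mul, abs_of_nonneg (inv_nonneg.2 (plusDen_pos n k).le)]
    calc |qConst n k| * (plusDen n k)⁻¹ ≤ (2 * 2 ^ k) * (4 ^ k / (2 * k)!) := by
          exact mul_le_mul (abs_qConst_le n k) (inv_plusDen_le n k)
            (inv_nonneg.2 (plusDen_pos n k).le) (by positivity)
      _ = 2 * 8 ^ k / (2 * k)! := by
          rw [show (8 : ℝ) = 2 * 4 by norm_num, mul_pow]; ring⟩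

theorem factorialDecay_of_finite {c : ℕ → ℝ} {s : ℕ} (h : ∀ k, s ≤ k → c k = 0) :
    FactorialDecay c := by
  refine ⟨∑ k ∈ Finset.range s, |c k| * (2 * k)!, 1, by positivity, le_rfl, fun k => ?_⟩
  rw [one_pow, mul_one, le_div_iff₀ (by positivity)]
  rcases lt_or_ge k s with hk | hk
  · exact Finset.single_le_sum (f := fun k => |c k| * ((2 * k)! : ℝ)) (fun i _ => by positivity)
      (Finset.mem_range.2 hk)
  · rw [h k hk]
    simp only [abs_zero, zero_mul]
    positivity

theorem minusDen_ne_zero {n k : ℕ} (h : ∀ i : ℕ, 1 ≤ i → i ≤ k → 2 * i ≠ n) : minusDen n k ≠ 0 := by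
  refine mul_ne_zero (by positivity) (Finset.prod_ne_zero_iff.2 fun i hi => ?_)
  rw [Finset.mem_Icc] at hi
  rw [sub_ne_zero]
  exact_mod_cast h i hi.1 hi.2

/-- For odd n each 2i - n is an odd integer, hence of absolute value at least 1. Thus k + 1 ≤
n|2(k+1) - n|: this is clear for k + 1 ≤ n, and otherwise 2(k+1) - n ≥ k + 1. -/
theorem le_abs_minusDen {n : ℕ} (hn : Odd n) (k : ℕ) :
    (k ! : ℝ) * k ! ≤ (n : ℝ) ^ k * |minusDen n k| := by
  have hn1 : (1 : ℝ) ≤ n := by exact_mod_cast hn.pos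
  induction k with
  | zero => simp
  | succ k ih =>
    rw [minusDen_succ, Nat.factorial_succ, abs_mul, abs_mul, pow_succ]
    have h1 : ((k : ℝ) + 1) ≤ n * |2 * ((k : ℝ) + 1) - n| := by
      have h2 : (1 : ℝ) ≤ |2 * ((k : ℝ) + 1) - n| := by
        have h3 : (1 : ℤ) ≤ |2 * ((k : ℤ) + 1) - n| := by
          refine Int.one_le_abs fun h0 => ?_
          obtain ⟨m, rfl⟩ := hn
          push_cast at h0
          omega
        exact_mod_cast h3
      rcases le_total ((k : ℝ) + 1) n with h | h
      · nlinarith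
      · have h4 : (k : ℝ) + 1 ≤ |2 * ((k : ℝ) + 1) - n| := le_trans (by linarith) (le_abs_self _)
        nlinarith [abs_nonneg (2 * ((k : ℝ) + 1) - n)]
    have h5 : |(k : ℝ) + 1| = k + 1 := abs_of_nonneg (by positivity)
    rw [h5]
    push_cast
    calc ((k : ℝ) + 1) * k ! * ((k + 1) * k !) = (k ! * k !) * ((k + 1) * (k + 1)) := by ring
      _ ≤ ((n : ℝ) ^ k * |minusDen n k|) * ((k + 1) * (n * |2 * ((k : ℝ) + 1) - n|)) := by gcongr
      _ = _ := by ring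

theorem factorialDecay_minusDen {n : ℕ} (hn : Odd n) : FactorialDecay fun k => (minusDen n k)⁻¹ := by
  have hn1 : (1 : ℝ) ≤ n := by exact_mod_cast hn.pos
  refine ⟨1, 4 * n, zero_le_one, by linarith, fun k => ?_⟩
  have h0 : minusDen n k ≠ 0 := minusDen_ne_zero fun i _ _ => by
    obtain ⟨m, rfl⟩ := hn; omega
  rw [abs_inv, one_mul, inv_le_comm₀ (abs_pos.2 h0) (by positivity), inv_div,
    div_le_iff₀ (by positivity), mul_pow]
  calc ((2 * k)! : ℝ) ≤ 4 ^ k * (k ! * k !) := factorial_two_mul_le k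
    _ ≤ 4 ^ k * ((n : ℝ) ^ k * |minusDen n k|) :=
        mul_le_mul_of_nonneg_left (le_abs_minusDen hn k) (by positivity)
    _ = _ := by ring

end Coefficients

/-! ### Small positive ϱ near a point z -/

section Filters

variable {E : Type*} [TopologicalSpace E]

theorem nhdsGT_prod_le (z : E) : 𝓝[>] (0 : ℝ) ×ˢ 𝓝 z ≤ 𝓝 ((0 : ℝ), z) := by
  rw [nhds_prod_eq]
  exact Filter.prod_mono nhdsWithin_le_nhds le_rfl

theorem eventually_pos (z : E) : ∀ᶠ q in 𝓝[>] (0 : ℝ) ×ˢ 𝓝 z, 0 < q.1 :=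
  (eventually_mem_nhdsWithin (a := (0 : ℝ)) (s := Ioi 0)).prod_inl (𝓝 z)

/-- Because the half-line ϱ > 0 is open, an identity valid for small ϱ > 0 holds on a full
neighbourhood of each such point and can be differentiated there. -/
theorem eventually_eventually_nhdsGT_prod {z : E} {P : ℝ × E → Prop}
    (h : ∀ᶠ q in 𝓝[>] (0 : ℝ) ×ˢ 𝓝 z, P q) :
    ∀ᶠ q in 𝓝[>] (0 : ℝ) ×ˢ 𝓝 z, ∀ᶠ q' in 𝓝 q, P q' := by
  obtain ⟨pa, ha, pb, hb, hP⟩ := eventually_prod_iff.1 h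
  have ha' : ∀ᶠ r in 𝓝[>] (0 : ℝ), ∀ᶠ r' in 𝓝 r, pa r' := by
    have h1 := eventually_eventually_nhdsWithin.2 ha
    filter_upwards [h1, self_mem_nhdsWithin] with r hr hr0
    rwa [IsOpen.nhdsWithin_eq isOpen_Ioi hr0] at hr
  filter_upwards [ha'.prod_inl (𝓝 z), (eventually_eventually_nhds.2 hb).prod_inr (𝓝[>] (0 : ℝ))]
    with q h1 h2
  rw [nhds_prod_eq]
  exact (h1.prod_mk h2).mono fun q' hq' => hP hq'.1 hq'.2

theorem tendsto_slice_nhdsGT (z : E) :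
    Tendsto (fun r : ℝ => (r, z)) (𝓝[>] 0) (𝓝[>] (0 : ℝ) ×ˢ 𝓝 z) :=
  tendsto_id.prodMk tendsto_const_nhds

end Filters

/-! ### Cauchy estimates uniform in ϱ -/

section EventuallyCauchy

variable {E : Type*} [NormedAddCommGroup E] [NormedSpace ℝ E]

/-- For `(ϱ, z)` in the filter `l`, the function `f ϱ` is smooth at `z` and its derivatives satisfy
Cauchy estimates with uniform constants. -/
def EventuallyCauchy (l : Filter (ℝ × E)) (f : ℝ → E → ℝ) : Prop :=
  ∃ C R : ℝ, 0 ≤ C ∧ 0 ≤ R ∧ ∀ᶠ q in l, ContDiffAt ℝ ∞ (f q.1) q.2 ∧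
    ∀ k : ℕ, ‖iteratedFDeriv ℝ k (f q.1) q.2‖ ≤ C * R ^ k * (k ! : ℝ)

namespace EventuallyCauchy

variable {l : Filter (ℝ × E)} {f g : ℝ → E → ℝ}

theorem add (hf : EventuallyCauchy l f) (hg : EventuallyCauchy l g) :
    EventuallyCauchy l fun r z => f r z + g r z := by
  obtain ⟨C, R, hC, hR, hf⟩ := hf
  obtain ⟨C', R', hC', hR', hg⟩ := hg
  refine ⟨C + C', max R R', by positivity, hR.trans (le_max_left _ _), ?_⟩
  filter_upwards [hf, hg] with q h1 h2
  refine ⟨h1.1.add h2.1, fun k => ?_⟩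
  have e := iteratedFDeriv_add_apply (i := k) (h1.1.of_le (by exact_mod_cast le_top))
    (h2.1.of_le (by exact_mod_cast le_top))
  change ‖iteratedFDeriv ℝ k (f q.1 + g q.1) q.2‖ ≤ _
  rw [e, add_mul, add_mul]
  refine (norm_add_le _ _).trans (add_le_add ((h1.2 k).trans ?_) ((h2.2 k).trans ?_))
  · gcongr; exact le_max_left _ _
  · gcongr; exact le_max_right _ _

theorem mul_of_abs_le (hf : EventuallyCauchy l f) {c : ℝ → ℝ} {B : ℝ} (hB : 0 ≤ B)
    (hc : ∀ᶠ q in l, |c q.1| ≤ B) :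
    EventuallyCauchy l fun r z => c r * f r z := by
  obtain ⟨C, R, hC, hR, hf⟩ := hf
  refine ⟨B * C, R, by positivity, hR, ?_⟩
  filter_upwards [hf, hc] with q h1 h2
  refine ⟨contDiffAt_const.mul h1.1, fun k => ?_⟩
  have e : iteratedFDeriv ℝ k (fun z => c q.1 * f q.1 z) q.2 =
      c q.1 • iteratedFDeriv ℝ k (f q.1) q.2 :=
    iteratedFDeriv_const_smul_apply (a := c q.1) (h1.1.of_le (by exact_mod_cast le_top))
  rw [e, norm_smul, Real.norm_eq_abs, mul_assoc B, mul_assoc B]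
  gcongr
  exact h1.2 k

theorem mono {l' : Filter (ℝ × E)} (hf : EventuallyCauchy l f) (hl : l' ≤ l) :
    EventuallyCauchy l' f := by
  obtain ⟨C, R, hC, hR, hf⟩ := hf
  exact ⟨C, R, hC, hR, hf.filter_mono hl⟩

end EventuallyCauchy

theorem eventuallyCauchy_of_analyticAt {f : ℝ → E → ℝ} {z₀ : E}
    (h : AnalyticAt ℝ (Function.uncurry f) (0, z₀)) : EventuallyCauchy (𝓝 (0, z₀)) f := by
  obtain ⟨δ, C, R, hδ, hC, hR, h⟩ := exists_cauchyOn_of_analyticAt h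
  refine ⟨C, R, hC, hR, ?_⟩
  filter_upwards [Metric.ball_mem_nhds _ hδ] with q hq
  refine ⟨?_, fun k => h.slice Metric.isOpen_ball hq k⟩
  have h1 := h.contDiffAt Metric.isOpen_ball hq
  exact ContDiffAt.comp q.2 (f := fun z => (q.1, z)) h1
    (contDiff_prodMk_right q.1).contDiffAt

end EventuallyCauchy

/-! ### Locality and differences of solutions -/

section Solutions

variable {d p : ℕ} {n : ℕ} {V : Set (Z d p)} {H : Z d p → ℝ} {h h' : ℝ → Z d p → ℝ}

theorem pdeAt_iff {ϱ : ℝ} {z : Z d p} : PDEAt n H h ϱ z ↔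
    radialOp (2 - (n : ℝ)) (fun r => h r z) ϱ = xLap (fun w => H w + h ϱ w) z := by
  rw [PDEAt, radialOp, sub_eq_zero]

theorem contDiffAt_slice_left {m : ℕ∞ω} {q : ℝ × Z d p} (h1 : ContDiffAt ℝ m (Function.uncurry h) q) :
    ContDiffAt ℝ m (fun r => h r q.2) q.1 :=
  ContDiffAt.comp q.1 (f := fun r => (r, q.2)) h1 (contDiff_prodMk_left q.2).contDiffAt

theorem contDiffAt_slice_right {m : ℕ∞ω} {q : ℝ × Z d p}
    (h1 : ContDiffAt ℝ m (Function.uncurry h) q) : ContDiffAt ℝ m (h q.1) q.2 :=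
  ContDiffAt.comp q.2 (f := fun z => (q.1, z)) h1 (contDiff_prodMk_right q.1).contDiffAt

theorem eventuallyEq_slices {q : ℝ × Z d p} (he : ∀ᶠ q' in 𝓝 q, h q'.1 q'.2 = h' q'.1 q'.2) :
    (fun r => h r q.2) =ᶠ[𝓝 q.1] (fun r => h' r q.2) ∧ h q.1 =ᶠ[𝓝 q.2] h' q.1 :=
  ⟨((Continuous.prodMk_left q.2).tendsto q.1).eventually he,
    ((Continuous.prodMk_right q.1).tendsto q.2).eventually he⟩

theorem PDEAt.congr {q : ℝ × Z d p} (he : ∀ᶠ q' in 𝓝 q, h q'.1 q'.2 = h' q'.1 q'.2)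
    (hp : PDEAt n H h' q.1 q.2) : PDEAt n H h q.1 q.2 := by
  obtain ⟨h1, h2⟩ := eventuallyEq_slices he
  rw [pdeAt_iff] at hp ⊢
  rw [radialOp_congr h1, hp]
  refine (xLap_congr ?_).self_of_nhds
  filter_upwards [h2] with w hw
  rw [hw]

theorem contDiffAt_uncurry_congr {q : ℝ × Z d p} {m : ℕ∞ω}
    (he : ∀ᶠ q' in 𝓝 q, h q'.1 q'.2 = h' q'.1 q'.2)
    (hp : ContDiffAt ℝ m (Function.uncurry h') q) : ContDiffAt ℝ m (Function.uncurry h) q :=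
  hp.congr_of_eventuallyEq he

theorem IsSolution.congr (hs : IsSolution n V H h')
    (he : ∀ z ∈ V, ∀ᶠ q in 𝓝[>] (0 : ℝ) ×ˢ 𝓝 z, h q.1 q.2 = h' q.1 q.2) :
    IsSolution n V H h := by
  intro z hz
  obtain ⟨h1, h2, C, R, h3⟩ := hs z hz
  have he' := eventually_eventually_nhdsGT_prod (he z hz)
  refine ⟨?_, ?_, C, R, ?_⟩
  · filter_upwards [h1, he'] with q hq hq'
    exact ⟨contDiffAt_uncurry_congr hq' hq.1, PDEAt.congr hq' hq.2⟩
  · refine h2.congr' ?_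
    filter_upwards [(tendsto_slice_nhdsGT z).eventually (he z hz)] with r hr using hr.symm
  · filter_upwards [h3, he'] with q hq hq' k
    rw [((eventuallyEq_slices hq').2.iteratedFDeriv ℝ k).self_of_nhds]
    exact hq k

/-- The regularity and the equation, for a function given by explicit data. -/
theorem isSolution_of (h1 : ∀ z ∈ V, ∀ᶠ q in 𝓝[>] (0 : ℝ) ×ˢ 𝓝 z,
      ContDiffAt ℝ ∞ (Function.uncurry h) q ∧ PDEAt n H h q.1 q.2)
    (h2 : ∀ z ∈ V, Tendsto (fun ϱ => h ϱ z) (𝓝[>] 0) (𝓝 0))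
    (h3 : ∀ z ∈ V, EventuallyCauchy (𝓝[>] (0 : ℝ) ×ˢ 𝓝 z) h) : IsSolution n V H h := by
  intro z hz
  obtain ⟨C, R, -, -, h3⟩ := h3 z hz
  exact ⟨h1 z hz, h2 z hz, C, R, h3.mono fun q hq => hq.2⟩

theorem IsSolution.eventuallyCauchy (hs : IsSolution n V H h) {z : Z d p} (hz : z ∈ V) :
    EventuallyCauchy (𝓝[>] (0 : ℝ) ×ˢ 𝓝 z) h := by
  obtain ⟨h1, -, C, R, h3⟩ := hs z hz
  refine ⟨|C|, |R|, abs_nonneg _, abs_nonneg _, ?_⟩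
  filter_upwards [h1, h3] with q hq hq3
  refine ⟨contDiffAt_slice_right hq.1, fun k => (hq3 k).trans ?_⟩
  rw [← abs_pow, ← abs_mul]
  gcongr
  exact le_abs_self _

/-- The difference of two solutions solves the homogeneous equation. -/
theorem IsSolution.sub (hV : IsOpen V) (hH : ContDiffOn ℝ ∞ H V) (hs : IsSolution n V H h)
    (hs' : IsSolution n V H h') : IsSolution n V (fun _ => 0) fun r z => h r z - h' r z := by
  refine isSolution_of (fun z hz => ?_) (fun z hz => ?_) fun z hz => ?_
  · have hV' : ∀ᶠ q in 𝓝[>] (0 : ℝ) ×ˢ 𝓝 z, q.2 ∈ V := (hV.eventually_mem hz).prod_inr _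
    filter_upwards [(hs z hz).1, (hs' z hz).1, hV'] with q h1 h2 hqV
    have hH' := (hH.contDiffAt (hV.mem_nhds hqV)).of_le two_le_infty
    refine ⟨h1.1.sub h2.1, ?_⟩
    have a1 := contDiffAt_slice_right h1.1
    have a2 := contDiffAt_slice_right h2.1
    have b1 := (contDiffAt_slice_left h1.1).of_le two_le_infty
    have b2 := (contDiffAt_slice_left h2.1).of_le two_le_infty
    have p1 := pdeAt_iff.1 h1.2
    have p2 := pdeAt_iff.1 h2.2
    rw [xLap_add hH' (a1.of_le two_le_infty)] at p1
    rw [xLap_add hH' (a2.of_le two_le_infty)] at p2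
    rw [pdeAt_iff]
    simp only [zero_add, sub_eq_add_neg, ← neg_one_mul (h' _ _)]
    have c1 := radialOp_add (β := 2 - (n : ℝ)) b1 (contDiffAt_const (c := (-1 : ℝ)).mul b2)
    have c2 := radialOp_const_mul (β := 2 - (n : ℝ)) b2 (-1)
    have c3 := xLap_add (a1.of_le two_le_infty)
      (contDiffAt_const (c := (-1 : ℝ)).mul (a2.of_le two_le_infty))
    have c4 := xLap_const_mul (a2.of_le two_le_infty) (-1)
    rw [sub_eq_add_neg] at *
    rw [c1, c2, c3, c4, p1, p2]
    ring
  · simpa using (hs z hz).2.1.sub (hs' z hz).2.1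
  · have h1 := (hs.eventuallyCauchy hz).add ((hs'.eventuallyCauchy hz).mul_of_abs_le
      (c := fun _ => -1) (B := 1) zero_le_one (by simp))
    simpa [sub_eq_add_neg] using h1

end Solutions

/-! ### Explicit solutions for odd n -/

section ExplicitSeries

variable {d p : ℕ} {n s : ℕ} {z₀ : Z d p} {H α : Z d p → ℝ}

theorem FactorialDecay.analyticAt {c : ℕ → ℝ} (hc : FactorialDecay c) (hα : AnalyticAt ℝ α z₀) :
    AnalyticAt ℝ (Function.uncurry (lapSeries c α)) (0, z₀) :=
  (hc.geometricCauchy hα).analyticAt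

theorem FactorialDecay.eventually_analyticAt {c : ℕ → ℝ} (hc : FactorialDecay c)
    (hα : AnalyticAt ℝ α z₀) :
    ∀ᶠ q in 𝓝 ((0 : ℝ), z₀), AnalyticAt ℝ (Function.uncurry (lapSeries c α)) q :=
  (hc.analyticAt hα).eventually_analyticAt

theorem lapSeries_zero_left (c : ℕ → ℝ) (α : Z d p → ℝ) (z : Z d p) :
    lapSeries c α 0 z = c 0 * α z := by
  rw [lapSeries, rhoSeries, tsum_eq_single 0 (fun k hk => by simp [hk])]
  simp

theorem lapSeries_zero_right (c : ℕ → ℝ) (r : ℝ) (z : Z d p) :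
    lapSeries c (fun _ => 0) r z = 0 := by
  simp [lapSeries, rhoSeries]

theorem lapSeries_congr {α' : Z d p → ℝ} {V : Set (Z d p)} (hV : IsOpen V) (h : EqOn α α' V)
    (c : ℕ → ℝ) (r : ℝ) {z : Z d p} (hz : z ∈ V) : lapSeries c α r z = lapSeries c α' r z := by
  simp only [lapSeries, rhoSeries]
  exact tsum_congr fun k => by rw [xLap_iterate_eqOn hV h k hz]

theorem FactorialDecay.tendsto {c : ℕ → ℝ} (hc : FactorialDecay c) (hα : AnalyticAt ℝ α z₀) :
    Tendsto (fun r => lapSeries c α r z₀) (𝓝[>] 0) (𝓝 (c 0 * α z₀)) := by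
  have h1 := (hc.analyticAt hα).continuousAt.tendsto
  rw [Function.uncurry_apply_pair, lapSeries_zero_left] at h1
  exact h1.comp ((tendsto_slice_nhdsGT z₀).mono_right (nhdsGT_prod_le z₀))

/-- `S = ∑ Δ^k α ϱ^k / (k! ∏ (2i + n))` solves `2 ϱ S'' + (2 + n) S' = Δ S`. -/
theorem eventually_plusSeries (n : ℕ) (hα : AnalyticAt ℝ α z₀) : ∀ᶠ q in 𝓝 ((0 : ℝ), z₀),
    radialOp (2 + n) (fun r => lapSeries (fun k => (plusDen n k)⁻¹) α r q.2) q.1 =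
      xLap (lapSeries (fun k => (plusDen n k)⁻¹) α q.1) q.2 := by
  filter_upwards [(factorialDecay_plusDen n).eventually_pde hα (2 + n)] with q hq
  rw [← sub_eq_zero]
  refine hq.unique ((hasSum_zero).congr_fun fun k => ?_)
  have h1 : (2 * (k : ℝ) + (2 + n)) * ((k + 1) * (plusDen n (k + 1))⁻¹) - (plusDen n k)⁻¹ = 0 := by
    have := plusDen_pos n k
    have hn : (0 : ℝ) ≤ n := Nat.cast_nonneg n
    rw [plusDen_succ]
    have h2 : 2 * ((k : ℝ) + 1) + n ≠ 0 := by positivity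
    field_simp
    ring
  rw [h1, zero_mul, zero_mul]

/-- The coefficients `1 / (k! ∏ (2i - n))` for `k ≥ 1`. -/
def oddCoeff (n k : ℕ) : ℝ := if k = 0 then 0 else (minusDen n k)⁻¹

theorem factorialDecay_oddCoeff (hn : Odd n) : FactorialDecay (oddCoeff n) := by
  obtain ⟨B, A, hB, hA, h⟩ := factorialDecay_minusDen hn
  refine ⟨B, A, hB, hA, fun k => ?_⟩
  unfold oddCoeff
  split_ifs with hk
  · rw [abs_zero]; positivity
  · exact h k

theorem two_mul_sub_ne_zero_of_odd (hn : Odd n) (k : ℕ) : (2 * (k : ℝ) + 2 - n) ≠ 0 := by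
  intro h
  obtain ⟨m, rfl⟩ := hn
  have h' : (2 * (k : ℤ) + 2 - (2 * m + 1 : ℕ)) = 0 := by exact_mod_cast h
  push_cast at h'
  omega

/-- The recursion is satisfied for k ≥ 1. At k = 0 the vanishing zeroth coefficient leaves the
factor 1, which is the source ΔH. -/
theorem eventually_oddSeries (hn : Odd n) (hH : AnalyticAt ℝ H z₀) : ∀ᶠ q in 𝓝 ((0 : ℝ), z₀),
    radialOp (2 - n) (fun r => lapSeries (oddCoeff n) H r q.2) q.1 =
      xLap H q.2 + xLap (lapSeries (oddCoeff n) H q.1) q.2 := by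
  filter_upwards [(factorialDecay_oddCoeff hn).eventually_pde hH (2 - n)] with q hq
  rw [← sub_eq_iff_eq_add]
  refine hq.unique ?_
  have h0 := hasSum_single (f := fun k : ℕ => ((2 * (k : ℝ) + (2 - n)) *
    ((k + 1) * oddCoeff n (k + 1)) - oddCoeff n k) * xLap^[k + 1] H q.2 * q.1 ^ k) 0 fun k hk => by
      have h1 := two_mul_sub_ne_zero_of_odd hn k
      have h2 : minusDen n k ≠ 0 := minusDen_ne_zero fun i _ _ => by
        obtain ⟨m, rfl⟩ := hn; omega
      have h3 : (2 * (k : ℝ) + (2 - n)) * ((k + 1) * oddCoeff n (k + 1)) - oddCoeff n k = 0 := by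
        simp only [oddCoeff, hk, Nat.succ_ne_zero, if_false, minusDen_succ]
        have h4 : 2 * ((k : ℝ) + 1) - n ≠ 0 := by convert h1 using 1; ring
        field_simp
        ring
      rw [h3, zero_mul, zero_mul]
  have h1 := two_mul_sub_ne_zero_of_odd hn 0
  have h2 : (2 * ((0 : ℕ) : ℝ) + (2 - n)) * ((((0 : ℕ) : ℝ) + 1) * oddCoeff n (0 + 1)) -
      oddCoeff n 0 = 1 := by
    simp only [oddCoeff, zero_add, one_ne_zero, if_false, if_true, minusDen_succ n 0]
    have h4 : (2 : ℝ) - n ≠ 0 := by simpa using h1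
    simp [h4]
  rw [h2] at h0
  simpa using h0

/-- The general solution for odd `n`. -/
def oddSol (n : ℕ) (H α : Z d p → ℝ) (ϱ : ℝ) (z : Z d p) : ℝ :=
  lapSeries (oddCoeff n) H ϱ z +
    ϱ ^ ((n : ℝ) / 2) * lapSeries (fun k => (plusDen n k)⁻¹) α ϱ z

theorem contDiffAt_fst_comp {g : ℝ → ℝ} {q : ℝ × Z d p} (h : ContDiffAt ℝ ∞ g q.1) :
    ContDiffAt ℝ ∞ (fun q' : ℝ × Z d p => g q'.1) q :=
  ContDiffAt.comp q h contDiffAt_fst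

theorem isSolution_oddSol {V : Set (Z d p)} (hn : Odd n) (hH : AnalyticOnNhd ℝ H V)
    (hα : AnalyticOnNhd ℝ α V) : IsSolution n V H (oddSol n H α) := by
  have hn0 : (0 : ℝ) < (n : ℝ) / 2 := by
    have : (0 : ℝ) < n := by exact_mod_cast hn.pos
    positivity
  have hrp : Tendsto (fun r : ℝ => r ^ ((n : ℝ) / 2)) (𝓝[>] 0) (𝓝 0) := by
    have := (Real.continuousAt_rpow_const 0 ((n : ℝ) / 2) (Or.inr hn0.le)).tendsto
    rw [Real.zero_rpow hn0.ne'] at this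
    exact this.mono_left nhdsWithin_le_nhds
  refine isSolution_of (fun z hz => ?_) (fun z hz => ?_) fun z hz => ?_
  · have hle := nhdsGT_prod_le z
    have hHa : ∀ᶠ q in 𝓝 ((0 : ℝ), z), AnalyticAt ℝ H q.2 :=
      (continuous_snd.tendsto ((0 : ℝ), z)).eventually (hH z hz).eventually_analyticAt
    filter_upwards [eventually_pos z, hle hHa,
      hle ((factorialDecay_oddCoeff hn).eventually_analyticAt (hH z hz)),
      hle ((factorialDecay_plusDen n).eventually_analyticAt (hα z hz)),
      hle (eventually_oddSeries hn (hH z hz)), hle (eventually_plusSeries n (hα z hz))]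
      with q hq hHq hA hB h1 h2
    have hA' : ContDiffAt ℝ ∞ (Function.uncurry (lapSeries (oddCoeff n) H)) q := hA.contDiffAt
    have hB' : ContDiffAt ℝ ∞ (Function.uncurry (lapSeries (fun k => (plusDen n k)⁻¹) α)) q :=
      hB.contDiffAt
    have hr : ContDiffAt ℝ ∞ (fun r : ℝ => r ^ ((n : ℝ) / 2)) q.1 :=
      Real.contDiffAt_rpow_const_of_ne hq.ne'
    refine ⟨hA'.add ((contDiffAt_fst_comp hr).mul hB'), ?_⟩
    rw [pdeAt_iff]
    have a1 := (contDiffAt_slice_left hA').of_le two_le_infty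
    have a2 := (contDiffAt_slice_left hB').of_le two_le_infty
    have a3 := (contDiffAt_slice_right hA').of_le two_le_infty
    have a4 := (contDiffAt_slice_right hB').of_le two_le_infty
    simp only [oddSol]
    rw [radialOp_add a1 ((hr.of_le two_le_infty).mul a2)]
    have e1 : (2 : ℝ) - n = 2 - 2 * ((n : ℝ) / 2) := by ring
    have e2 := radialOp_rpow_mul ((n : ℝ) / 2) hq a2
    rw [← e1, show (2 : ℝ) + 2 * ((n : ℝ) / 2) = 2 + n by ring] at e2
    rw [e2, h1, h2, xLap_add hHq.contDiffAt (a3.add (contDiffAt_const.mul a4)),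
      xLap_add a3 (contDiffAt_const.mul a4), xLap_const_mul a4]
    ring
  · have h1 := (factorialDecay_oddCoeff hn).tendsto (hH z hz)
    have h2 := (factorialDecay_plusDen n).tendsto (hα z hz)
    have h3 := h1.add (hrp.mul h2)
    simpa [oddCoeff, oddSol] using h3
  · have h1 := (eventuallyCauchy_of_analyticAt
      ((factorialDecay_oddCoeff hn).analyticAt (hH z hz))).mono (nhdsGT_prod_le z)
    have h2 := (eventuallyCauchy_of_analyticAt
      ((factorialDecay_plusDen n).analyticAt (hα z hz))).mono (nhdsGT_prod_le z)
    refine h1.add (h2.mul_of_abs_le zero_le_one ?_)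
    exact ((hrp.abs.eventually (ge_mem_nhds (by simp : |(0 : ℝ)| < 1))).prod_inl _)

/-- The series without the `ϱ^(n/2)`-part is a solution that is analytic in `ϱ`. -/
theorem isRhoAnalyticSolution_oddSeries {V : Set (Z d p)} (hn : Odd n) (hH : AnalyticOnNhd ℝ H V) :
    IsRhoAnalyticSolution n V H (lapSeries (oddCoeff n) H) := by
  intro z hz
  rw [← nhds_prod_eq]
  have hHa : ∀ᶠ q in 𝓝 ((0 : ℝ), z), AnalyticAt ℝ H q.2 :=
    (continuous_snd.tendsto ((0 : ℝ), z)).eventually (hH z hz).eventually_analyticAt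
  refine ⟨?_, by simp [lapSeries_zero_left, oddCoeff]⟩
  filter_upwards [hHa, (factorialDecay_oddCoeff hn).eventually_analyticAt (hH z hz),
    eventually_oddSeries hn (hH z hz)] with q hHq hA h1
  refine ⟨hA.contDiffAt, ?_, ?_⟩
  · exact AnalyticAt.comp (f := fun r => (r, q.2)) hA (analyticAt_id.prod analyticAt_const)
  · rw [pdeAt_iff, h1, xLap_add hHq.contDiffAt (contDiffAt_slice_right hA.contDiffAt)]

end ExplicitSeries

/-! ### Explicit solutions for even n: truncation and logarithm -/

section EvenSeries

variable {d p : ℕ} {s : ℕ} {z₀ : Z d p} {H α : Z d p → ℝ}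

/-- The coefficients `1 / (k! ∏ (2i - n))` for `1 ≤ k < s`, where `n = 2s`. -/
def evenCoeff (s k : ℕ) : ℝ := if k = 0 ∨ s ≤ k then 0 else (minusDen (2 * s) k)⁻¹

theorem factorialDecay_evenCoeff (s : ℕ) : FactorialDecay (evenCoeff s) :=
  factorialDecay_of_finite (s := s) fun k hk => by simp [evenCoeff, hk]

theorem minusDen_even_ne_zero {k : ℕ} (h : k < s) : minusDen (2 * s) k ≠ 0 :=
  minusDen_ne_zero fun i _ _ => by omega

/-- Two defects remain: the source at k = 0, and at k = s - 1 the term that cannot be continued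
because 2k + 2 - 2s = 0. They fall on the same index when s = 1. -/
theorem evenCoeff_recursion (hs : 1 ≤ s) (k : ℕ) :
    (2 * (k : ℝ) + (2 - (2 * s : ℕ))) * ((k + 1) * evenCoeff s (k + 1)) - evenCoeff s k =
      (if k = 0 then 1 else 0) - if k = s - 1 then (minusDen (2 * s) (s - 1))⁻¹ else 0 := by
  rcases lt_trichotomy k (s - 1) with hk | hk | hk
  · have h1 : ¬(s ≤ k + 1) := by omega
    have h2 : ¬(s ≤ k) := by omega
    have h3 := minusDen_even_ne_zero (s := s) (k := k) (by omega)
    have h4 : 2 * ((k : ℝ) + 1) - (2 * s : ℕ) ≠ 0 := by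
      rw [sub_ne_zero]
      have : 2 * (k + 1) ≠ 2 * s := by omega
      exact_mod_cast this
    have h5 : (2 * (k : ℝ) + (2 - (2 * s : ℕ))) * ((k + 1) * evenCoeff s (k + 1)) =
        (minusDen (2 * s) k)⁻¹ := by
      simp only [evenCoeff, Nat.succ_ne_zero, h1, false_or, if_false, minusDen_succ]
      have h6 : (2 * (k : ℝ) + (2 - (2 * s : ℕ))) = 2 * ((k : ℝ) + 1) - (2 * s : ℕ) := by ring
      rw [h6]
      field_simp
    rw [h5, if_neg hk.ne]
    by_cases hk0 : k = 0
    · simp [evenCoeff, hk0]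
    · simp [evenCoeff, hk0, h2]
  · have h1 : s ≤ k + 1 := by omega
    have h2 : ¬(s ≤ k) := by omega
    rw [if_pos hk, ← hk]
    by_cases hk0 : k = 0
    · subst hk0
      simp [evenCoeff, h1]
    · simp [evenCoeff, h1, h2, hk0]
  · have h1 : s ≤ k + 1 := by omega
    have h2 : s ≤ k := by omega
    have h3 : k ≠ 0 := by omega
    simp [evenCoeff, h1, h2, h3, hk.ne']

theorem eventually_evenSeries (hs : 1 ≤ s) (hH : AnalyticAt ℝ H z₀) :
    ∀ᶠ q in 𝓝 ((0 : ℝ), z₀),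
      radialOp (2 - (2 * s : ℕ)) (fun r => lapSeries (evenCoeff s) H r q.2) q.1 =
        xLap H q.2 + xLap (lapSeries (evenCoeff s) H q.1) q.2 -
          (minusDen (2 * s) (s - 1))⁻¹ * xLap^[s] H q.2 * q.1 ^ (s - 1) := by
  filter_upwards [(factorialDecay_evenCoeff s).eventually_pde hH (2 - (2 * s : ℕ))] with q hq
  simp only [evenCoeff_recursion hs] at hq
  have h1 := hasSum_single (f := fun k : ℕ => (if k = 0 then (1 : ℝ) else 0) *
    xLap^[k + 1] H q.2 * q.1 ^ k) 0 fun k hk => by simp [hk]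
  have h2 := hasSum_single (f := fun k : ℕ => (if k = s - 1 then (minusDen (2 * s) (s - 1))⁻¹ else 0) *
    xLap^[k + 1] H q.2 * q.1 ^ k) (s - 1) fun k hk => by simp [hk]
  have h3 := hq.unique ((h1.sub h2).congr_fun fun k => by ring)
  simp only [if_true, zero_add, Function.iterate_one, one_mul, pow_zero, mul_one,
    Nat.sub_add_cancel hs] at h3
  linarith

/-- The logarithmic series `log ϱ S - ∑ q_k Δ^k f ϱ^k / (k! ∏ (2i + n))`. -/
def logSeries (n : ℕ) (f : Z d p → ℝ) (ϱ : ℝ) (z : Z d p) : ℝ :=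
  Real.log ϱ * lapSeries (fun k => (plusDen n k)⁻¹) f ϱ z -
    lapSeries (fun k => qConst n k * (plusDen n k)⁻¹) f ϱ z

theorem eventually_contDiffAt_logSeries (n : ℕ) {f : Z d p → ℝ} (hf : AnalyticAt ℝ f z₀) :
    ∀ᶠ q in 𝓝[>] (0 : ℝ) ×ˢ 𝓝 z₀, ContDiffAt ℝ ∞ (Function.uncurry (logSeries n f)) q := by
  have hle := nhdsGT_prod_le z₀
  filter_upwards [eventually_pos z₀, hle ((factorialDecay_plusDen n).eventually_analyticAt hf),
    hle ((factorialDecay_qConst n).eventually_analyticAt hf)] with q hq h1 h2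
  have h1' : ContDiffAt ℝ ∞ (Function.uncurry (lapSeries (fun k => (plusDen n k)⁻¹) f)) q :=
    h1.contDiffAt
  have h2' : ContDiffAt ℝ ∞
    (Function.uncurry (lapSeries (fun k => qConst n k * (plusDen n k)⁻¹) f)) q := h2.contDiffAt
  exact ((contDiffAt_fst_comp (Real.contDiffAt_log.2 hq.ne')).mul h1').sub h2'

/-- By `radialOp_log_mul` the logarithm produces 4S' + nS/ϱ, where S is the series of f with S = f
at ϱ = 0. Apart from n f/ϱ, its coefficient at ϱ^k Δ^(k+1) f is (4(k+1) + n)/plusDen(k+1), and the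
increments of q_k are exactly those for which the q-series absorbs it. -/
theorem eventually_logSeries (n : ℕ) {f : Z d p → ℝ} (hf : AnalyticAt ℝ f z₀) :
    ∀ᶠ q in 𝓝[>] (0 : ℝ) ×ˢ 𝓝 z₀,
      radialOp (2 + n) (fun r => logSeries n f r q.2) q.1 =
        xLap (logSeries n f q.1) q.2 + n * f q.2 / q.1 := by
  have hle := nhdsGT_prod_le z₀
  have hG := (factorialDecay_plusDen n).geometricCauchy hf
  filter_upwards [eventually_pos z₀, hle ((factorialDecay_plusDen n).eventually_analyticAt hf),
    hle ((factorialDecay_qConst n).eventually_analyticAt hf), hle (eventually_plusSeries n hf),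
    hle ((factorialDecay_qConst n).eventually_pde hf (2 + n)), hle hG.eventually_hasDerivAt,
    hle hG.deriv.eventually_hasSum, hle hG.eventually_hasSum] with q hq hA hB h1 h2 h3 h4 h5
  have hA' := (hA.contDiffAt (n := ∞))
  have hB' := (hB.contDiffAt (n := ∞))
  have a1 := (contDiffAt_slice_left hA').of_le two_le_infty
  have a2 := (contDiffAt_slice_left hB').of_le two_le_infty
  have a3 := (contDiffAt_slice_right hA').of_le two_le_infty
  have a4 := (contDiffAt_slice_right hB').of_le two_le_infty
  have hlog : ContDiffAt ℝ 2 Real.log q.1 := Real.contDiffAt_log.2 hq.ne'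
  have e1 : (fun r => logSeries n f r q.2) = fun r =>
      Real.log r * lapSeries (fun k => (plusDen n k)⁻¹) f r q.2 +
        -1 * lapSeries (fun k => qConst n k * (plusDen n k)⁻¹) f r q.2 := by
    funext r; simp only [logSeries]; ring
  have e2 : logSeries n f q.1 = fun z =>
      Real.log q.1 * lapSeries (fun k => (plusDen n k)⁻¹) f q.1 z +
        -1 * lapSeries (fun k => qConst n k * (plusDen n k)⁻¹) f q.1 z := by
    funext z; simp only [logSeries]; ring
  rw [e1, e2, radialOp_add (hlog.mul a1) (contDiffAt_const.mul a2), radialOp_const_mul a2,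
    radialOp_log_mul hq a1, h1, xLap_add (contDiffAt_const.mul a3) (contDiffAt_const.mul a4),
    xLap_const_mul a3, xLap_const_mul a4]
  -- Removing the constant term f from S makes the quotient by ϱ a power series again.
  have h6 : HasSum (fun k : ℕ => (plusDen n (k + 1))⁻¹ * xLap^[k + 1] f q.2 * q.1 ^ k)
      ((lapSeries (fun k => (plusDen n k)⁻¹) f q.1 q.2 - f q.2) / q.1) := by
    have h7 := ((hasSum_nat_add_iff' 1).2 h5).div_const q.1
    simp only [Finset.range_one, Finset.sum_singleton, plusDen_zero, inv_one, one_mul,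
      Function.iterate_zero, id_eq, pow_zero, mul_one] at h7
    refine h7.congr_fun fun k => ?_
    rw [pow_succ]
    field_simp
  have h8 := h2.unique (((h4.mul_left 4).add (h6.mul_left (n : ℝ))).congr_fun fun k => by
    have h9 := (plusDen_pos n k).ne'
    have hn : (0 : ℝ) ≤ n := Nat.cast_nonneg n
    have h10 : 2 * ((k : ℝ) + 1) + n ≠ 0 := by positivity
    have h11 : (n : ℝ) + 2 * (k + 1) ≠ 0 := by positivity
    rw [qConst_succ, plusDen_succ]
    field_simp
    ring)
  have h12 : deriv (fun r => lapSeries (fun k => (plusDen n k)⁻¹) f r q.2) q.1 =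
      rhoSeries (fun k z => ((k : ℝ) + 1) * ((plusDen n (k + 1))⁻¹ * xLap^[k + 1] f z)) q.1 q.2 :=
    h3.deriv
  rw [h12]
  have h13 : ((2 : ℝ) + n - 2) = n := by ring
  rw [h13]
  have h14 : (n : ℝ) * ((lapSeries (fun k => (plusDen n k)⁻¹) f q.1 q.2 - f q.2) / q.1) =
    n * lapSeries (fun k => (plusDen n k)⁻¹) f q.1 q.2 / q.1 - n * f q.2 / q.1 := by ring
  rw [h14] at h8
  linarith

theorem prod_Icc_one_eq_prod_range (g : ℕ → ℝ) (m : ℕ) :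
    ∏ i ∈ Finset.Icc 1 m, g i = ∏ i ∈ Finset.range m, g (i + 1) := by
  induction m with
  | zero => simp
  | succ m ih => rw [Finset.prod_Icc_succ_top (Nat.le_add_left 1 m), Finset.prod_range_succ, ih]

/-- The factor i = 0 in the product defining c_n is -n and cancels; what remains is the defect of
the truncated polynomial, so c_n times the defect n f/ϱ of the logarithmic series balances it. -/
theorem cConst_mul (hs : 1 ≤ s) :
    cConst s * ((2 * s : ℕ) : ℝ) = (minusDen (2 * s) (s - 1))⁻¹ := by
  obtain ⟨m, rfl⟩ : ∃ m, s = m + 1 := ⟨s - 1, by omega⟩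
  have h0 := minusDen_even_ne_zero (s := m + 1) (k := m) (by omega)
  simp only [cConst, minusDen, Nat.add_sub_cancel, prod_Icc_one_eq_prod_range] at h0 ⊢
  rw [Finset.prod_range_succ']
  have h1 : ((2 * (m + 1) : ℕ) : ℝ) ≠ 0 := by positivity
  set P := ∏ i ∈ Finset.range m, (2 * ((i + 1 : ℕ) : ℝ) - ((2 * (m + 1) : ℕ) : ℝ)) with hP
  have hP0 : P ≠ 0 := (mul_ne_zero_iff.1 h0).2
  have h2 : (m ! : ℝ) ≠ 0 := by positivity
  rw [Nat.cast_zero, mul_zero, zero_sub]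
  field_simp

/-- The general solution for even `n = 2s`. -/
def evenSol (s : ℕ) (H α : Z d p → ℝ) (ϱ : ℝ) (z : Z d p) : ℝ :=
  lapSeries (evenCoeff s) H ϱ z + ϱ ^ s *
    (lapSeries (fun k => (plusDen (2 * s) k)⁻¹) α ϱ z +
      cConst s * logSeries (2 * s) (xLap^[s] H) ϱ z)

theorem tendsto_pow_mul_log (hs : 1 ≤ s) :
    Tendsto (fun r : ℝ => r ^ s * Real.log r) (𝓝[>] 0) (𝓝 0) := by
  have h := tendsto_log_mul_rpow_nhdsGT_zero (r := (s : ℝ)) (by exact_mod_cast hs)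
  refine h.congr fun r => ?_
  rw [Real.rpow_natCast, mul_comm]

theorem tendsto_pow_nhdsGT (hs : 1 ≤ s) :
    Tendsto (fun r : ℝ => r ^ s) (𝓝[>] 0) (𝓝 0) := by
  have h := ((continuous_pow s).tendsto (0 : ℝ)).mono_left (nhdsWithin_le_nhds (s := Ioi 0))
  rwa [zero_pow (by omega)] at h

theorem isSolution_evenSol {V : Set (Z d p)} (hs : 1 ≤ s) (hH : AnalyticOnNhd ℝ H V)
    (hα : AnalyticOnNhd ℝ α V) : IsSolution (2 * s) V H (evenSol s H α) := by
  have hf : AnalyticOnNhd ℝ (xLap^[s] H) V := fun z hz => analyticAt_xLap_iterate (hH z hz) s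
  refine isSolution_of (fun z hz => ?_) (fun z hz => ?_) fun z hz => ?_
  · have hle := nhdsGT_prod_le z
    have hHa : ∀ᶠ q in 𝓝 ((0 : ℝ), z), AnalyticAt ℝ H q.2 :=
      (continuous_snd.tendsto ((0 : ℝ), z)).eventually (hH z hz).eventually_analyticAt
    filter_upwards [eventually_pos z, hle hHa,
      hle ((factorialDecay_evenCoeff s).eventually_analyticAt (hH z hz)),
      hle ((factorialDecay_plusDen (2 * s)).eventually_analyticAt (hα z hz)),
      eventually_contDiffAt_logSeries (2 * s) (hf z hz),
      hle (eventually_evenSeries hs (hH z hz)), hle (eventually_plusSeries (2 * s) (hα z hz)),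
      eventually_logSeries (2 * s) (hf z hz)] with q hq hHq hA hB hL h1 h2 h3
    have hA' : ContDiffAt ℝ ∞ (Function.uncurry (lapSeries (evenCoeff s) H)) q := hA.contDiffAt
    have hB' : ContDiffAt ℝ ∞ (Function.uncurry (lapSeries (fun k => (plusDen (2 * s) k)⁻¹) α)) q :=
      hB.contDiffAt
    have hr : ContDiffAt ℝ ∞ (fun r : ℝ => r ^ s) q.1 := (contDiff_id.pow s).contDiffAt
    refine ⟨hA'.add ((contDiffAt_fst_comp hr).mul (hB'.add (contDiffAt_const.mul hL))), ?_⟩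
    rw [pdeAt_iff]
    have a1 := (contDiffAt_slice_left hA').of_le two_le_infty
    have a2 := (contDiffAt_slice_left hB').of_le two_le_infty
    have a3 := (contDiffAt_slice_right hA').of_le two_le_infty
    have a4 := (contDiffAt_slice_right hB').of_le two_le_infty
    have a5 := (contDiffAt_slice_left hL).of_le two_le_infty
    have a6 := (contDiffAt_slice_right hL).of_le two_le_infty
    simp only [evenSol]
    have a7 := a2.add (contDiffAt_const (c := cConst s).mul a5)
    have a8 := a4.add (contDiffAt_const (c := cConst s).mul a6)
    rw [radialOp_add a1 ((hr.of_le two_le_infty).mul a7)]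
    have e1 : (2 : ℝ) - (2 * s : ℕ) = 2 - 2 * (s : ℝ) := by push_cast; ring
    have e3 : (2 : ℝ) + (2 * s : ℕ) = 2 + 2 * (s : ℝ) := by push_cast; ring
    have e2 := radialOp_pow_mul s a7
    rw [← e1, ← e3] at e2
    rw [e2, h1, radialOp_add a2 (contDiffAt_const.mul a5), radialOp_const_mul a5, h2, h3,
      xLap_add hHq.contDiffAt (a3.add (contDiffAt_const.mul a8)),
      xLap_add a3 (contDiffAt_const.mul a8), xLap_const_mul a8,
      xLap_add a4 (contDiffAt_const.mul a6), xLap_const_mul a6, ← cConst_mul hs]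
    -- Times c_n ϱ^s, the defect n f/ϱ becomes a multiple of ϱ^(s-1) and cancels that of the
    -- polynomial.
    have e4 : q.1 ^ s = q.1 ^ (s - 1) * q.1 := by
      rw [← pow_succ, Nat.sub_add_cancel hs]
    rw [e4]
    field_simp
    ring
  · have h1 := (factorialDecay_evenCoeff s).tendsto (hH z hz)
    have h2 := (factorialDecay_plusDen (2 * s)).tendsto (hα z hz)
    have h3 := (factorialDecay_plusDen (2 * s)).tendsto (hf z hz)
    have h4 := (factorialDecay_qConst (2 * s)).tendsto (hf z hz)
    have h5 := (h1.add ((tendsto_pow_nhdsGT hs).mul (h2.sub (h4.const_mul (cConst s))))).add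
      (((tendsto_pow_mul_log hs).mul h3).const_mul (cConst s))
    simp only [evenCoeff, true_or, if_true, zero_mul, mul_zero, add_zero] at h5
    refine h5.congr fun r => ?_
    simp only [evenSol, logSeries]
    ring
  · have h1 := (eventuallyCauchy_of_analyticAt
      ((factorialDecay_evenCoeff s).analyticAt (hH z hz))).mono (nhdsGT_prod_le z)
    have h2 := (eventuallyCauchy_of_analyticAt
      ((factorialDecay_plusDen (2 * s)).analyticAt (hα z hz))).mono (nhdsGT_prod_le z)
    have h3 := (eventuallyCauchy_of_analyticAt
      ((factorialDecay_plusDen (2 * s)).analyticAt (hf z hz))).mono (nhdsGT_prod_le z)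
    have h4 := (eventuallyCauchy_of_analyticAt
      ((factorialDecay_qConst (2 * s)).analyticAt (hf z hz))).mono (nhdsGT_prod_le z)
    have hp : ∀ᶠ q in 𝓝[>] (0 : ℝ) ×ˢ 𝓝 z, |q.1 ^ s| ≤ 1 :=
      ((tendsto_pow_nhdsGT hs).abs.eventually (ge_mem_nhds (by simp : |(0 : ℝ)| < 1))).prod_inl _
    -- The logarithm alone is unbounded; only together with ϱ^s is it an admissible bounded factor.
    have hl : ∀ᶠ q in 𝓝[>] (0 : ℝ) ×ˢ 𝓝 z, |cConst s * (q.1 ^ s * Real.log q.1)| ≤ |cConst s| := by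
      have := ((tendsto_pow_mul_log hs).abs.eventually
        (ge_mem_nhds (by simp : |(0 : ℝ)| < 1))).prod_inl (𝓝 z)
      filter_upwards [this] with q hq
      rw [abs_mul]
      exact mul_le_of_le_one_right (abs_nonneg _) hq
    have hq : ∀ᶠ q in 𝓝[>] (0 : ℝ) ×ˢ 𝓝 z, |-cConst s * q.1 ^ s| ≤ |cConst s| := by
      filter_upwards [hp] with q hq
      rw [abs_mul, abs_neg]
      exact mul_le_of_le_one_right (abs_nonneg _) hq
    have h5 := ((h1.add (h2.mul_of_abs_le (c := fun r => r ^ s) zero_le_one hp)).add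
      (h3.mul_of_abs_le (c := fun r => cConst s * (r ^ s * Real.log r)) (abs_nonneg _) hl)).add (h4.mul_of_abs_le (c := fun r => -cConst s * r ^ s)
        (abs_nonneg _) hq)
    convert h5 using 3 with r z
    simp only [evenSol, logSeries]
    ring

end EvenSeries

/-! ### Barriers and integral estimates for the scalar equation -/

section ScalarEstimates

theorem radialOp_rpow (β m : ℝ) {t : ℝ} (ht : 0 < t) :
    radialOp β (fun t => t ^ m) t = m * (2 * (m - 1) + β) * t ^ (m - 1) := by
  have h : ∀ μ : ℝ, ∀ t : ℝ, 0 < t → HasDerivAt (fun t : ℝ => t ^ μ) (μ * t ^ (μ - 1)) t :=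
    fun μ t ht => Real.hasDerivAt_rpow_const (Or.inl ht.ne')
  rw [radialOp_eq ((lt_mem_nhds ht).mono fun t ht => h m t ht) ((h (m - 1) t ht).const_mul m),
    Real.rpow_sub_one ht.ne' (m - 1)]
  field_simp

theorem contDiffAt_rpow {m t : ℝ} (ht : 0 < t) : ContDiffAt ℝ 2 (fun t : ℝ => t ^ m) t :=
  Real.contDiffAt_rpow_const_of_ne ht.ne'

theorem tendsto_rpow_nhdsGT {m : ℝ} (hm : 0 < m) :
    Tendsto (fun t : ℝ => t ^ m) (𝓝[>] 0) (𝓝 0) := by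
  have h := (Real.continuousAt_rpow_const 0 m (Or.inr hm.le)).tendsto
  rw [Real.zero_rpow hm.ne'] at h
  exact h.mono_left nhdsWithin_le_nhds

/-- Divergence form of the operator, with t^μ as integrating factor: the sign of `radialOp` governs
the monotonicity of the flux t^(μ+1) y'. -/
theorem hasDerivAt_rpow_mul_deriv (μ : ℝ) {y : ℝ → ℝ} {t : ℝ} (ht : 0 < t)
    (hy : ContDiffAt ℝ 2 y t) :
    HasDerivAt (fun t => t ^ (μ + 1) * deriv y t) (t ^ μ / 2 * radialOp (2 + 2 * μ) y t) t := by
  have h1 := (eventually_hasDerivAt_of_contDiffAt hy).2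
  have h2 : HasDerivAt (fun t : ℝ => t ^ (μ + 1)) ((μ + 1) * t ^ (μ + 1 - 1)) t :=
    Real.hasDerivAt_rpow_const (Or.inl ht.ne')
  refine (h2.fun_mul h1).congr_deriv ?_
  rw [add_sub_cancel_right, Real.rpow_add_one ht.ne', radialOp]
  ring

/-- A minimum principle: supersolutions that vanish at `0` and are nonnegative at `ε` are
nonnegative. -/
theorem nonneg_of_radialOp_nonpos {ν ε : ℝ} {v : ℝ → ℝ}
    (hv : ∀ t ∈ Ioc 0 ε, ContDiffAt ℝ 2 v t)
    (hop : ∀ t ∈ Ioo 0 ε, radialOp (2 - 2 * ν) v t ≤ 0) (h0 : Tendsto v (𝓝[>] 0) (𝓝 0))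
    (hend : 0 ≤ v ε) : ∀ t ∈ Ioc 0 ε, 0 ≤ v t := by
  intro t ht
  by_contra! hneg
  have htε : t < ε := lt_of_le_of_ne ht.2 (by rintro rfl; linarith)
  have hG : AntitoneOn (fun t => t ^ (-ν + 1) * deriv v t) (Ioo 0 ε) := by
    have hd : ∀ t ∈ Ioo 0 ε, HasDerivAt (fun t => t ^ (-ν + 1) * deriv v t)
        (t ^ (-ν) / 2 * radialOp (2 + 2 * (-ν)) v t) t := fun t ht =>
      hasDerivAt_rpow_mul_deriv (-ν) ht.1 (hv t ⟨ht.1, ht.2.le⟩)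
    refine antitoneOn_of_deriv_nonpos (convex_Ioo 0 ε)
      (fun t ht => (hd t ht).continuousAt.continuousWithinAt)
      (fun t ht => (hd t (interior_subset ht)).differentiableAt.differentiableWithinAt)
      fun t ht => ?_
    have ht' := interior_subset ht
    rw [(hd t ht').deriv]
    refine mul_nonpos_of_nonneg_of_nonpos ?_ ?_
    · exact div_nonneg (Real.rpow_nonneg ht'.1.le _) zero_le_two
    · have := hop t ht'
      rwa [show (2 : ℝ) + 2 * (-ν) = 2 - 2 * ν by ring]
  have hcd : ∀ a b, 0 < a → b ≤ ε → ContinuousOn v (Icc a b) ∧ DifferentiableOn ℝ v (Ioo a b) :=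
    fun a b ha hb => ⟨fun r hr => (hv r ⟨ha.trans_le hr.1, hr.2.trans hb⟩).continuousAt.continuousWithinAt,
      fun r hr => ((hv r ⟨ha.trans hr.1, hr.2.le.trans hb⟩).differentiableAt
        (by simp)).differentiableWithinAt⟩
  -- A negative value at t, between the limit 0 at the origin and v(ε) ≥ 0, forces v' < 0 somewhere
  -- before t and v' > 0 somewhere after. The flux t^(1-ν) v' would change from negative to positive
  -- although it is decreasing.
  obtain ⟨t₁, ht₁, ht₁0, ht₁t⟩ : ∃ t₁, v t < v t₁ ∧ 0 < t₁ ∧ t₁ < t := by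
    have h1 : ∀ᶠ r in 𝓝[>] (0 : ℝ), v t < v r := h0.eventually (lt_mem_nhds hneg)
    have h2 : ∀ᶠ r in 𝓝[>] (0 : ℝ), r ∈ Ioo 0 t := Ioo_mem_nhdsGT ht.1
    obtain ⟨r, hr1, hr2⟩ := (h1.and h2).exists
    exact ⟨r, hr1, hr2.1, hr2.2⟩
  obtain ⟨ξ₁, hξ₁, e₁⟩ := exists_deriv_eq_slope v ht₁t (hcd t₁ t ht₁0 ht.2).1 (hcd t₁ t ht₁0 ht.2).2
  obtain ⟨ξ₂, hξ₂, e₂⟩ := exists_deriv_eq_slope v htε (hcd t ε ht.1 le_rfl).1 (hcd t ε ht.1 le_rfl).2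
  have s₁ : deriv v ξ₁ < 0 := by rw [e₁]; exact div_neg_of_neg_of_pos (by linarith) (by linarith)
  have s₂ : 0 < deriv v ξ₂ := by rw [e₂]; exact div_pos (by linarith) (by linarith)
  have hξ₁0 : 0 < ξ₁ := ht₁0.trans hξ₁.1
  have hξ₂0 : 0 < ξ₂ := ht.1.trans hξ₂.1
  have hle := hG ⟨hξ₁0, hξ₁.2.trans htε⟩ ⟨hξ₂0, hξ₂.2⟩ (hξ₁.2.trans hξ₂.1).le
  have p₁ : ξ₁ ^ (-ν + 1) * deriv v ξ₁ < 0 :=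
    mul_neg_of_pos_of_neg (Real.rpow_pos_of_pos hξ₁0 _) s₁
  have p₂ : 0 < ξ₂ ^ (-ν + 1) * deriv v ξ₂ := mul_pos (Real.rpow_pos_of_pos hξ₂0 _) s₂
  linarith

/-- The minimum principle is applied to w + y and w - y. -/
theorem abs_le_of_barrier {ν ε : ℝ} {y w : ℝ → ℝ}
    (hy : ∀ t ∈ Ioc 0 ε, ContDiffAt ℝ 2 y t) (hw : ∀ t ∈ Ioc 0 ε, ContDiffAt ℝ 2 w t)
    (hop : ∀ t ∈ Ioo 0 ε, radialOp (2 - 2 * ν) w t ≤ -|radialOp (2 - 2 * ν) y t|)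
    (hy0 : Tendsto y (𝓝[>] 0) (𝓝 0)) (hw0 : Tendsto w (𝓝[>] 0) (𝓝 0)) (hend : |y ε| ≤ w ε) :
    ∀ t ∈ Ioc 0 ε, |y t| ≤ w t := by
  intro t ht
  have key : ∀ c : ℝ, |c| = 1 → 0 ≤ w t + c * y t := fun c hc => by
    refine nonneg_of_radialOp_nonpos (ν := ν) (v := fun t => w t + c * y t)
      (fun t ht => (hw t ht).add (contDiffAt_const.mul (hy t ht))) (fun t ht => ?_) ?_ ?_ t ht
    · have ht' : t ∈ Ioc 0 ε := ⟨ht.1, ht.2.le⟩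
      rw [radialOp_add (hw t ht') (contDiffAt_const.mul (hy t ht')), radialOp_const_mul (hy t ht')]
      have h1 := le_abs_self (c * radialOp (2 - 2 * ν) y t)
      rw [abs_mul, hc, one_mul] at h1
      linarith [hop t ht]
    · simpa using hw0.add (hy0.const_mul c)
    · have h1 := neg_abs_le (c * y ε)
      rw [abs_mul, hc, one_mul] at h1
      linarith
  rw [_root_.abs_le]
  constructor
  · linarith [key 1 (by simp)]
  · linarith [key (-1) (by simp)]

/-- Solutions of `2 ϱ y'' + (2 - n) y' = O(ϱ^(i/2))` that vanish at `0` are `O(ϱ^((i+1)/2))` as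
long as `i < n`. -/
theorem exists_abs_le_rpow {n i : ℕ} (hi : i + 1 ≤ n) {ε : ℝ} (hε : 0 < ε) (hε1 : ε ≤ 1) :
    ∃ K : ℝ, 0 ≤ K ∧ ∀ (y : ℝ → ℝ) (B : ℝ), 0 ≤ B → (∀ t ∈ Ioc 0 ε, ContDiffAt ℝ 2 y t) →
      Tendsto y (𝓝[>] 0) (𝓝 0) → |y ε| ≤ B →
      (∀ t ∈ Ioo 0 ε, |radialOp (2 - n) y t| ≤ B * t ^ ((i : ℝ) / 2)) →
      ∀ t ∈ Ioc 0 ε, |y t| ≤ K * B * t ^ (((i + 1 : ℕ) : ℝ) / 2) := by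
  set m : ℝ := ((i + 1 : ℕ) : ℝ) / 2 with hm
  have hi0 : (0 : ℝ) ≤ i := Nat.cast_nonneg i
  have hm' : m = (i : ℝ) / 2 + 1 / 2 := by rw [hm]; push_cast; ring
  have hm2 : 1 / 2 ≤ m := by linarith
  have hnν : (2 : ℝ) - n = 2 - 2 * ((n : ℝ) / 2) := by ring
  have hεm : 0 < ε ^ m := Real.rpow_pos_of_pos hε m
  -- The summand 4 makes the barrier dominate the right-hand side, and 1/ε^m makes it dominate |y|
  -- at the endpoint ε.
  set K₀ : ℝ := 4 + 1 / ε ^ m with hK₀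
  have hK₀p : 0 < K₀ := by positivity
  have hKε : 1 ≤ K₀ * ε ^ m := by
    rw [hK₀, add_mul, one_div, inv_mul_cancel₀ hεm.ne']; linarith [hεm]
  refine ⟨2 * K₀, by positivity, fun y B hB hy hy0 hend hop => ?_⟩
  -- For m < n/2 the operator sends t^m to -m(n-2m) t^(m-1), with m(n-2m) ≥ 1/2; since t ≤ 1,
  -- t^(m-1) exceeds t^(i/2), and t^m is a barrier.
  rcases Nat.lt_or_ge (i + 1) n with h2 | h2
  · have hmn : 2 * m + 1 ≤ n := by
      rw [hm]
      have : ((i + 1 + 1 : ℕ) : ℝ) ≤ n := by exact_mod_cast h2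
      push_cast at this ⊢
      linarith
    have hmain : ∀ t ∈ Ioc 0 ε, |y t| ≤ K₀ * B * t ^ m := by
      refine abs_le_of_barrier (ν := (n : ℝ) / 2) hy
        (fun t ht => contDiffAt_const.mul (contDiffAt_rpow ht.1)) (fun t ht => ?_) hy0 ?_ ?_
      · rw [radialOp_const_mul (contDiffAt_rpow ht.1), radialOp_rpow _ _ ht.1, ← hnν]
        have ht1 : t ^ ((i : ℝ) / 2) ≤ t ^ (m - 1) :=
          Real.rpow_le_rpow_of_exponent_ge ht.1 (ht.2.le.trans hε1) (by linarith)
        have h3 := hop t ht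
        have h4 : 0 < t ^ (m - 1) := Real.rpow_pos_of_pos ht.1 _
        have h5 : B * t ^ ((i : ℝ) / 2) ≤ B * t ^ (m - 1) := by gcongr
        have h6 : 1 ≤ K₀ * (m * (n - 2 * m)) := by
          have h7 : 1 / 2 ≤ m * (n - 2 * m) := by nlinarith
          have h8 : 4 ≤ K₀ := by
            rw [hK₀]
            have : (0 : ℝ) ≤ 1 / ε ^ m := by positivity
            linarith
          nlinarith
        have h7 : B * t ^ (m - 1) * 1 ≤ B * t ^ (m - 1) * (K₀ * (m * (n - 2 * m))) := by gcongr
        have e : K₀ * B * (m * (2 * (m - 1) + (2 - n)) * t ^ (m - 1)) =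
            -(B * t ^ (m - 1) * (K₀ * (m * (n - 2 * m)))) := by ring
        rw [e]
        linarith
      · simpa using (tendsto_rpow_nhdsGT (by linarith : 0 < m)).const_mul (K₀ * B)
      · nlinarith
    intro t ht
    have h3 : 0 ≤ t ^ m := Real.rpow_nonneg ht.1.le m
    have h4 : 0 ≤ K₀ * B * t ^ m := by positivity
    linarith [hmain t ht]
  · have hin : i + 1 = n := le_antisymm hi h2
    have hmn : (n : ℝ) = 2 * m := by rw [hm, hin]; ring
    -- At m = n/2 the power t^m is annihilated. Subtracting t^(m+1/2), whose image is (m+1/2)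
    -- t^(i/2), restores strictness; the factor 2 keeps the barrier large enough at ε.
    have hmain : ∀ t ∈ Ioc 0 ε, |y t| ≤ 2 * K₀ * B * t ^ m + -(K₀ * B) * t ^ (m + 1 / 2) := by
      refine abs_le_of_barrier (ν := (n : ℝ) / 2) hy
        (fun t ht => (contDiffAt_const.mul (contDiffAt_rpow ht.1)).add
          (contDiffAt_const.mul (contDiffAt_rpow ht.1))) (fun t ht => ?_) hy0 ?_ ?_
      · rw [radialOp_add (contDiffAt_const.mul (contDiffAt_rpow ht.1))
            (contDiffAt_const.mul (contDiffAt_rpow ht.1)),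
          radialOp_const_mul (contDiffAt_rpow ht.1), radialOp_const_mul (contDiffAt_rpow ht.1),
          radialOp_rpow _ _ ht.1, radialOp_rpow _ _ ht.1, ← hnν]
        have h3 := hop t ht
        have e1 : m + 1 / 2 - 1 = (i : ℝ) / 2 := by rw [hm']; ring
        rw [e1, hmn] at *
        have h4 : 0 < t ^ ((i : ℝ) / 2) := Real.rpow_pos_of_pos ht.1 _
        have h6 : 1 ≤ K₀ * (m + 1 / 2) := by
          have h8 : 4 ≤ K₀ := by
            rw [hK₀]
            have : (0 : ℝ) ≤ 1 / ε ^ m := by positivity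
            linarith
          nlinarith
        have h7 : B * t ^ ((i : ℝ) / 2) * 1 ≤ B * t ^ ((i : ℝ) / 2) * (K₀ * (m + 1 / 2)) := by gcongr
        have e2 : 2 * K₀ * B * (m * (2 * (m - 1) + (2 - 2 * m)) * t ^ (m - 1)) +
            -(K₀ * B) * ((m + 1 / 2) * (2 * ((i : ℝ) / 2) + (2 - 2 * m)) * t ^ ((i : ℝ) / 2)) =
            -(B * t ^ ((i : ℝ) / 2) * (K₀ * (m + 1 / 2))) := by
          linear_combination (2 * K₀ * B * (m + 1 / 2) * t ^ ((i : ℝ) / 2)) * hm'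
        rw [e2]
        linarith
      · simpa using ((tendsto_rpow_nhdsGT (by linarith : 0 < m)).const_mul (2 * K₀ * B)).add
          ((tendsto_rpow_nhdsGT (by linarith : 0 < m + 1 / 2)).const_mul (-(K₀ * B)))
      · have h3 : ε ^ (m + 1 / 2) ≤ ε ^ m :=
          Real.rpow_le_rpow_of_exponent_ge hε hε1 (by linarith)
        have h4 : K₀ * B * ε ^ (m + 1 / 2) ≤ K₀ * B * ε ^ m := by gcongr
        nlinarith
    intro t ht
    have h3 : 0 ≤ t ^ (m + 1 / 2) := Real.rpow_nonneg ht.1.le _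
    have h4 : 0 ≤ K₀ * B * t ^ (m + 1 / 2) := by positivity
    linarith [hmain t ht]

/-- Bounded solutions of `2 ϱ x'' + (2 + 2ν) x' = O(ϱ^a)` have `x' = O(ϱ^a)`. -/
theorem deriv_le_of_radialOp_le {ν ε B C : ℝ} (hν : 0 < ν) (hB : 0 ≤ B) {x : ℝ → ℝ} (a : ℕ)
    (hx : ∀ t ∈ Ioo 0 ε, ContDiffAt ℝ 2 x t) (hC : ∀ t ∈ Ioo 0 ε, |x t| ≤ C)
    (hop : ∀ t ∈ Ioo 0 ε, radialOp (2 + 2 * ν) x t ≤ B * t ^ a) :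
    ∀ t ∈ Ioo 0 ε, deriv x t ≤ B / (2 * (a + 1) + 2 * ν) * t ^ a := by
  intro t ht
  set D : ℝ := B / (2 * (a + 1) + 2 * ν) with hD
  have ha : (0 : ℝ) ≤ a := Nat.cast_nonneg a
  have hden : 0 < 2 * ((a : ℝ) + 1) + 2 * ν := by positivity
  have hD0 : 0 ≤ D := by positivity
  have hd : ∀ t ∈ Ioo 0 ε, HasDerivAt (fun t => t ^ (ν + 1) * deriv x t - D * t ^ ((a : ℝ) + 1 + ν))
      (t ^ ν / 2 * radialOp (2 + 2 * ν) x t - D * (((a : ℝ) + 1 + ν) * t ^ ((a : ℝ) + 1 + ν - 1))) t :=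
    fun t ht => (hasDerivAt_rpow_mul_deriv ν ht.1 (hx t ht)).sub
      ((Real.hasDerivAt_rpow_const (Or.inl ht.1.ne')).const_mul D)
  have hG : AntitoneOn (fun t => t ^ (ν + 1) * deriv x t - D * t ^ ((a : ℝ) + 1 + ν)) (Ioo 0 ε) := by
    refine antitoneOn_of_deriv_nonpos (convex_Ioo 0 ε)
      (fun t ht => (hd t ht).continuousAt.continuousWithinAt)
      (fun t ht => (hd t (interior_subset ht)).differentiableAt.differentiableWithinAt)
      fun t ht => ?_
    have ht' := interior_subset ht
    rw [(hd t ht').deriv]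
    have e : t ^ ((a : ℝ) + 1 + ν - 1) = t ^ ν * t ^ a := by
      rw [show (a : ℝ) + 1 + ν - 1 = ν + (a : ℝ) by ring, Real.rpow_add ht'.1, Real.rpow_natCast]
    have e2 : D * (((a : ℝ) + 1 + ν) * (t ^ ν * t ^ a)) = t ^ ν / 2 * (B * t ^ a) := by
      rw [hD]; field_simp
    rw [e, e2, ← mul_sub]
    exact mul_nonpos_of_nonneg_of_nonpos (div_nonneg (Real.rpow_nonneg ht'.1.le _) zero_le_two)
      (by linarith [hop t ht'])
  have hmain : t ^ (ν + 1) * deriv x t - D * t ^ ((a : ℝ) + 1 + ν) ≤ 0 := by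
    by_contra! hpos
    set η := t ^ (ν + 1) * deriv x t - D * t ^ ((a : ℝ) + 1 + ν) with hη
    have hC0 : 0 ≤ C := (abs_nonneg _).trans (hC t ht)
    -- A positive value η of the decreasing corrected flux would persist towards 0. On (τ/2, τ),
    -- however, boundedness and the mean value theorem give a point with x' ≤ 4C/τ, where the flux
    -- is at most 4Cτ^ν. This is how boundedness excludes the solution t^(-ν).
    obtain ⟨τ, hτη, hτ0, hτt⟩ : ∃ τ : ℝ, 4 * C * τ ^ ν < η ∧ 0 < τ ∧ τ < t := by
      have h1 := (tendsto_rpow_nhdsGT hν).const_mul (4 * C)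
      rw [mul_zero] at h1
      have h2 : ∀ᶠ r in 𝓝[>] (0 : ℝ), r ∈ Ioo 0 t := Ioo_mem_nhdsGT ht.1
      obtain ⟨r, hr1, hr2⟩ := ((h1.eventually (gt_mem_nhds hpos)).and h2).exists
      exact ⟨r, hr1, hr2.1, hr2.2⟩
    have hsub : ∀ r ∈ Icc (τ / 2) τ, r ∈ Ioo 0 ε := fun r hr =>
      ⟨by linarith [hr.1], by linarith [hr.2, ht.2]⟩
    obtain ⟨ξ, hξ, e⟩ := exists_deriv_eq_slope x (by linarith : τ / 2 < τ)
      (fun r hr => (hx r (hsub r hr)).continuousAt.continuousWithinAt)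
      (fun r hr => ((hx r (hsub r ⟨hr.1.le, hr.2.le⟩)).differentiableAt
        (by simp)).differentiableWithinAt)
    have hξ' := hsub ξ ⟨hξ.1.le, hξ.2.le⟩
    have h1 : deriv x ξ ≤ 4 * C / τ := by
      rw [e, div_le_div_iff₀ (by linarith) hτ0]
      have h2 := (_root_.abs_le.1 (hC τ (hsub τ ⟨by linarith, le_rfl⟩))).2
      have h3 := (_root_.abs_le.1 (hC (τ / 2) (hsub _ ⟨le_rfl, by linarith⟩))).1
      nlinarith
    have h2 := hG hξ' ht (by linarith [hξ.2])
    have h3 : ξ ^ (ν + 1) * deriv x ξ ≤ 4 * C * τ ^ ν := by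
      have h4 : ξ ^ (ν + 1) ≤ τ ^ (ν + 1) := Real.rpow_le_rpow hξ'.1.le hξ.2.le (by linarith)
      have h5 : 0 ≤ ξ ^ (ν + 1) := Real.rpow_nonneg hξ'.1.le _
      calc ξ ^ (ν + 1) * deriv x ξ ≤ ξ ^ (ν + 1) * (4 * C / τ) := by gcongr
        _ ≤ τ ^ (ν + 1) * (4 * C / τ) := by gcongr
        _ = 4 * C * τ ^ ν := by rw [Real.rpow_add_one hτ0.ne']; field_simp
    have h6 : 0 ≤ D * ξ ^ ((a : ℝ) + 1 + ν) := mul_nonneg hD0 (Real.rpow_nonneg hξ'.1.le _)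
    simp only at h2
    linarith
  have e : t ^ ((a : ℝ) + 1 + ν) = t ^ (ν + 1) * t ^ a := by
    rw [show (a : ℝ) + 1 + ν = (ν + 1) + (a : ℝ) by ring, Real.rpow_add ht.1, Real.rpow_natCast]
  rw [e] at hmain
  have hp : 0 < t ^ (ν + 1) := Real.rpow_pos_of_pos ht.1 _
  have h7 : t ^ (ν + 1) * (deriv x t - D * t ^ a) ≤ 0 := by linarith
  linarith [nonpos_of_mul_nonpos_right h7 hp]

theorem abs_deriv_le_of_radialOp_le {ν ε B C : ℝ} (hν : 0 < ν) (hB : 0 ≤ B) {x : ℝ → ℝ} (a : ℕ)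
    (hx : ∀ t ∈ Ioo 0 ε, ContDiffAt ℝ 2 x t) (hC : ∀ t ∈ Ioo 0 ε, |x t| ≤ C)
    (hop : ∀ t ∈ Ioo 0 ε, |radialOp (2 + 2 * ν) x t| ≤ B * t ^ a) :
    ∀ t ∈ Ioo 0 ε, |deriv x t| ≤ B / (2 * (a + 1) + 2 * ν) * t ^ a := by
  intro t ht
  have h1 := deriv_le_of_radialOp_le hν hB a hx hC (fun t ht => (le_abs_self _).trans (hop t ht)) t ht
  have h2 := deriv_le_of_radialOp_le (x := fun t => -1 * x t) hν hB a
    (fun t ht => contDiffAt_const.mul (hx t ht)) (fun t ht => by simpa using hC t ht)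
    (fun t ht => by
      rw [radialOp_const_mul (hx t ht)]
      have := neg_abs_le (radialOp (2 + 2 * ν) x t)
      linarith [hop t ht]) t ht
  rw [deriv_const_mul _ ((hx t ht).differentiableAt (by simp))] at h2
  rw [_root_.abs_le]
  constructor <;> linarith

/-- Solutions of `2 ϱ x'' + (2 + 2ν) x' = O(ϱ^a)` that vanish at `0` are `O(ϱ^(a+1))`. -/
theorem abs_le_of_radialOp_le {ν ε B : ℝ} (hν : 0 < ν) (hB : 0 ≤ B) {x : ℝ → ℝ} (a : ℕ)
    (hx : ∀ t ∈ Ioo 0 ε, ContDiffAt ℝ 2 x t) {C : ℝ} (hC : ∀ t ∈ Ioo 0 ε, |x t| ≤ C)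
    (hop : ∀ t ∈ Ioo 0 ε, |radialOp (2 + 2 * ν) x t| ≤ B * t ^ a)
    (h0 : Tendsto x (𝓝[>] 0) (𝓝 0)) :
    ∀ t ∈ Ioo 0 ε, |x t| ≤ B / ((a + 1) * (2 * (a + 1) + 2 * ν)) * t ^ (a + 1) := by
  have ha : (0 : ℝ) ≤ a := Nat.cast_nonneg a
  set D : ℝ := B / ((a + 1) * (2 * (a + 1) + 2 * ν)) with hD
  have hder := abs_deriv_le_of_radialOp_le hν hB a hx hC hop
  -- Both signs are treated together: ±x - D t^(a+1) is decreasing by the derivative bound and tends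
  -- to 0 at the origin.
  have key : ∀ c : ℝ, |c| = 1 → ∀ t ∈ Ioo 0 ε, c * x t - D * t ^ (a + 1) ≤ 0 := fun c hc t ht => by
    have hd : ∀ t ∈ Ioo 0 ε, HasDerivAt (fun t => c * x t - D * t ^ (a + 1))
        (c * deriv x t - D * (((a + 1 : ℕ) : ℝ) * t ^ a)) t := fun t ht =>
      ((((hx t ht).differentiableAt (by simp)).hasDerivAt).const_mul c).sub
        ((hasDerivAt_pow (a + 1) t).const_mul D)
    have hanti : AntitoneOn (fun t => c * x t - D * t ^ (a + 1)) (Ioo 0 ε) := by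
      refine antitoneOn_of_deriv_nonpos (convex_Ioo 0 ε)
        (fun t ht => (hd t ht).continuousAt.continuousWithinAt)
        (fun t ht => (hd t (interior_subset ht)).differentiableAt.differentiableWithinAt)
        fun t ht => ?_
      have ht' := interior_subset ht
      rw [(hd t ht').deriv]
      have h1 := (le_abs_self (c * deriv x t)).trans_eq (by rw [abs_mul, hc, one_mul])
      have e : D * (((a + 1 : ℕ) : ℝ) * t ^ a) = B / (2 * (a + 1) + 2 * ν) * t ^ a := by
        rw [hD]; push_cast; field_simp
      rw [e]
      linarith [hder t ht']
    have hlim : Tendsto (fun t => c * x t - D * t ^ (a + 1)) (𝓝[>] 0) (𝓝 0) := by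
      simpa using (h0.const_mul c).sub ((tendsto_pow_nhdsGT (Nat.le_add_left 1 a)).const_mul D)
    refine ge_of_tendsto hlim ?_
    filter_upwards [Ioo_mem_nhdsGT ht.1] with r hr
    exact hanti ⟨hr.1, hr.2.trans ht.2⟩ ht hr.2.le
  intro t ht
  have k1 := key 1 (by simp) t ht
  have k2 := key (-1) (by simp) t ht
  rw [_root_.abs_le]
  constructor <;> linarith

end ScalarEstimates

/-! ### Pointwise convergence passes to derivatives -/

section Landau

variable {E : Type*} [NormedAddCommGroup E] [NormedSpace ℝ E]

theorem hasDerivAt_iteratedFDeriv_line {g : E → ℝ} {z v : E} {t : ℝ} {k : ℕ}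
    (hg : ContDiffAt ℝ ∞ g (z + t • v)) (w : Fin k → E) :
    HasDerivAt (fun t : ℝ => iteratedFDeriv ℝ k g (z + t • v) w)
      (iteratedFDeriv ℝ (k + 1) g (z + t • v) (Fin.cons v w)) t := by
  have h2 : DifferentiableAt ℝ (iteratedFDeriv ℝ k g) (z + t • v) :=
    hg.differentiableAt_iteratedFDeriv (by exact_mod_cast ENat.natCast_lt_top k)
  have h3 : HasDerivAt (fun t : ℝ => z + t • v) v t := by
    simpa using ((hasDerivAt_id t).smul_const v).const_add z
  have h4 := h2.hasFDerivAt.comp_hasDerivAt t h3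
  have h5 := ((ContinuousMultilinearMap.apply ℝ (fun _ : Fin k => E) ℝ w).hasFDerivAt.comp_hasDerivAt
    t h4)
  exact h5

/-- If functions with uniformly bounded derivatives tend to `0` pointwise, then so do their
derivatives. -/
theorem tendsto_iteratedFDeriv_of_tendsto {ι : Type*} {l : Filter ι} {g : ι → E → ℝ} {U : Set E}
    (hU : IsOpen U) {C : ℕ → ℝ} (hg : ∀ᶠ i in l, ∀ z ∈ U, ContDiffAt ℝ ∞ (g i) z ∧
      ∀ k, ‖iteratedFDeriv ℝ k (g i) z‖ ≤ C k)
    (h0 : ∀ z ∈ U, Tendsto (fun i => g i z) l (𝓝 0)) (k : ℕ) (w : Fin k → E) :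
    ∀ z ∈ U, Tendsto (fun i => iteratedFDeriv ℝ k (g i) z w) l (𝓝 0) := by
  induction k with
  | zero => intro z hz; simpa using h0 z hz
  | succ k ih =>
    intro z hz
    set v := w 0 with hv
    set w' : Fin k → E := Fin.tail w with hw'
    have hw : w = Fin.cons v w' := (Fin.cons_self_tail w).symm
    obtain ⟨δ, hδ, hball⟩ := Metric.isOpen_iff.1 hU z hz
    have hC0 : ∀ᶠ _i in l, 0 ≤ C (k + 2) := by
      filter_upwards [hg] with i hi using (norm_nonneg _).trans ((hi z hz).2 (k + 2))
    set M : ℝ := |C (k + 2)| * ∏ j, ‖(Fin.cons v (Fin.cons v w') : Fin (k + 2) → E) j‖ with hM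
    have hM0 : 0 ≤ M := by positivity
    rw [Metric.tendsto_nhds]
    intro e he
    -- The derivative differs by at most Mη from a difference quotient of step η, where M bounds the
    -- second derivative along the segment. For fixed η the quotient tends to 0 by induction, so η
    -- only has to keep the segment in U and Mη below e/2.
    obtain ⟨η, hη0, hηδ, hηM⟩ : ∃ η : ℝ, 0 < η ∧ η * ‖v‖ < δ ∧ M * η < e / 2 := by
      refine ⟨min (δ / (2 * (‖v‖ + 1))) (e / (4 * (M + 1))), by positivity, ?_, ?_⟩
      · calc _ ≤ δ / (2 * (‖v‖ + 1)) * ‖v‖ := by gcongr; exact min_le_left _ _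
          _ < δ := by
            rw [div_mul_eq_mul_div, div_lt_iff₀ (by positivity)]
            nlinarith [norm_nonneg v]
      · calc _ ≤ M * (e / (4 * (M + 1))) := by gcongr; exact min_le_right _ _
          _ < e / 2 := by
            rw [mul_div_assoc', div_lt_div_iff₀ (by positivity) (by norm_num)]
            nlinarith
    have hseg : ∀ t ∈ Icc (0 : ℝ) η, z + t • v ∈ U := fun t ht => by
      refine hball ?_
      rw [Metric.mem_ball, dist_eq_norm, add_sub_cancel_left, norm_smul, Real.norm_eq_abs,
        abs_of_nonneg ht.1]
      exact (mul_le_mul_of_nonneg_right ht.2 (norm_nonneg _)).trans_lt hηδ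
    have hlim : Tendsto (fun i => (iteratedFDeriv ℝ k (g i) (z + η • v) w' -
        iteratedFDeriv ℝ k (g i) z w') / η) l (𝓝 0) := by
      simpa using ((ih w' _ (hseg η ⟨hη0.le, le_rfl⟩)).sub (ih w' z hz)).div_const η
    filter_upwards [hg, Metric.tendsto_nhds.1 hlim (e / 2) (half_pos he)] with i hi hq
    rw [dist_zero_right, Real.norm_eq_abs] at hq ⊢
    have hd1 : ∀ t ∈ Icc (0 : ℝ) η, HasDerivAt (fun t : ℝ => iteratedFDeriv ℝ k (g i) (z + t • v) w')
        (iteratedFDeriv ℝ (k + 1) (g i) (z + t • v) (Fin.cons v w')) t := fun t ht =>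
      hasDerivAt_iteratedFDeriv_line (hi _ (hseg t ht)).1 w'
    have hd2 : ∀ t ∈ Icc (0 : ℝ) η,
        HasDerivAt (fun t : ℝ => iteratedFDeriv ℝ (k + 1) (g i) (z + t • v) (Fin.cons v w'))
        (iteratedFDeriv ℝ (k + 2) (g i) (z + t • v) (Fin.cons v (Fin.cons v w'))) t := fun t ht =>
      hasDerivAt_iteratedFDeriv_line (hi _ (hseg t ht)).1 _
    obtain ⟨ξ, hξ, e1⟩ := exists_hasDerivAt_eq_slope _ _ hη0
      (fun t ht => (hd1 t ht).continuousAt.continuousWithinAt) fun t ht => hd1 t ⟨ht.1.le, ht.2.le⟩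
    have hlip := (convex_Icc (0 : ℝ) η).norm_image_sub_le_of_norm_hasDerivWithin_le
      (fun t ht => (hd2 t ht).hasDerivWithinAt) (C := M) (fun t ht => by
        refine (ContinuousMultilinearMap.le_opNorm _ _).trans ?_
        rw [hM]
        gcongr
        exact ((hi _ (hseg t ht)).2 (k + 2)).trans (le_abs_self _))
      (⟨le_rfl, hη0.le⟩ : (0 : ℝ) ∈ Icc 0 η) ⟨hξ.1.le, hξ.2.le⟩
    rw [e1] at hlip
    simp only [zero_smul, add_zero, sub_zero, Real.norm_eq_abs, abs_of_pos hξ.1] at hlip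
    rw [← hw] at hlip
    have h2 : M * ξ ≤ M * η := by gcongr; exact hξ.2.le
    have h3 := abs_sub_abs_le_abs_sub (iteratedFDeriv ℝ (k + 1) (g i) z w)
      ((iteratedFDeriv ℝ k (g i) (z + η • v) w' - iteratedFDeriv ℝ k (g i) z w') / η)
    rw [abs_sub_comm] at h3
    linarith

end Landau

/-! ### The operators on functions of (ϱ, z), and their commutation -/

section JointOperators

variable {d p : ℕ}

/-- The operator `2 ϱ ∂² + β ∂` on functions of `(ϱ, z)`. -/
def jointOp (β : ℝ) (f : ℝ × Z d p → ℝ) (q : ℝ × Z d p) : ℝ :=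
  2 * q.1 * dirDeriv (1, 0) (dirDeriv (1, 0) f) q + β * dirDeriv (1, 0) f q

/-- The Laplacian in `x` on functions of `(ϱ, z)`. -/
def jointLap (f : ℝ × Z d p → ℝ) (q : ℝ × Z d p) : ℝ :=
  ∑ i, dirDeriv (0, xUnit i) (dirDeriv (0, xUnit i) f) q

theorem hasDerivAt_slice_left {f : ℝ × Z d p → ℝ} {q : ℝ × Z d p} (hf : DifferentiableAt ℝ f q) :
    HasDerivAt (fun t => f (t, q.2)) (dirDeriv (1, 0) f q) q.1 := by
  have h : HasDerivAt (fun t : ℝ => (t, q.2)) ((1 : ℝ), (0 : Z d p)) q.1 :=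
    (hasDerivAt_id q.1).prodMk (hasDerivAt_const q.1 q.2)
  exact HasFDerivAt.comp_hasDerivAt q.1 (hf.hasFDerivAt (x := q)) h

theorem dirDeriv_slice {f : ℝ × Z d p → ℝ} {q : ℝ × Z d p} (hf : DifferentiableAt ℝ f q)
    (v : Z d p) : dirDeriv v (fun z => f (q.1, z)) q.2 = dirDeriv (0, v) f q := by
  have h : HasFDerivAt (fun z : Z d p => (q.1, z)) (ContinuousLinearMap.inr ℝ ℝ (Z d p)) q.2 :=
    (hasFDerivAt_const q.1 q.2).prodMk (hasFDerivAt_id q.2)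
  have h2 := HasFDerivAt.comp q.2 (hf.hasFDerivAt (x := q)) h
  have h3 : fderiv ℝ (fun z => f (q.1, z)) q.2 =
    (fderiv ℝ f q).comp (ContinuousLinearMap.inr ℝ ℝ (Z d p)) := h2.fderiv
  simp [dirDeriv, h3]

theorem tendsto_slice_left (q : ℝ × Z d p) : Tendsto (fun t => (t, q.2)) (𝓝 q.1) (𝓝 q) :=
  (Continuous.tendsto (by fun_prop : Continuous fun t : ℝ => (t, q.2)) q.1)

theorem tendsto_slice_right (q : ℝ × Z d p) : Tendsto (fun z => (q.1, z)) (𝓝 q.2) (𝓝 q) :=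
  (Continuous.tendsto (by fun_prop : Continuous fun z : Z d p => (q.1, z)) q.2)

theorem contDiffAt_comp_slice {m : ℕ∞ω} {f : ℝ × Z d p → ℝ} {q : ℝ × Z d p}
    (hf : ContDiffAt ℝ m f q) : ContDiffAt ℝ m (fun z => f (q.1, z)) q.2 :=
  ContDiffAt.comp (g := f) q.2 hf (contDiffAt_const.prodMk contDiffAt_id)

theorem radialOp_slice (β : ℝ) {f : ℝ × Z d p → ℝ} {q : ℝ × Z d p} (hf : ContDiffAt ℝ 2 f q) :
    radialOp β (fun t => f (t, q.2)) q.1 = jointOp β f q := by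
  have h1 : ∀ᶠ t in 𝓝 q.1, HasDerivAt (fun t => f (t, q.2)) (dirDeriv (1, 0) f (t, q.2)) t := by
    filter_upwards [(tendsto_slice_left q).eventually (hf.eventually (by simp))] with t ht
    exact hasDerivAt_slice_left (q := (t, q.2)) (ht.differentiableAt (by simp))
  exact radialOp_eq h1 (hasDerivAt_slice_left (q := q)
    ((contDiffAt_dirDeriv (m := 1) hf (by norm_num) _).differentiableAt (by simp)))

theorem xLap_slice {f : ℝ × Z d p → ℝ} {q : ℝ × Z d p} (hf : ContDiffAt ℝ 2 f q) :
    xLap (fun z => f (q.1, z)) q.2 = jointLap f q := by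
  have h1 := contDiffAt_comp_slice hf
  rw [xLap_eq_sum h1]
  refine Finset.sum_congr rfl fun i _ => ?_
  have h2 : dirDeriv (xUnit i) (fun z => f (q.1, z)) =ᶠ[𝓝 q.2]
      fun z => dirDeriv (0, xUnit i) f (q.1, z) := by
    filter_upwards [(tendsto_slice_right q).eventually (hf.eventually (by simp))] with z hz
    exact dirDeriv_slice (q := (q.1, z)) (hz.differentiableAt (by simp)) _
  rw [(dirDeriv_congr h2 _).self_of_nhds]
  exact dirDeriv_slice ((contDiffAt_dirDeriv (m := 1) hf (by norm_num) _).differentiableAt (by simp)) _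

theorem jointOp_congr (β : ℝ) {f g : ℝ × Z d p → ℝ} {q : ℝ × Z d p} (h : f =ᶠ[𝓝 q] g) :
    jointOp β f q = jointOp β g q := by
  rw [jointOp, jointOp, (dirDeriv_congr h _).self_of_nhds,
    (dirDeriv_congr (dirDeriv_congr h _) _).self_of_nhds]

theorem contDiffAt_jointOp (β : ℝ) {f : ℝ × Z d p → ℝ} {q : ℝ × Z d p} (hf : ContDiffAt ℝ ∞ f q) :
    ContDiffAt ℝ ∞ (jointOp β f) q := by
  have h1 := contDiffAt_infty_dirDeriv hf ((1 : ℝ), (0 : Z d p))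
  exact ((contDiffAt_const.mul contDiffAt_fst).mul (contDiffAt_infty_dirDeriv h1 _)).add
    (contDiffAt_const.mul h1)

theorem dirDeriv_dirDeriv_comm {E : Type*} [NormedAddCommGroup E] [NormedSpace ℝ E] {f : E → ℝ}
    {z : E} (hf : ContDiffAt ℝ ∞ f z) (u v : E) :
    dirDeriv u (dirDeriv v (dirDeriv v f)) z = dirDeriv v (dirDeriv v (dirDeriv u f)) z := by
  rw [dirDeriv_comm ((contDiffAt_infty_dirDeriv hf v).of_le two_le_infty)]
  have h : dirDeriv u (dirDeriv v f) =ᶠ[𝓝 z] dirDeriv v (dirDeriv u f) :=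
    ((hf.of_le two_le_infty).eventually (by simp)).mono fun w hw => dirDeriv_comm hw u v
  exact (dirDeriv_congr h v).self_of_nhds

/-- The coefficient 2ϱ is constant in z, so no extra term arises; mixed partial derivatives commute.
-/
theorem dirDeriv_jointOp (β : ℝ) {f : ℝ × Z d p → ℝ} {q : ℝ × Z d p} (hf : ContDiffAt ℝ ∞ f q)
    (v : Z d p) : dirDeriv (0, v) (jointOp β f) q = jointOp β (dirDeriv (0, v) f) q := by
  have h1 := contDiffAt_infty_dirDeriv hf ((1 : ℝ), (0 : Z d p))
  have h2 := contDiffAt_infty_dirDeriv h1 ((1 : ℝ), (0 : Z d p))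
  have d1 := h1.differentiableAt (by simp)
  have d2 := h2.differentiableAt (by simp)
  have d3 : DifferentiableAt ℝ (fun q : ℝ × Z d p => 2 * q.1) q := by fun_prop
  have e : HasFDerivAt (fun q : ℝ × Z d p => 2 * q.1)
      ((2 : ℝ) • ContinuousLinearMap.fst ℝ ℝ (Z d p)) q := hasFDerivAt_fst.const_mul 2
  unfold jointOp
  rw [dirDeriv_add (d3.fun_mul d2) (d1.const_mul β), dirDeriv_const_mul d1,
    ← dirDeriv_dirDeriv_comm hf, dirDeriv_comm (hf.of_le two_le_infty) (1, 0)]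
  congr 1
  have h3 := (e.fun_mul d2.hasFDerivAt).fderiv
  change fderiv ℝ (fun q : ℝ × Z d p => 2 * q.1 * dirDeriv (1, 0) (dirDeriv (1, 0) f) q) q (0, v) = _
  rw [h3]
  simp [dirDeriv]

theorem dirDeriv_jointLap {f : ℝ × Z d p → ℝ} {q : ℝ × Z d p} (hf : ContDiffAt ℝ ∞ f q)
    (v : ℝ × Z d p) : dirDeriv v (jointLap f) q = jointLap (dirDeriv v f) q := by
  unfold jointLap
  rw [dirDeriv_sum _ fun i _ => (contDiffAt_infty_dirDeriv (contDiffAt_infty_dirDeriv hf _)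
    (0, xUnit i)).differentiableAt (by simp)]
  exact Finset.sum_congr rfl fun i _ => dirDeriv_dirDeriv_comm hf _ _

theorem iteratedFDeriv_succ_apply_eq_dirDeriv {E : Type*} [NormedAddCommGroup E] [NormedSpace ℝ E]
    {g : E → ℝ} {z : E} {k : ℕ} (hg : ContDiffAt ℝ ∞ g z) (v : Fin (k + 1) → E) :
    iteratedFDeriv ℝ (k + 1) g z v =
      dirDeriv (v 0) (fun w => iteratedFDeriv ℝ k g w (Fin.tail v)) z := by
  rw [iteratedFDeriv_succ_apply_left, dirDeriv]
  have h2 : DifferentiableAt ℝ (iteratedFDeriv ℝ k g) z :=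
    hg.differentiableAt_iteratedFDeriv (by exact_mod_cast ENat.natCast_lt_top k)
  have h5 := ((ContinuousMultilinearMap.apply ℝ (fun _ : Fin k => E) ℝ (Fin.tail v)).hasFDerivAt.comp
    z h2.hasFDerivAt).fderiv
  have h6 : fderiv ℝ (fun w => iteratedFDeriv ℝ k g w (Fin.tail v)) z =
    (ContinuousMultilinearMap.apply ℝ (fun _ : Fin k => E) ℝ (Fin.tail v)).comp
      (fderiv ℝ (iteratedFDeriv ℝ k g) z) := h5
  rw [h6]
  rfl

/-- The operator `2 ϱ ∂² + β ∂` commutes with the derivatives in `z`. -/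
theorem radialOp_iteratedFDeriv (β : ℝ) {W : Set (ℝ × Z d p)} (hW : IsOpen W)
    {f : ℝ → Z d p → ℝ} (hf : ∀ q ∈ W, ContDiffAt ℝ ∞ (Function.uncurry f) q) (k : ℕ)
    (v : Fin k → Z d p) {q : ℝ × Z d p} (hq : q ∈ W) :
    ContDiffAt ℝ ∞ (fun q : ℝ × Z d p => iteratedFDeriv ℝ k (f q.1) q.2 v) q ∧
    radialOp β (fun t => iteratedFDeriv ℝ k (f t) q.2 v) q.1 =
      iteratedFDeriv ℝ k (fun z => radialOp β (fun t => f t z) q.1) q.2 v := by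
  induction k generalizing q with
  | zero =>
    simp only [iteratedFDeriv_zero_apply, and_true]
    exact hf q hq
  | succ k ih =>
    set g : ℝ × Z d p → ℝ := fun q => iteratedFDeriv ℝ k (f q.1) q.2 (Fin.tail v) with hg
    have hgs : ∀ q ∈ W, ContDiffAt ℝ ∞ g q := fun q hq => (ih (Fin.tail v) hq).1
    have e1 : (fun q : ℝ × Z d p => iteratedFDeriv ℝ (k + 1) (f q.1) q.2 v) =ᶠ[𝓝 q]
        dirDeriv (0, v 0) g := by
      filter_upwards [hW.mem_nhds hq] with q hq
      rw [iteratedFDeriv_succ_apply_eq_dirDeriv (contDiffAt_slice_right (hf q hq)),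
        ← dirDeriv_slice ((hgs q hq).differentiableAt (by simp))]
    have h1 := contDiffAt_infty_dirDeriv (hgs q hq) ((0 : ℝ), v 0)
    have h2 := h1.congr_of_eventuallyEq e1
    refine ⟨h2, ?_⟩
    have e2 : (fun z => radialOp β (fun t => f t z) q.1) =ᶠ[𝓝 q.2]
        fun z => jointOp β (Function.uncurry f) (q.1, z) := by
      filter_upwards [(tendsto_slice_right q).eventually (hW.mem_nhds hq)] with z hz
      exact radialOp_slice (f := Function.uncurry f) (q := (q.1, z)) β ((hf _ hz).of_le two_le_infty)
    have h3 : ContDiffAt ℝ ∞ (fun z => radialOp β (fun t => f t z) q.1) q.2 :=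
      (contDiffAt_comp_slice (contDiffAt_jointOp β (hf q hq))).congr_of_eventuallyEq e2
    have e3 : (fun z => iteratedFDeriv ℝ k (fun z => radialOp β (fun t => f t z) q.1) z (Fin.tail v))
        =ᶠ[𝓝 q.2] fun z => jointOp β g (q.1, z) := by
      filter_upwards [(tendsto_slice_right q).eventually (hW.mem_nhds hq)] with z hz
      rw [← (ih (Fin.tail v) (q := (q.1, z)) hz).2]
      exact radialOp_slice (f := g) (q := (q.1, z)) β ((hgs _ hz).of_le two_le_infty)
    rw [iteratedFDeriv_succ_apply_eq_dirDeriv h3, (dirDeriv_congr e3 _).self_of_nhds,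
      dirDeriv_slice ((contDiffAt_jointOp β (hgs q hq)).differentiableAt (by simp)),
      dirDeriv_jointOp β (hgs q hq)]
    exact (radialOp_slice (q := q) β (h2.of_le two_le_infty)).trans (jointOp_congr β e1)

end JointOperators

/-! ### The homogeneous equation: bootstrap, boundary value, uniqueness -/

section HomogeneousFamilies

variable {d p : ℕ} {β ε C R : ℝ} {U : Set (Z d p)} {f : ℝ → Z d p → ℝ} {n : ℕ}

/-- Solutions of `2 ϱ f'' + β f' = Δ f` on `(0, ε) × U` with Cauchy estimates in `z`. -/
structure HomFamily (β ε : ℝ) (U : Set (Z d p)) (C R : ℝ) (f : ℝ → Z d p → ℝ) : Prop where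
  isOpen : IsOpen U
  contDiffAt : ∀ t ∈ Ioo 0 ε, ∀ z ∈ U, ContDiffAt ℝ ∞ (Function.uncurry f) (t, z)
  eq : ∀ t ∈ Ioo 0 ε, ∀ z ∈ U, radialOp β (fun r => f r z) t = xLap (f t) z
  bound : ∀ t ∈ Ioo 0 ε, ∀ z ∈ U, ∀ k : ℕ,
    ‖iteratedFDeriv ℝ k (f t) z‖ ≤ C * R ^ k * (k ! : ℝ)

/-- Trades the filter formulation for one box (0, ε) × ball with fixed constants, on which the
scalar estimates can be run. -/
theorem exists_homFamily {z₀ : Z d p} {V : Set (Z d p)} (hV : V ∈ 𝓝 z₀)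
    (h1 : ∀ᶠ q in 𝓝[>] (0 : ℝ) ×ˢ 𝓝 z₀, ContDiffAt ℝ ∞ (Function.uncurry f) q ∧
      radialOp β (fun r => f r q.2) q.1 = xLap (f q.1) q.2)
    (h2 : EventuallyCauchy (𝓝[>] (0 : ℝ) ×ˢ 𝓝 z₀) f) :
    ∃ ε δ C R : ℝ, 0 < ε ∧ 0 < δ ∧ 0 ≤ C ∧ 0 ≤ R ∧ Metric.ball z₀ δ ⊆ V ∧
      HomFamily β ε (Metric.ball z₀ δ) C R f := by
  obtain ⟨C, R, hC, hR, h2⟩ := h2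
  have h3 : ∀ᶠ q in 𝓝[>] (0 : ℝ) ×ˢ 𝓝 z₀, q.2 ∈ V := Eventually.prod_inr hV _
  obtain ⟨⟨ε, δ⟩, ⟨hε, hδ⟩, h⟩ :=
    ((nhdsGT_basis (0 : ℝ)).prod (Metric.nhds_basis_ball (x := z₀))).eventually_iff.1
      (h1.and (h2.and h3))
  refine ⟨ε, δ, C, R, hε, hδ, hC, hR, fun z hz => ?_, Metric.isOpen_ball,
    fun t ht z hz => (h (x := (t, z)) ⟨ht, hz⟩).1.1, fun t ht z hz => (h (x := (t, z)) ⟨ht, hz⟩).1.2,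
    fun t ht z hz => (h (x := (t, z)) ⟨ht, hz⟩).2.1.2⟩
  -- The inclusion concerns z only, but is known jointly; any ϱ in (0, ε) extracts it.
  exact (h (x := (ε / 2, z)) ⟨⟨half_pos hε, half_lt_self hε⟩, hz⟩).2.2

namespace HomFamily

theorem contDiffAt_right (h : HomFamily β ε U C R f) {t : ℝ} (ht : t ∈ Ioo 0 ε) {z : Z d p}
    (hz : z ∈ U) : ContDiffAt ℝ ∞ (f t) z :=
  contDiffAt_slice_right (q := (t, z)) (h.contDiffAt t ht z hz)

/-- A z-derivative evaluated on fixed vectors is a scalar function of ϱ. Its image under the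
operator is the same derivative of Δf, so the scalar estimates apply at the price of two
derivatives. -/
theorem scalar (h : HomFamily β ε U C R f) {k : ℕ} (v : Fin k → Z d p) {t : ℝ} (ht : t ∈ Ioo 0 ε)
    {z : Z d p} (hz : z ∈ U) :
    ContDiffAt ℝ 2 (fun t => iteratedFDeriv ℝ k (f t) z v) t ∧
    |radialOp β (fun t => iteratedFDeriv ℝ k (f t) z v) t| ≤
      d * ‖iteratedFDeriv ℝ (k + 2) (f t) z‖ * ∏ i, ‖v i‖ := by
  obtain ⟨h1, h2⟩ := radialOp_iteratedFDeriv β (isOpen_Ioo.prod h.isOpen)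
    (fun q hq => h.contDiffAt q.1 hq.1 q.2 hq.2) k v (q := (t, z)) ⟨ht, hz⟩
  refine ⟨(ContDiffAt.comp (g := fun q : ℝ × Z d p => iteratedFDeriv ℝ k (f q.1) q.2 v) t h1
    (contDiffAt_id.prodMk contDiffAt_const)).of_le two_le_infty, ?_⟩
  have h3 : (fun w => radialOp β (fun r => f r w) t) =ᶠ[𝓝 z] xLap (f t) := by
    filter_upwards [h.isOpen.mem_nhds hz] with w hw using h.eq t ht w hw
  rw [h2, (h3.iteratedFDeriv ℝ k).self_of_nhds, ← Real.norm_eq_abs]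
  refine (ContinuousMultilinearMap.le_opNorm _ _).trans ?_
  gcongr
  exact norm_iteratedFDeriv_xLap_le (h.contDiffAt_right ht hz) k

theorem tendsto_iteratedFDeriv (h : HomFamily β ε U C R f) (hε : 0 < ε)
    (h0 : ∀ z ∈ U, Tendsto (fun t => f t z) (𝓝[>] 0) (𝓝 0)) {k : ℕ} (v : Fin k → Z d p)
    {z : Z d p} (hz : z ∈ U) :
    Tendsto (fun t => iteratedFDeriv ℝ k (f t) z v) (𝓝[>] 0) (𝓝 0) := by
  refine tendsto_iteratedFDeriv_of_tendsto h.isOpen (C := fun k => C * R ^ k * (k ! : ℝ)) ?_ h0 k v z hz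
  filter_upwards [Ioo_mem_nhdsGT hε] with t ht z hz
  exact ⟨h.contDiffAt_right ht hz, h.bound t ht z hz⟩

/-- Each step gains half a power of ϱ from `exists_abs_le_rpow` and loses two z-derivatives. The
loss (k+1)(k+2) ≤ 2·4^k only replaces R' by 4R', and n steps suffice. -/
theorem exists_rpow_bound {ε₀ : ℝ} (h : HomFamily (2 - n) ε₀ U C R f) (hC : 0 ≤ C) (hR : 0 ≤ R)
    (h0 : ∀ z ∈ U, Tendsto (fun t => f t z) (𝓝[>] 0) (𝓝 0)) (hε : 0 < ε) (hε1 : ε ≤ 1)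
    (hεε : ε < ε₀) (i : ℕ) (hi : i ≤ n) : ∃ C' R' : ℝ, 0 ≤ C' ∧ 0 ≤ R' ∧
      ∀ t ∈ Ioc 0 ε, ∀ z ∈ U, ∀ k : ℕ,
        ‖iteratedFDeriv ℝ k (f t) z‖ ≤ C' * R' ^ k * (k ! : ℝ) * t ^ ((i : ℝ) / 2) := by
  have hsub : ∀ t ∈ Ioc 0 ε, t ∈ Ioo 0 ε₀ := fun t ht => ⟨ht.1, ht.2.trans_lt hεε⟩
  induction i with
  | zero => exact ⟨C, R, hC, hR, fun t ht z hz k => by simpa using h.bound t (hsub t ht) z hz k⟩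
  | succ i ih =>
    obtain ⟨C', R', hC', hR', hb⟩ := ih (by omega)
    obtain ⟨K, hK, hK2⟩ := exists_abs_le_rpow hi hε hε1
    refine ⟨K * (C' * (1 + 2 * d * R' ^ 2)), 4 * R', by positivity, by positivity,
      fun t ht z hz k => ?_⟩
    have ht0 : 0 ≤ t ^ (((i + 1 : ℕ) : ℝ) / 2) := Real.rpow_nonneg ht.1.le _
    refine ContinuousMultilinearMap.opNorm_le_bound (by positivity) fun v => ?_
    have hP : 0 ≤ ∏ i, ‖v i‖ := by positivity
    set P : ℝ := ∏ i, ‖v i‖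
    set A : ℝ := C' * R' ^ k * k ! with hA
    have hA0 : 0 ≤ A := by positivity
    have hB0 : 0 ≤ A * (1 + d * R' ^ 2 * ((k + 1) * (k + 2))) * P := by positivity
    -- In the common bound the summand 1 covers the endpoint value, the other summand the right-hand
    -- side of the equation.
    have key := hK2 (fun t => iteratedFDeriv ℝ k (f t) z v)
      (A * (1 + d * R' ^ 2 * ((k + 1) * (k + 2))) * P) hB0
      (fun t ht => (h.scalar v (hsub t ht) hz).1)
      (h.tendsto_iteratedFDeriv (hε.trans hεε) h0 v hz) ?_ (fun t ht => ?_) t ht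
    · rw [Real.norm_eq_abs]
      refine key.trans ?_
      have hk : ((k : ℝ) + 1) * (k + 2) ≤ 2 * 4 ^ k := by
        have h2 : (k : ℝ) + 1 ≤ 2 ^ k := by exact_mod_cast Nat.lt_two_pow_self
        have h4 : (4 : ℝ) ^ k = 2 ^ k * 2 ^ k := by rw [← mul_pow]; norm_num
        rw [h4]
        nlinarith [Nat.cast_nonneg (α := ℝ) k]
      have h1 : (1 : ℝ) ≤ 4 ^ k := one_le_pow₀ (by norm_num)
      have h2 : 1 + d * R' ^ 2 * (((k : ℝ) + 1) * (k + 2)) ≤ (1 + 2 * d * R' ^ 2) * 4 ^ k := by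
        have : d * R' ^ 2 * (((k : ℝ) + 1) * (k + 2)) ≤ d * R' ^ 2 * (2 * 4 ^ k) := by gcongr
        linarith
      calc _ ≤ K * (A * ((1 + 2 * d * R' ^ 2) * 4 ^ k) * P) * t ^ (((i + 1 : ℕ) : ℝ) / 2) := by gcongr
        _ = _ := by rw [hA, mul_pow]; ring
    · have h1 := (iteratedFDeriv ℝ k (f ε) z).le_opNorm v
      rw [Real.norm_eq_abs] at h1
      have h2 := hb ε ⟨hε, le_rfl⟩ z hz k
      have h3 : ε ^ ((i : ℝ) / 2) ≤ 1 := Real.rpow_le_one hε.le hε1 (by positivity)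
      have h4 : (1 : ℝ) ≤ 1 + d * R' ^ 2 * (((k : ℝ) + 1) * (k + 2)) := by
        have : (0 : ℝ) ≤ d * R' ^ 2 * (((k : ℝ) + 1) * (k + 2)) := by positivity
        linarith
      calc _ ≤ ‖iteratedFDeriv ℝ k (f ε) z‖ * P := h1
        _ ≤ A * ε ^ ((i : ℝ) / 2) * P := by gcongr
        _ ≤ A * 1 * P := by gcongr
        _ ≤ _ := by gcongr
    · have ht' : t ∈ Ioc 0 ε := ⟨ht.1, ht.2.le⟩
      have ht1 : 0 ≤ t ^ ((i : ℝ) / 2) := Real.rpow_nonneg ht.1.le _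
      have h4 : d * R' ^ 2 * (((k : ℝ) + 1) * (k + 2)) ≤
          1 + d * R' ^ 2 * (((k : ℝ) + 1) * (k + 2)) := by linarith
      calc _ ≤ _ := (h.scalar v (hsub t ht') hz).2
        _ ≤ d * (C' * R' ^ (k + 2) * ((k + 2)! : ℝ) * t ^ ((i : ℝ) / 2)) * P := by
          gcongr
          exact hb t ht' z hz (k + 2)
        _ = A * (d * R' ^ 2 * (((k : ℝ) + 1) * (k + 2))) * P * t ^ ((i : ℝ) / 2) := by
          rw [Nat.factorial_succ, Nat.factorial_succ, hA]; push_cast; ring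
        _ ≤ _ := by gcongr

/-- Dividing by ϱ^(n/2) exchanges decay for uniform Cauchy bounds and moves to the operator with β =
2 + n, whose bounded solutions are regular at ϱ = 0. -/
theorem rpow_neg_mul (h : HomFamily (2 - n) ε U C R f) {C' R' : ℝ}
    (hb : ∀ t ∈ Ioo 0 ε, ∀ z ∈ U, ∀ k : ℕ,
      ‖iteratedFDeriv ℝ k (f t) z‖ ≤ C' * R' ^ k * (k ! : ℝ) * t ^ ((n : ℝ) / 2)) :
    HomFamily (2 + n) ε U C' R' fun t z => t ^ (-((n : ℝ) / 2)) * f t z := by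
  have hs : ∀ t ∈ Ioo 0 ε, ∀ z ∈ U, ContDiffAt ℝ ∞
      (Function.uncurry fun t z => t ^ (-((n : ℝ) / 2)) * f t z) (t, z) := fun t ht z hz =>
    (contDiffAt_fst_comp (q := (t, z)) (Real.contDiffAt_rpow_const_of_ne ht.1.ne')).mul
      (h.contDiffAt t ht z hz)
  refine ⟨h.isOpen, hs, fun t ht z hz => ?_, fun t ht z hz k => ?_⟩
  · have h1 := radialOp_rpow_mul ((n : ℝ) / 2) ht.1
      ((contDiffAt_slice_left (q := (t, z)) (hs t ht z hz)).of_le two_le_infty)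
    have h2 : (fun r => r ^ ((n : ℝ) / 2) * (r ^ (-((n : ℝ) / 2)) * f r z)) =ᶠ[𝓝 t]
        fun r => f r z := by
      filter_upwards [lt_mem_nhds ht.1] with r hr
      rw [← mul_assoc, ← Real.rpow_add hr, add_neg_cancel, Real.rpow_zero, one_mul]
    have e1 : (2 : ℝ) - 2 * ((n : ℝ) / 2) = 2 - n := by ring
    have e2 : (2 : ℝ) + 2 * ((n : ℝ) / 2) = 2 + n := by ring
    simp only at h1
    rw [radialOp_congr h2, e1, e2, h.eq t ht z hz] at h1
    rw [xLap_const_mul ((h.contDiffAt_right ht hz).of_le two_le_infty), h1, ← mul_assoc,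
      ← Real.rpow_add ht.1, neg_add_cancel, Real.rpow_zero, one_mul]
  · have e : (fun w => t ^ (-((n : ℝ) / 2)) * f t w) = t ^ (-((n : ℝ) / 2)) • f t := rfl
    have hp := Real.rpow_pos_of_pos ht.1 ((n : ℝ) / 2)
    rw [e, iteratedFDeriv_const_smul_apply
      ((h.contDiffAt_right ht hz).of_le (by exact_mod_cast le_top)), norm_smul, Real.norm_eq_abs,
      abs_of_pos (Real.rpow_pos_of_pos ht.1 _), Real.rpow_neg ht.1.le, inv_mul_le_iff₀ hp]
    linarith [hb t ht z hz k]

/-- With a = 0, `abs_deriv_le_of_radialOp_le` bounds the ϱ-derivative of every z-derivative, so all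
of them have limits as ϱ ↓ 0. -/
theorem norm_iteratedFDeriv_sub_le (h : HomFamily (2 + n) ε U C R f) (hC : 0 ≤ C) (hR : 0 ≤ R)
    (hn : 1 ≤ n) {k : ℕ} {z : Z d p} (hz : z ∈ U) {s t : ℝ} (hs : s ∈ Ioo 0 ε) (ht : t ∈ Ioo 0 ε) :
    ‖iteratedFDeriv ℝ k (f t) z - iteratedFDeriv ℝ k (f s) z‖ ≤
      d * (C * R ^ (k + 2) * ((k + 2)! : ℝ)) * ‖t - s‖ := by
  have hn' : (1 : ℝ) ≤ n := by exact_mod_cast hn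
  refine ContinuousMultilinearMap.opNorm_le_bound (by positivity) fun v => ?_
  have hP : 0 ≤ ∏ i, ‖v i‖ := by positivity
  have e : (2 : ℝ) + n = 2 + 2 * ((n : ℝ) / 2) := by ring
  set B : ℝ := d * (C * R ^ (k + 2) * ((k + 2)! : ℝ)) * ∏ i, ‖v i‖ with hB
  have hB0 : 0 ≤ B := by positivity
  have key := abs_deriv_le_of_radialOp_le (ν := (n : ℝ) / 2) (by positivity) hB0
    (x := fun t => iteratedFDeriv ℝ k (f t) z v) (C := C * R ^ k * k ! * ∏ i, ‖v i‖) 0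
    (fun t ht => (h.scalar v ht hz).1)
    (fun t ht => by
      rw [← Real.norm_eq_abs]
      exact ((iteratedFDeriv ℝ k (f t) z).le_opNorm v).trans
        (mul_le_mul_of_nonneg_right (h.bound t ht z hz k) hP))
    (fun t ht => by
      rw [← e, pow_zero, mul_one]
      exact (h.scalar v ht hz).2.trans (mul_le_mul_of_nonneg_right
        (mul_le_mul_of_nonneg_left (h.bound t ht z hz (k + 2)) (Nat.cast_nonneg d)) hP))
  have h2 := (convex_Ioo (0 : ℝ) ε).norm_image_sub_le_of_norm_deriv_le
    (f := fun t => iteratedFDeriv ℝ k (f t) z v) (C := B)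
    (fun t ht => (h.scalar v ht hz).1.differentiableAt (by simp))
    (fun t ht => by
      rw [Real.norm_eq_abs]
      refine (key t ht).trans ?_
      rw [pow_zero, mul_one]
      exact div_le_self hB0 (by push_cast; linarith)) hs ht
  calc _ ≤ B * ‖t - s‖ := h2
    _ = _ := by rw [hB]; ring

theorem _root_.PPWave.exists_tendsto_nhdsGT_of_lipschitz {F : Type*} [NormedAddCommGroup F] [CompleteSpace F]
    {g : ℝ → F} {L : ℝ} (hε : 0 < ε)
    (h : ∀ s ∈ Ioo 0 ε, ∀ t ∈ Ioo 0 ε, ‖g t - g s‖ ≤ L * ‖t - s‖) :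
    ∃ a, Tendsto g (𝓝[>] 0) (𝓝 a) := by
  rw [← cauchy_map_iff_exists_tendsto, Metric.cauchy_iff]
  refine ⟨inferInstance, fun e he => ?_⟩
  set η := min ε (e / (|L| + 1)) with hη
  have hη0 : 0 < η := lt_min hε (by positivity)
  refine ⟨g '' Ioo 0 η, image_mem_map (Ioo_mem_nhdsGT hη0), ?_⟩
  rintro _ ⟨s, hs, rfl⟩ _ ⟨t, ht, rfl⟩
  have hs' : s ∈ Ioo 0 ε := ⟨hs.1, hs.2.trans_le (min_le_left _ _)⟩
  have ht' : t ∈ Ioo 0 ε := ⟨ht.1, ht.2.trans_le (min_le_left _ _)⟩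
  have h1 : ‖s - t‖ < η := by
    rw [Real.norm_eq_abs, abs_lt]
    constructor <;> linarith [hs.1, hs.2, ht.1, ht.2]
  rw [dist_eq_norm]
  calc ‖g s - g t‖ ≤ L * ‖s - t‖ := h t ht' s hs'
    _ ≤ (|L| + 1) * ‖s - t‖ := by
      gcongr
      linarith [le_abs_self L]
    _ < (|L| + 1) * η := by gcongr
    _ ≤ (|L| + 1) * (e / (|L| + 1)) := by gcongr; exact min_le_right _ _
    _ = e := by field_simp

/-- Bounded solutions of `2 ϱ f'' + (2 + n) f' = Δ f` have an analytic limit as `ϱ ↓ 0`. -/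
theorem analyticAt_limUnder (h : HomFamily (2 + n) ε U C R f) (hC : 0 ≤ C) (hR : 0 ≤ R)
    (hn : 1 ≤ n) (hε : 0 < ε) {z : Z d p} (hz : z ∈ U) :
    AnalyticAt ℝ (fun z => limUnder (𝓝[>] 0) fun t => f t z) z ∧
      Tendsto (fun t => f t z) (𝓝[>] 0) (𝓝 (limUnder (𝓝[>] 0) fun t => f t z)) := by
  have hlim : ∀ (k : ℕ), ∀ z ∈ U, ∃ a, Tendsto (fun t => iteratedFDeriv ℝ k (f t) z) (𝓝[>] 0) (𝓝 a) :=
    fun k z hz => exists_tendsto_nhdsGT_of_lipschitz hε fun s hs t ht =>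
      h.norm_iteratedFDeriv_sub_le hC hR hn hz hs ht
  have h0 : ∀ z ∈ U, Tendsto (fun t => f t z) (𝓝[>] 0) (𝓝 (limUnder (𝓝[>] 0) fun t => f t z)) :=
    fun z hz => by
      obtain ⟨a, ha⟩ := hlim 0 z hz
      have h1 := ((ContinuousMultilinearMap.apply ℝ (fun _ : Fin 0 => Z d p) ℝ 0).continuous.tendsto
        a).comp ha
      exact tendsto_nhds_limUnder ⟨_, h1⟩
  refine ⟨?_, h0 z hz⟩
  choose a ha using fun k => hlim k z hz
  have hav : ∀ k, ‖a k‖ ≤ C * R ^ k * k ! := fun k =>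
    le_of_tendsto (ha k).norm (by
      filter_upwards [Ioo_mem_nhdsGT hε] with t ht using h.bound t ht z hz k)
  obtain ⟨δ, hδ, hball⟩ := Metric.isOpen_iff.1 h.isOpen z hz
  have hδ' : 0 < min δ (1 / (R + 1)) := lt_min hδ (by positivity)
  refine analyticAt_of_hasSum (P := fun k => (k ! : ℝ)⁻¹ • a k) (C := C) hR hδ' (fun k => ?_)
    fun v hv => ?_
  · rw [norm_smul, norm_inv, Real.norm_natCast, inv_mul_le_iff₀ (by positivity)]
    linarith [hav k]
  · have hvδ : ‖v‖ < δ := hv.trans_le (min_le_left _ _)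
    have hvR : R * ‖v‖ < 1 := by
      have h1 : ‖v‖ < 1 / (R + 1) := hv.trans_le (min_le_right _ _)
      rw [lt_div_iff₀ (by positivity)] at h1
      nlinarith [norm_nonneg v]
    have hzv : z + v ∈ U := hball (by simpa [dist_eq_norm] using hvδ)
    have hT : ∀ t ∈ Ioo 0 ε, HasSum (fun k : ℕ => (k ! : ℝ)⁻¹ * iteratedFDeriv ℝ k (f t) z fun _ => v)
        (f t (z + v)) := fun t ht =>
      CauchyOn.hasSum_taylor h.isOpen (C := C) ⟨fun w hw => (h.contDiffAt_right ht hw).contDiffWithinAt,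
        fun w hw k => h.bound t ht w hw k⟩ hR (fun s hs => hball (ball_segment hvδ hs)) hvR
    have hsum : Summable fun k : ℕ => C * (R * ‖v‖) ^ k :=
      (summable_geometric_of_lt_one (by positivity) hvR).mul_left C
    have hterm : ∀ (k : ℕ) (A : ContinuousMultilinearMap ℝ (fun _ : Fin k => Z d p) ℝ),
        ‖A‖ ≤ C * R ^ k * k ! → ‖(k ! : ℝ)⁻¹ * A fun _ => v‖ ≤ C * (R * ‖v‖) ^ k := fun k A hA => by
      have h1 := A.le_opNorm fun _ => v
      rw [Finset.prod_const, Finset.card_univ, Fintype.card_fin] at h1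
      rw [norm_mul, norm_inv, Real.norm_natCast, inv_mul_le_iff₀ (by positivity)]
      calc _ ≤ C * R ^ k * k ! * ‖v‖ ^ k := h1.trans (by gcongr)
        _ = _ := by rw [mul_pow]; ring
    -- The Taylor series of f t at z converge under one geometric bound independent of t, so their
    -- limit is the power series of the limit function.
    have hTan := tendsto_tsum_of_dominated_convergence (𝓕 := 𝓝[>] (0 : ℝ)) hsum
      (f := fun t k => (k ! : ℝ)⁻¹ * iteratedFDeriv ℝ k (f t) z fun _ => v)
      (g := fun k => (k ! : ℝ)⁻¹ * a k fun _ => v)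
      (fun k => (((ContinuousMultilinearMap.apply ℝ (fun _ : Fin k => Z d p) ℝ fun _ => v).continuous.tendsto
        (a k)).comp (ha k)).const_mul _)
      (by
        filter_upwards [Ioo_mem_nhdsGT hε] with t ht k
        exact hterm k _ (h.bound t ht z hz k))
    have h4 : Tendsto (fun t => f t (z + v)) (𝓝[>] 0) (𝓝 (∑' k, (k ! : ℝ)⁻¹ * a k fun _ => v)) :=
      hTan.congr' (by filter_upwards [Ioo_mem_nhdsGT hε] with t ht using (hT t ht).tsum_eq)
    have h5 : (limUnder (𝓝[>] 0) fun t => f t (z + v)) = ∑' k, (k ! : ℝ)⁻¹ * a k fun _ => v :=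
      tendsto_nhds_unique (h0 _ hzv) h4
    rw [h5]
    exact (Summable.of_norm_bounded hsum fun k => hterm k _ (hav k)).hasSum

/-- Bounded solutions of `2 ϱ f'' + (2 + n) f' = Δ f` that vanish at `ϱ = 0` vanish. -/
theorem eq_zero (h : HomFamily (2 + n) ε U C R f) (hC : 0 ≤ C) (hR : 0 ≤ R) (hn : 1 ≤ n)
    (hε : 0 < ε) (h0 : ∀ z ∈ U, Tendsto (fun t => f t z) (𝓝[>] 0) (𝓝 0)) {t : ℝ}
    (ht : t ∈ Ioo 0 ε) (htR : 4 * d * R ^ 2 * t < 1) {z : Z d p} (hz : z ∈ U) : f t z = 0 := by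
  have hn' : (1 : ℝ) ≤ n := by exact_mod_cast hn
  have e : (2 : ℝ) + n = 2 + 2 * ((n : ℝ) / 2) := by ring
  -- Each application of `abs_le_of_radialOp_le` gains t/((N+1)(2(N+1)+n)) and costs two
  -- derivatives; the denominators accumulate to `plusDen`.
  have key : ∀ N : ℕ, ∀ t ∈ Ioo 0 ε, ∀ z ∈ U, ∀ k : ℕ, ‖iteratedFDeriv ℝ k (f t) z‖ ≤
      C * R ^ (k + 2 * N) * ((k + 2 * N)! : ℝ) * d ^ N * (plusDen n N)⁻¹ * t ^ N := by
    intro N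
    induction N with
    | zero =>
      intro t ht z hz k
      simpa [plusDen_zero] using h.bound t ht z hz k
    | succ N ih =>
      intro t ht z hz k
      have hp1 := plusDen_pos n (N + 1)
      have hp := plusDen_pos n N
      have ht0 := ht.1
      refine ContinuousMultilinearMap.opNorm_le_bound (by positivity) fun v => ?_
      have hP : 0 ≤ ∏ i, ‖v i‖ := by positivity
      set B : ℝ := d * (C * R ^ (k + 2 + 2 * N) * ((k + 2 + 2 * N)! : ℝ) * d ^ N * (plusDen n N)⁻¹) *
        ∏ i, ‖v i‖ with hB
      have hB0 : 0 ≤ B := by positivity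
      have := abs_le_of_radialOp_le (ν := (n : ℝ) / 2) (by positivity) hB0
        (x := fun t => iteratedFDeriv ℝ k (f t) z v) (C := C * R ^ k * k ! * ∏ i, ‖v i‖) N
        (fun t ht => (h.scalar v ht hz).1)
        (fun t ht => by
          rw [← Real.norm_eq_abs]
          exact ((iteratedFDeriv ℝ k (f t) z).le_opNorm v).trans
            (mul_le_mul_of_nonneg_right (h.bound t ht z hz k) hP))
        (fun t ht => by
          rw [← e]
          refine (h.scalar v ht hz).2.trans ((mul_le_mul_of_nonneg_right
            (mul_le_mul_of_nonneg_left (ih t ht z hz (k + 2)) (Nat.cast_nonneg d)) hP).trans_eq ?_)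
          rw [hB]; ring)
        (h.tendsto_iteratedFDeriv hε h0 v hz) t ht
      rw [Real.norm_eq_abs]
      refine this.trans_eq ?_
      rw [hB, plusDen_succ, show k + 2 * (N + 1) = k + 2 + 2 * N by ring]
      field_simp
      ring
  -- The factorial (2N)! from the lost derivatives cancels against `plusDen`, and only a geometric
  -- factor is left.
  have hd : ∀ N : ℕ, |f t z| ≤ C * (4 * d * R ^ 2 * t) ^ N := fun N => by
    have h1 := key N t ht z hz 0
    have h2 := inv_plusDen_le n N
    have h3 : (0 : ℝ) < (2 * N)! := by positivity
    have ht0 := ht.1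
    rw [norm_iteratedFDeriv_zero, zero_add, Real.norm_eq_abs] at h1
    calc _ ≤ _ := h1
      _ ≤ C * R ^ (2 * N) * ((2 * N)! : ℝ) * d ^ N * (4 ^ N / (2 * N)!) * t ^ N := by gcongr
      _ = _ := by
        rw [pow_mul, mul_pow, mul_pow, mul_pow]
        field_simp
  have hlim : Tendsto (fun N : ℕ => C * (4 * d * R ^ 2 * t) ^ N) atTop (𝓝 0) := by
    have ht0 := ht.1
    simpa using (tendsto_pow_atTop_nhds_zero_of_lt_one (by positivity) htR).const_mul C
  exact abs_nonpos_iff.1 (ge_of_tendsto' hlim hd)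

end HomFamily

end HomogeneousFamilies

/-! ### Classification of homogeneous solutions -/

section HomogeneousSolutions

variable {d p n : ℕ} {V : Set (Z d p)}

/-- The solutions of the homogeneous equation. -/
theorem IsSolution.exists_eq_lapSeries (hn : 1 ≤ n) (hV : IsOpen V) {y : ℝ → Z d p → ℝ}
    (hs : IsSolution n V (fun _ => 0) y) : ∃ α : Z d p → ℝ, AnalyticOnNhd ℝ α V ∧
      ∀ z ∈ V, ∀ᶠ q in 𝓝[>] (0 : ℝ) ×ˢ 𝓝 z,
        y q.1 q.2 = q.1 ^ ((n : ℝ) / 2) * lapSeries (fun k => (plusDen n k)⁻¹) α q.1 q.2 := by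
  set χ : ℝ → Z d p → ℝ := fun t z => t ^ (-((n : ℝ) / 2)) * y t z with hχ
  -- As a limit, α is defined on all of V at once and no local choices have to be patched.
  set α : Z d p → ℝ := fun z => limUnder (𝓝[>] 0) fun t => χ t z with hα
  have hloc : ∀ z₀ ∈ V, ∃ ε δ C R : ℝ, 0 < ε ∧ 0 < δ ∧ 0 ≤ C ∧ 0 ≤ R ∧ Metric.ball z₀ δ ⊆ V ∧
      HomFamily (2 + n) ε (Metric.ball z₀ δ) C R χ := by
    intro z₀ hz₀
    obtain ⟨ε₀, δ, C, R, hε₀, hδ, hC, hR, hball, hf⟩ := exists_homFamily (β := 2 - n) (f := y)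
      (hV.mem_nhds hz₀) (by
        filter_upwards [(hs z₀ hz₀).1] with q hq
        refine ⟨hq.1, ?_⟩
        simpa only [zero_add] using pdeAt_iff.1 hq.2) (hs.eventuallyCauchy hz₀)
    -- The barrier estimates need ε ≤ 1 and an endpoint strictly inside the interval of the
    -- equation.
    set ε := min 1 (ε₀ / 2) with hε
    have hε0 : 0 < ε := lt_min one_pos (half_pos hε₀)
    have hεε : ε < ε₀ := (min_le_right _ _).trans_lt (half_lt_self hε₀)
    obtain ⟨C', R', hC', hR', hb⟩ := hf.exists_rpow_bound hC hR
      (fun z hz => (hs z (hball hz)).2.1) hε0 (min_le_left _ _) hεε n le_rfl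
    have hf' : HomFamily (2 - n) ε (Metric.ball z₀ δ) C R y :=
      ⟨hf.isOpen, fun t ht => hf.contDiffAt t ⟨ht.1, ht.2.trans hεε⟩,
        fun t ht => hf.eq t ⟨ht.1, ht.2.trans hεε⟩, fun t ht => hf.bound t ⟨ht.1, ht.2.trans hεε⟩⟩
    exact ⟨ε, δ, C', R', hε0, hδ, hC', hR', hball,
      hf'.rpow_neg_mul fun t ht => hb t ⟨ht.1, ht.2.le⟩⟩
  have hαV : ∀ z ∈ V, AnalyticAt ℝ α z ∧ Tendsto (fun t => χ t z) (𝓝[>] 0) (𝓝 (α z)) := by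
    intro z hz
    obtain ⟨ε, δ, C, R, hε, hδ, hC, hR, -, hf⟩ := hloc z hz
    exact hf.analyticAt_limUnder hC hR hn hε (Metric.mem_ball_self hδ)
  refine ⟨α, fun z hz => (hαV z hz).1, fun z₀ hz₀ => ?_⟩
  set S := lapSeries (fun k => (plusDen n k)⁻¹) α with hS
  have hαz := (hαV z₀ hz₀).1
  obtain ⟨ε₁, δ₁, C₁, R₁, hε₁, hδ₁, hC₁, hR₁, hball₁, hf₁⟩ := hloc z₀ hz₀
  have hχ1 : ∀ᶠ q in 𝓝[>] (0 : ℝ) ×ˢ 𝓝 z₀, q ∈ Ioo 0 ε₁ ×ˢ Metric.ball z₀ δ₁ :=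
    prod_mem_prod (Ioo_mem_nhdsGT hε₁) (Metric.ball_mem_nhds z₀ hδ₁)
  have hχC : EventuallyCauchy (𝓝[>] (0 : ℝ) ×ˢ 𝓝 z₀) χ := by
    refine ⟨C₁, R₁, hC₁, hR₁, ?_⟩
    filter_upwards [hχ1] with q hq
    exact ⟨hf₁.contDiffAt_right hq.1 hq.2, hf₁.bound q.1 hq.1 q.2 hq.2⟩
  have hSA := (factorialDecay_plusDen n).analyticAt hαz
  have hSC := (eventuallyCauchy_of_analyticAt hSA).mono (nhdsGT_prod_le z₀)
  have hdC : EventuallyCauchy (𝓝[>] (0 : ℝ) ×ˢ 𝓝 z₀) fun t z => χ t z + -1 * S t z :=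
    hχC.add (hSC.mul_of_abs_le (c := fun _ => -1) zero_le_one (by simp))
  -- Both χ and S solve the conjugated equation with uniform Cauchy estimates and have the same
  -- limit α, so their difference falls under `HomFamily.eq_zero`.
  obtain ⟨ε, δ, C, R, hε, hδ, hC, hR, hball, hf⟩ := exists_homFamily (β := 2 + n)
    (f := fun t z => χ t z + -1 * S t z) (hV.mem_nhds hz₀) (by
      filter_upwards [hχ1, ((factorialDecay_plusDen n).eventually_analyticAt hαz).filter_mono
        (nhdsGT_prod_le z₀), (eventually_plusSeries n hαz).filter_mono (nhdsGT_prod_le z₀)]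
        with q h1 h2 h3
      have a1 := hf₁.contDiffAt q.1 h1.1 q.2 h1.2
      have a2 : ContDiffAt ℝ ∞ (Function.uncurry S) q := h2.contDiffAt
      refine ⟨a1.add (contDiffAt_const.mul a2), ?_⟩
      have b1 := (contDiffAt_slice_left a1).of_le two_le_infty
      have b2 := (contDiffAt_slice_left a2).of_le two_le_infty
      have c1 := (contDiffAt_slice_right a1).of_le two_le_infty
      have c2 := (contDiffAt_slice_right a2).of_le two_le_infty
      rw [radialOp_add b1 (contDiffAt_const.mul b2), radialOp_const_mul b2,
        xLap_add c1 (contDiffAt_const.mul c2), xLap_const_mul c2, h3]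
      congr 1
      exact hf₁.eq q.1 h1.1 q.2 h1.2) hdC
  have h0 : ∀ z ∈ Metric.ball z₀ δ, Tendsto (fun t => χ t z + -1 * S t z) (𝓝[>] 0) (𝓝 0) := by
    intro z hz
    have h1 := (hαV z (hball hz)).2
    have h2 := (factorialDecay_plusDen n).tendsto (hαV z (hball hz)).1
    simpa [plusDen_zero] using h1.add (h2.const_mul (-1))
  have hη : 0 < min ε (1 / (4 * d * R ^ 2 + 1)) := lt_min hε (by positivity)
  filter_upwards [prod_mem_prod (Ioo_mem_nhdsGT hη) (Metric.ball_mem_nhds z₀ hδ)] with q hq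
  have hq1 : q.1 ∈ Ioo 0 ε := ⟨hq.1.1, hq.1.2.trans_le (min_le_left _ _)⟩
  have hq2 : 4 * d * R ^ 2 * q.1 < 1 := by
    have h1 : q.1 < 1 / (4 * d * R ^ 2 + 1) := hq.1.2.trans_le (min_le_right _ _)
    rw [lt_div_iff₀ (by positivity)] at h1
    linarith [hq1.1]
  have h1 := hf.eq_zero hC hR hn hε h0 hq1 hq2 hq.2
  have h2 : S q.1 q.2 = q.1 ^ (-((n : ℝ) / 2)) * y q.1 q.2 := by
    simp only [hχ] at h1
    linarith
  rw [h2, ← mul_assoc, ← Real.rpow_add hq1.1, add_neg_cancel, Real.rpow_zero, one_mul]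

end HomogeneousSolutions

/-! ### The ϱ-derivatives at ϱ = 0 -/

section TaylorCoefficients

variable {d p : ℕ} {z₀ : Z d p}

theorem contDiffAt_dirDeriv_iterate {E : Type*} [NormedAddCommGroup E] [NormedSpace ℝ E]
    {f : E → ℝ} {z : E} (hf : ContDiffAt ℝ ∞ f z) (w : E) (k : ℕ) :
    ContDiffAt ℝ ∞ ((dirDeriv w)^[k] f) z := by
  induction k with
  | zero => exact hf
  | succ k ih => rw [Function.iterate_succ_apply']; exact contDiffAt_infty_dirDeriv ih w

theorem analyticAt_dirDeriv_iterate {E : Type*} [NormedAddCommGroup E] [NormedSpace ℝ E]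
    {f : E → ℝ} {z : E} (hf : AnalyticAt ℝ f z) (w : E) (k : ℕ) :
    AnalyticAt ℝ ((dirDeriv w)^[k] f) z := by
  induction k with
  | zero => exact hf
  | succ k ih => rw [Function.iterate_succ_apply']; exact analyticAt_dirDeriv ih w

/-- Differentiating the coefficient 2ϱ contributes one more 2∂, so each ϱ-derivative raises β by 2.
-/
theorem dirDeriv_one_jointOp (β : ℝ) {f : ℝ × Z d p → ℝ} {q : ℝ × Z d p}
    (hf : ContDiffAt ℝ ∞ f q) :
    dirDeriv (1, 0) (jointOp β f) q = jointOp (β + 2) (dirDeriv (1, 0) f) q := by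
  have h1 := contDiffAt_infty_dirDeriv hf ((1 : ℝ), (0 : Z d p))
  have h2 := contDiffAt_infty_dirDeriv h1 ((1 : ℝ), (0 : Z d p))
  have d1 := h1.differentiableAt (by simp)
  have d2 := h2.differentiableAt (by simp)
  have d3 : DifferentiableAt ℝ (fun q : ℝ × Z d p => 2 * q.1) q := by fun_prop
  have e : HasFDerivAt (fun q : ℝ × Z d p => 2 * q.1)
      ((2 : ℝ) • ContinuousLinearMap.fst ℝ ℝ (Z d p)) q := hasFDerivAt_fst.const_mul 2
  unfold jointOp
  rw [dirDeriv_add (d3.fun_mul d2) (d1.const_mul β), dirDeriv_const_mul d1, add_mul, ← add_assoc,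
    add_right_comm]
  congr 1
  have h3 := (e.fun_mul d2.hasFDerivAt).fderiv
  change fderiv ℝ (fun q : ℝ × Z d p => 2 * q.1 * dirDeriv (1, 0) (dirDeriv (1, 0) f) q) q (1, 0) = _
  rw [h3]
  simp [dirDeriv]
  ring

theorem jointOp_dirDeriv_iterate {β : ℝ} {W : Set (ℝ × Z d p)} (hW : IsOpen W)
    {f : ℝ × Z d p → ℝ} (hf : ∀ q ∈ W, ContDiffAt ℝ ∞ f q)
    (he : ∀ q ∈ W, jointOp β f q = jointLap f q) (k : ℕ) : ∀ q ∈ W,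
      jointOp (β + 2 * k) ((dirDeriv (1, 0))^[k] f) q = jointLap ((dirDeriv (1, 0))^[k] f) q := by
  induction k generalizing f β with
  | zero => simpa using he
  | succ k ih =>
    intro q hq
    have h := ih (β := β + 2) (f := dirDeriv (1, 0) f)
      (fun q hq => contDiffAt_infty_dirDeriv (hf q hq) _) (fun q hq => by
        rw [← dirDeriv_one_jointOp β (hf q hq), ← dirDeriv_jointLap (hf q hq)]
        exact (dirDeriv_congr (Set.EqOn.eventuallyEq_of_mem he (hW.mem_nhds hq)) _).self_of_nhds) q hq
    rw [Function.iterate_succ_apply, ← h]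
    congr 1
    push_cast
    ring

theorem iteratedDeriv_slice {W : Set (ℝ × Z d p)} (hW : IsOpen W) {f : ℝ × Z d p → ℝ}
    (hf : ∀ q ∈ W, ContDiffAt ℝ ∞ f q) (k : ℕ) : ∀ q ∈ W,
      iteratedDeriv k (fun t => f (t, q.2)) q.1 = (dirDeriv (1, 0))^[k] f q := by
  induction k with
  | zero => intro q _; simp
  | succ k ih =>
    intro q hq
    rw [iteratedDeriv_succ, Function.iterate_succ_apply']
    have h : iteratedDeriv k (fun t => f (t, q.2)) =ᶠ[𝓝 q.1]
        fun t => (dirDeriv (1, 0))^[k] f (t, q.2) := by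
      filter_upwards [(tendsto_slice_left q).eventually (hW.mem_nhds hq)] with t ht
      exact ih (t, q.2) ht
    rw [h.deriv_eq]
    exact (hasDerivAt_slice_left ((contDiffAt_dirDeriv_iterate (hf q hq) _ k).differentiableAt
      (by simp))).deriv

/-- The `k`-th derivative with respect to `ϱ` at `ϱ = 0`. -/
def rhoDeriv (g : ℝ → Z d p → ℝ) (k : ℕ) (z : Z d p) : ℝ :=
  (dirDeriv ((1 : ℝ), (0 : Z d p)))^[k] (Function.uncurry g) (0, z)

@[simp] theorem rhoDeriv_zero (g : ℝ → Z d p → ℝ) (z : Z d p) : rhoDeriv g 0 z = g 0 z := rfl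

theorem rhoDeriv_eq_iteratedDeriv {g : ℝ → Z d p → ℝ} {z : Z d p}
    (hg : ∀ᶠ q in 𝓝 ((0 : ℝ), z), ContDiffAt ℝ ∞ (Function.uncurry g) q) (k : ℕ) :
    rhoDeriv g k z = iteratedDeriv k (fun r => g r z) 0 := by
  obtain ⟨W, hWs, hW, hz⟩ := mem_nhds_iff.1 hg
  exact (iteratedDeriv_slice hW (fun q hq => hWs hq) k (0, z) hz).symm

theorem analyticAt_rhoDeriv {g : ℝ → Z d p → ℝ} {z : Z d p}
    (hg : AnalyticAt ℝ (Function.uncurry g) (0, z)) (k : ℕ) : AnalyticAt ℝ (rhoDeriv g k) z :=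
  AnalyticAt.comp (f := fun z : Z d p => ((0 : ℝ), z)) (analyticAt_dirDeriv_iterate hg _ k)
    (analyticAt_const.prod analyticAt_id)

theorem tendsto_zero_prodMk (z : Z d p) : Tendsto (fun w => ((0 : ℝ), w)) (𝓝 z) (𝓝 (0, z)) :=
  tendsto_slice_right ((0 : ℝ), z)

/-- The equation at `ϱ = 0`, differentiated `k` times. -/
theorem eventually_rhoDeriv_succ {β : ℝ} {g : ℝ → Z d p → ℝ}
    (h : ∀ᶠ q in 𝓝 ((0 : ℝ), z₀), ContDiffAt ℝ ∞ (Function.uncurry g) q ∧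
      radialOp β (fun r => g r q.2) q.1 = xLap (g q.1) q.2) :
    ∀ᶠ z in 𝓝 z₀, ∀ k : ℕ, (β + 2 * k) * rhoDeriv g (k + 1) z = xLap (rhoDeriv g k) z := by
  obtain ⟨W, hWs, hW, hz⟩ := mem_nhds_iff.1 h
  have hsm : ∀ q ∈ W, ContDiffAt ℝ ∞ (Function.uncurry g) q := fun q hq => (hWs hq).1
  have he : ∀ q ∈ W, jointOp β (Function.uncurry g) q = jointLap (Function.uncurry g) q := by
    intro q hq
    have h2 := (hsm q hq).of_le two_le_infty
    rw [← radialOp_slice β h2, ← xLap_slice h2]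
    exact (hWs hq).2
  filter_upwards [(tendsto_zero_prodMk z₀).eventually (hW.mem_nhds hz)] with z hz k
  -- At ϱ = 0 the second-order term drops out and the equation becomes a recursion between
  -- consecutive derivatives.
  have h1 := jointOp_dirDeriv_iterate hW hsm he k (0, z) hz
  rw [← xLap_slice ((contDiffAt_dirDeriv_iterate (hsm _ hz) _ k).of_le two_le_infty), jointOp,
    mul_zero, zero_mul, zero_add] at h1
  rw [rhoDeriv, Function.iterate_succ_apply']
  exact h1

/-- The recursion fixes each coefficient unless β + 2k = 0; exactly there the vanishing has to be
supplied as a hypothesis. -/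
theorem eqOn_zero_of_recursion {β : ℝ} {U : Set (Z d p)} (hU : IsOpen U) {a : ℕ → Z d p → ℝ}
    (h : ∀ z ∈ U, ∀ k : ℕ, (β + 2 * k) * a (k + 1) z = xLap (a k) z)
    (h0 : ∀ z ∈ U, a 0 z = 0) (h1 : ∀ k : ℕ, β + 2 * k = 0 → ∀ z ∈ U, a (k + 1) z = 0) (k : ℕ) :
    ∀ z ∈ U, a k z = 0 := by
  induction k with
  | zero => exact h0
  | succ k ih =>
    intro z hz
    by_cases hk : β + 2 * k = 0
    · exact h1 k hk z hz
    · have h2 := h z hz k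
      rw [xLap_eqOn hU (g := fun _ => 0) (fun w hw => ih w hw) hz, xLap_zero] at h2
      exact (mul_eq_zero.1 h2).resolve_left hk

/-- Functions that are analytic in `ϱ` are determined by their `ϱ`-derivatives at `ϱ = 0`. -/
theorem eventually_eq_zero_of_rhoDeriv {g : ℝ → Z d p → ℝ}
    (h : ∀ᶠ q in 𝓝 ((0 : ℝ), z₀), ContDiffAt ℝ ∞ (Function.uncurry g) q ∧
      AnalyticAt ℝ (fun r => g r q.2) q.1)
    (h0 : ∀ᶠ z in 𝓝 z₀, ∀ k, rhoDeriv g k z = 0) : ∀ᶠ q in 𝓝 ((0 : ℝ), z₀), g q.1 q.2 = 0 := by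
  have h0' : ∀ᶠ q in 𝓝 ((0 : ℝ), z₀), ∀ k, rhoDeriv g k q.2 = 0 :=
    (continuous_snd.tendsto ((0 : ℝ), z₀)).eventually h0
  obtain ⟨e, he, hball⟩ := Metric.mem_nhds_iff.1 (h.and h0')
  filter_upwards [Metric.ball_mem_nhds _ he] with q hq
  rw [← ball_prod_same] at hball hq
  have hmem : ∀ r ∈ Metric.ball (0 : ℝ) e, (r, q.2) ∈ Metric.ball (0 : ℝ) e ×ˢ Metric.ball z₀ e :=
    fun r hr => ⟨hr, hq.2⟩
  have hA : AnalyticOnNhd ℝ (fun r => g r q.2) (Metric.ball 0 e) := fun r hr =>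
    (hball (hmem r hr)).1.2
  have h0e := Metric.mem_ball_self (x := (0 : ℝ)) he
  have hev : (fun r => g r q.2) =ᶠ[𝓝 0] 0 := by
    -- Vanishing of all derivatives means infinite order at 0; the identity theorem extends it to
    -- the whole interval.
    refine analyticOrderAt_eq_top.1 ((ENat.eq_top_iff_forall_ge).2 fun m => ?_)
    refine (natCast_le_analyticOrderAt_iff_iteratedDeriv_eq_zero (hA 0 h0e)).2 fun i _ => ?_
    rw [← rhoDeriv_eq_iteratedDeriv (z := q.2)]
    · exact (hball (hmem 0 h0e)).2 i
    · filter_upwards [(Metric.isOpen_ball.prod Metric.isOpen_ball).mem_nhds (hmem 0 h0e)] with q hq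
      exact (hball hq).1.1
  exact hA.eqOn_zero_of_preconnected_of_eventuallyEq_zero (convex_ball 0 e).isPreconnected h0e hev hq.1

end TaylorCoefficients

/-! ### Solutions analytic in ϱ: uniqueness and the obstruction Δ^s H -/

section AnalyticInRho

variable {d p n s : ℕ} {V : Set (Z d p)} {H : Z d p → ℝ} {h h' : ℝ → Z d p → ℝ}

theorem radialOp_sub_of_pdeAt {q : ℝ × Z d p} (hH : ContDiffAt ℝ 2 H q.2)
    (h1 : ContDiffAt ℝ ∞ (Function.uncurry h) q) (h2 : ContDiffAt ℝ ∞ (Function.uncurry h') q)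
    (e1 : PDEAt n H h q.1 q.2) (e2 : PDEAt n H h' q.1 q.2) :
    radialOp (2 - (n : ℝ)) (fun r => h r q.2 + -1 * h' r q.2) q.1 =
      xLap (fun w => h q.1 w + -1 * h' q.1 w) q.2 := by
  have a1 := (contDiffAt_slice_right h1).of_le two_le_infty
  have a2 := (contDiffAt_slice_right h2).of_le two_le_infty
  have b1 := (contDiffAt_slice_left h1).of_le two_le_infty
  have b2 := (contDiffAt_slice_left h2).of_le two_le_infty
  rw [radialOp_add b1 (contDiffAt_const.mul b2), radialOp_const_mul b2, pdeAt_iff.1 e1,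
    pdeAt_iff.1 e2, xLap_add hH a1, xLap_add hH a2, xLap_add a1 (contDiffAt_const.mul a2),
    xLap_const_mul a2]
  ring

theorem IsRhoAnalyticSolution.congr (hs : IsRhoAnalyticSolution n V H h')
    (he : ∀ z ∈ V, ∀ᶠ q in 𝓝 ((0 : ℝ), z), h q.1 q.2 = h' q.1 q.2) :
    IsRhoAnalyticSolution n V H h := by
  intro z hz
  obtain ⟨h1, h2⟩ := hs z hz
  rw [← nhds_prod_eq] at h1 ⊢
  refine ⟨?_, (he z hz).self_of_nhds.trans h2⟩
  filter_upwards [h1, (he z hz).eventually_nhds] with q hq hq'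
  exact ⟨contDiffAt_uncurry_congr hq' hq.1,
    hq.2.1.congr (eventuallyEq_slices hq').1.symm, PDEAt.congr hq' hq.2.2⟩

/-- Uniqueness, for `n` odd, of the solution that is analytic in `ϱ`. -/
theorem IsRhoAnalyticSolution.eventuallyEq (hn : Odd n) (hV : IsOpen V) (hH : ContDiffOn ℝ ∞ H V)
    (hs : IsRhoAnalyticSolution n V H h) (hs' : IsRhoAnalyticSolution n V H h') :
    ∀ z ∈ V, ∀ᶠ q in 𝓝 ((0 : ℝ), z), h q.1 q.2 = h' q.1 q.2 := by
  intro z hz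
  have h1 := (hs z hz).1
  have h2 := (hs' z hz).1
  rw [← nhds_prod_eq] at h1 h2
  have hVq : ∀ᶠ q in 𝓝 ((0 : ℝ), z), q.2 ∈ V :=
    (continuous_snd.tendsto ((0 : ℝ), z)).eventually (hV.mem_nhds hz)
  have hrec := eventually_rhoDeriv_succ (β := 2 - n) (g := fun r w => h r w + -1 * h' r w) (z₀ := z) (by
    filter_upwards [h1, h2, hVq] with q a1 a2 hq
    exact ⟨a1.1.add (contDiffAt_const.mul a2.1), radialOp_sub_of_pdeAt
      ((hH.contDiffAt (hV.mem_nhds hq)).of_le two_le_infty) a1.1 a2.1 a1.2.2 a2.2.2⟩)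
  have h3 := eventually_eq_zero_of_rhoDeriv (g := fun r w => h r w + -1 * h' r w) (z₀ := z) (by
    filter_upwards [h1, h2] with q a1 a2
    exact ⟨a1.1.add (contDiffAt_const.mul a2.1), a1.2.1.add (analyticAt_const.mul a2.2.1)⟩) (by
    obtain ⟨U, hUs, hU, hzU⟩ := mem_nhds_iff.1 (hrec.and (hV.mem_nhds hz))
    filter_upwards [hU.mem_nhds hzU] with w hw k
    refine eqOn_zero_of_recursion hU (fun w hw => (hUs hw).1) (fun w hw => ?_) (fun k hk => ?_) k w hw
    · simp [(hs w (hUs hw).2).2, (hs' w (hUs hw).2).2]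
    · exact absurd (by linarith) (two_mul_sub_ne_zero_of_odd hn k))
  filter_upwards [h3] with q hq
  linarith

theorem radialOp_const (β c r : ℝ) : radialOp β (fun _ => c) r = 0 := by
  simp [radialOp_eq (Eventually.of_forall fun t => hasDerivAt_const t c) (hasDerivAt_const r (0 : ℝ))]

/-- For `n = 2s`, a solution that is analytic in `ϱ` exists only if `Δ^s H = 0`. -/
theorem IsRhoAnalyticSolution.xLap_iterate_eq_zero (hs1 : 1 ≤ s) (hV : IsOpen V)
    (hH : ContDiffOn ℝ ∞ H V) (hs : IsRhoAnalyticSolution (2 * s) V H h) :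
    ∀ z ∈ V, (xLap^[s] H) z = 0 := by
  intro z hz
  have h1 := (hs z hz).1
  rw [← nhds_prod_eq] at h1
  have hVq : ∀ᶠ q in 𝓝 ((0 : ℝ), z), q.2 ∈ V :=
    (continuous_snd.tendsto ((0 : ℝ), z)).eventually (hV.mem_nhds hz)
  have hHV : ∀ w ∈ V, ContDiffAt ℝ ∞ H w := fun w hw => hH.contDiffAt (hV.mem_nhds hw)
  -- The equation is homogeneous for g = H + h, whose value at ϱ = 0 is H.
  have hrec := eventually_rhoDeriv_succ (β := 2 - (2 * s : ℕ)) (g := fun r w => H w + h r w)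
    (z₀ := z) (by
      filter_upwards [h1, hVq] with q a1 hq
      refine ⟨(ContDiffAt.comp (g := H) q (hHV _ hq) contDiffAt_snd).add a1.1, ?_⟩
      rw [radialOp_add contDiffAt_const ((contDiffAt_slice_left a1.1).of_le two_le_infty),
        radialOp_const, zero_add]
      exact pdeAt_iff.1 a1.2.2)
  obtain ⟨U, hUs, hU, hzU⟩ := mem_nhds_iff.1 (hrec.and (hV.mem_nhds hz))
  -- Below the resonance every factor 2 - 2s + 2k is nonzero, so the k-th derivative is a nonzero
  -- multiple of Δ^k H.
  have key : ∀ k < s, ∃ κ : ℝ, κ ≠ 0 ∧ ∀ w ∈ U,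
      rhoDeriv (fun r w => H w + h r w) k w = κ * xLap^[k] H w := by
    intro k hk
    induction k with
    | zero => exact ⟨1, one_ne_zero, fun w hw => by simp [(hs w (hUs hw).2).2]⟩
    | succ k ih =>
      obtain ⟨κ, hκ, hκU⟩ := ih (by omega)
      have hc : (2 - ((2 * s : ℕ) : ℝ) + 2 * k) ≠ 0 := by
        intro h0
        have h2 : ((k + 1 : ℕ) : ℝ) = s := by push_cast at h0 ⊢; linarith
        have h3 : k + 1 = s := by exact_mod_cast h2
        omega
      refine ⟨κ / (2 - ((2 * s : ℕ) : ℝ) + 2 * k), div_ne_zero hκ hc, fun w hw => ?_⟩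
      have h2 := (hUs hw).1 k
      rw [xLap_eqOn hU hκU hw, xLap_const_mul ((contDiffAt_xLap_iterate
        (hHV w (hUs hw).2) k).of_le two_le_infty), ← Function.iterate_succ_apply' xLap] at h2
      rw [div_mul_eq_mul_div, eq_div_iff hc, ← h2, mul_comm]
  obtain ⟨m, rfl⟩ : ∃ m, s = m + 1 := ⟨s - 1, by omega⟩
  obtain ⟨κ, hκ, hκU⟩ := key m (by omega)
  have h2 := (hUs hzU).1 m
  rw [xLap_eqOn hU hκU hzU, xLap_const_mul ((contDiffAt_xLap_iterate
    (hHV z hz) m).of_le two_le_infty), ← Function.iterate_succ_apply' xLap] at h2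
  -- At k = s - 1 the left-hand side of the recursion disappears and leaves κ Δ^s H = 0.
  have h3 : (2 - ((2 * (m + 1) : ℕ) : ℝ) + 2 * m) = 0 := by push_cast; ring
  rw [h3, zero_mul] at h2
  exact (mul_eq_zero.1 h2.symm).resolve_left hκ

theorem radialOp_sum {ι : Type*} (β : ℝ) (S : Finset ι) {y : ι → ℝ → ℝ} {r : ℝ}
    (hy : ∀ i ∈ S, ContDiffAt ℝ 2 (y i) r) :
    radialOp β (fun t => ∑ i ∈ S, y i t) r = ∑ i ∈ S, radialOp β (y i) r := by
  classical
  induction S using Finset.induction_on with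
  | empty => simp [radialOp_const]
  | insert i S hi ih =>
    simp only [Finset.sum_insert hi]
    rw [radialOp_add (hy i (by simp)) (ContDiffAt.sum fun j hj => hy j (by simp [hj])),
      ih fun j hj => hy j (by simp [hj])]

theorem xLap_sum {ι : Type*} (S : Finset ι) {f : ι → Z d p → ℝ} {z : Z d p}
    (hf : ∀ i ∈ S, ContDiffAt ℝ 2 (f i) z) :
    xLap (fun w => ∑ i ∈ S, f i w) z = ∑ i ∈ S, xLap (f i) z := by
  classical
  induction S using Finset.induction_on with
  | empty => simp
  | insert i S hi ih =>
    simp only [Finset.sum_insert hi]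
    rw [xLap_add (hf i (by simp)) (ContDiffAt.sum fun j hj => hf j (by simp [hj])),
      ih fun j hj => hf j (by simp [hj])]

theorem radialOp_pow (β : ℝ) (k : ℕ) (r : ℝ) :
    radialOp β (fun t => t ^ (k + 1)) r = (2 * k + β) * (k + 1) * r ^ k := by
  have h1 : ∀ᶠ t in 𝓝 r, HasDerivAt (fun t : ℝ => t ^ (k + 1)) (((k + 1 : ℕ) : ℝ) * t ^ k) t :=
    Eventually.of_forall fun t => hasDerivAt_pow (k + 1) t
  rw [radialOp_eq h1 ((hasDerivAt_pow k r).const_mul _)]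
  rcases k with _ | k
  · simp
  · rw [Nat.add_sub_cancel, pow_succ r k]
    push_cast
    ring

/-- For `n = 2s` and `Δ^s H = 0`, a solution that is a polynomial in `ϱ`. -/
theorem isRhoAnalyticSolution_polynomial (hs1 : 1 ≤ s) (hV : IsOpen V) (hH : ContDiffOn ℝ ∞ H V)
    (h0 : ∀ z ∈ V, (xLap^[s] H) z = 0) : IsRhoAnalyticSolution (2 * s) V H
      fun r z => ∑ k ∈ Finset.range s, evenCoeff s k * xLap^[k] H z * r ^ k := by
  intro z hz
  rw [← nhds_prod_eq]
  have hVq : ∀ᶠ q in 𝓝 ((0 : ℝ), z), q.2 ∈ V :=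
    (continuous_snd.tendsto ((0 : ℝ), z)).eventually (hV.mem_nhds hz)
  have hHV : ∀ w ∈ V, ∀ k, ContDiffAt ℝ ∞ (xLap^[k] H) w := fun w hw k =>
    contDiffAt_xLap_iterate (hH.contDiffAt (hV.mem_nhds hw)) k
  obtain ⟨m, rfl⟩ : ∃ m, s = m + 1 := ⟨s - 1, by omega⟩
  refine ⟨?_, ?_⟩
  · filter_upwards [hVq] with q hq
    have hr : ∀ k : ℕ, ContDiffAt ℝ 2 (fun t : ℝ => t ^ k) q.1 := fun k => contDiffAt_id.pow k
    refine ⟨?_, ?_, ?_⟩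
    · refine ContDiffAt.sum fun k _ => ?_
      exact (contDiffAt_const.mul (ContDiffAt.comp (g := xLap^[k] H) q (hHV _ hq k)
        contDiffAt_snd)).mul (contDiffAt_fst.pow k)
    · exact Finset.analyticAt_fun_sum _ fun k _ => analyticAt_const.mul (analyticAt_id.pow k)
    · rw [pdeAt_iff, radialOp_sum _ _ fun k _ => contDiffAt_const.mul (hr k),
        xLap_add (f := H) ((hHV _ hq 0).of_le two_le_infty) (ContDiffAt.sum fun k _ =>
          (contDiffAt_const.mul ((hHV _ hq k).of_le two_le_infty)).mul contDiffAt_const),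
        xLap_sum _ fun k _ => (contDiffAt_const.mul ((hHV _ hq k).of_le two_le_infty)).mul
          contDiffAt_const]
      have e1 : ∀ k, xLap (fun w => evenCoeff (m + 1) k * xLap^[k] H w * q.1 ^ k) q.2 =
          evenCoeff (m + 1) k * q.1 ^ k * xLap^[k + 1] H q.2 := fun k => by
        have : (fun w => evenCoeff (m + 1) k * xLap^[k] H w * q.1 ^ k) =
            fun w => (evenCoeff (m + 1) k * q.1 ^ k) * xLap^[k] H w := by
          funext w; ring
        rw [this, xLap_const_mul ((hHV _ hq k).of_le two_le_infty), Function.iterate_succ_apply']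
      have e2 : ∀ k, radialOp (2 - ((2 * (m + 1) : ℕ) : ℝ))
          (fun t => evenCoeff (m + 1) k * xLap^[k] H q.2 * t ^ k) q.1 =
          evenCoeff (m + 1) k * xLap^[k] H q.2 *
            radialOp (2 - ((2 * (m + 1) : ℕ) : ℝ)) (fun t => t ^ k) q.1 := fun k =>
        radialOp_const_mul (hr k) _
      have e3 : ∀ k ∈ Finset.range m, evenCoeff (m + 1) (k + 1) * xLap^[k + 1] H q.2 *
            ((2 * k + (2 - ((2 * (m + 1) : ℕ) : ℝ))) * (k + 1) * q.1 ^ k) =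
          (if k = 0 then xLap^[k + 1] H q.2 * q.1 ^ k else 0) +
            evenCoeff (m + 1) k * q.1 ^ k * xLap^[k + 1] H q.2 := fun k hk => by
        have h1 := evenCoeff_recursion hs1 k
        rw [Nat.add_sub_cancel, if_neg (Finset.mem_range.1 hk).ne] at h1
        have h2 : (if k = 0 then xLap^[k + 1] H q.2 * q.1 ^ k else 0) =
          (if k = 0 then 1 else 0) * (xLap^[k + 1] H q.2 * q.1 ^ k) := by split_ifs <;> simp
        rw [h2]
        linear_combination (xLap^[k + 1] H q.2 * q.1 ^ k) * h1
      simp only [e1, e2]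
      -- On the left the term constant in ϱ is split off to align the powers; on the right the last
      -- term, which carries Δ^s H = 0.
      rw [Finset.sum_range_succ', Finset.sum_range_succ, h0 _ hq]
      simp only [radialOp_pow]
      rw [Finset.sum_congr rfl e3, Finset.sum_add_distrib, Finset.sum_ite_eq' (Finset.range m) 0]
      rcases Nat.eq_zero_or_pos m with rfl | hm
      · simpa [evenCoeff] using (h0 _ hq).symm
      · simp [evenCoeff, hm]
  · change ∑ k ∈ Finset.range (m + 1), _ = _
    rw [Finset.sum_range_succ']
    simp [evenCoeff]

end AnalyticInRho

/-! ### Analytic solutions for n = 2s when Δ^s H = 0 -/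

section AnalyticSolutions

variable {d p s : ℕ} {V : Set (Z d p)} {H α : Z d p → ℝ} {h h' : ℝ → Z d p → ℝ}

theorem IsAnalyticSolution.congr {n : ℕ} (hs : IsAnalyticSolution n V H h')
    (he : ∀ z ∈ V, ∀ᶠ q in 𝓝 ((0 : ℝ), z), h q.1 q.2 = h' q.1 q.2) :
    IsAnalyticSolution n V H h := by
  intro z hz
  obtain ⟨h1, h2, h3⟩ := hs z hz
  rw [← nhds_prod_eq] at h2 ⊢
  have he' : Function.uncurry h' =ᶠ[𝓝 ((0 : ℝ), z)] Function.uncurry h :=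
    (he z hz).mono fun q hq => hq.symm
  refine ⟨h1.congr he', ?_, (he z hz).self_of_nhds.trans h3⟩
  filter_upwards [h2, (he z hz).eventually_nhds] with q hq hq'
  exact PDEAt.congr hq' hq

/-- The analytic solutions for `n = 2s` and `Δ^s H = 0`. -/
def evenAnalyticSol (s : ℕ) (H α : Z d p → ℝ) (ϱ : ℝ) (z : Z d p) : ℝ :=
  lapSeries (evenCoeff s) H ϱ z + ϱ ^ s * lapSeries (fun k => (plusDen (2 * s) k)⁻¹) α ϱ z

theorem isAnalyticSolution_evenAnalyticSol (hs : 1 ≤ s) (hV : IsOpen V) (hH : AnalyticOnNhd ℝ H V)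
    (h0 : ∀ z ∈ V, (xLap^[s] H) z = 0) (hα : AnalyticOnNhd ℝ α V) :
    IsAnalyticSolution (2 * s) V H (evenAnalyticSol s H α) := by
  intro z hz
  rw [← nhds_prod_eq]
  have hVq : ∀ᶠ q in 𝓝 ((0 : ℝ), z), q.2 ∈ V :=
    (continuous_snd.tendsto ((0 : ℝ), z)).eventually (hV.mem_nhds hz)
  have f1 := factorialDecay_evenCoeff s
  have f2 := factorialDecay_plusDen (2 * s)
  refine ⟨(f1.analyticAt (hH z hz)).add ((analyticAt_fst.pow s).mul (f2.analyticAt (hα z hz))), ?_, ?_⟩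
  · filter_upwards [hVq, f1.eventually_analyticAt (hH z hz), f2.eventually_analyticAt (hα z hz),
      eventually_evenSeries hs (hH z hz), eventually_plusSeries (2 * s) (hα z hz)]
      with q hq a1 a2 e1 e2
    have b1 := (contDiffAt_slice_left a1.contDiffAt).of_le (m := 2) (n := 2) le_rfl
    have b2 := (contDiffAt_slice_left a2.contDiffAt).of_le (m := 2) (n := 2) le_rfl
    have c1 := (contDiffAt_slice_right a1.contDiffAt).of_le (m := 2) (n := 2) le_rfl
    have c2 := (contDiffAt_slice_right a2.contDiffAt).of_le (m := 2) (n := 2) le_rfl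
    have hp : ContDiffAt ℝ 2 (fun t : ℝ => t ^ s) q.1 := contDiffAt_id.pow s
    have e3 := radialOp_pow_mul s b2
    have e4 : (2 : ℝ) - 2 * s = 2 - (2 * s : ℕ) := by push_cast; ring
    have e5 : (2 : ℝ) + 2 * s = 2 + (2 * s : ℕ) := by push_cast; ring
    rw [e4, e5, e2] at e3
    rw [pdeAt_iff]
    unfold evenAnalyticSol
    rw [radialOp_add b1 (hp.mul b2), e1, e3, h0 _ hq,
      xLap_add (hH _ hq).contDiffAt (c1.add (contDiffAt_const.mul c2)),
      xLap_add c1 (contDiffAt_const.mul c2), xLap_const_mul c2]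
    ring
  · simp [evenAnalyticSol, lapSeries_zero_left, evenCoeff, zero_pow (by omega : s ≠ 0)]

theorem iteratedDeriv_pow_mul_zero {y : ℝ → ℝ} (hy : ContDiffAt ℝ s y 0) :
    iteratedDeriv s (fun r => r ^ s * y r) 0 = s ! * y 0 := by
  have hp : ContDiffAt ℝ s (fun r : ℝ => r ^ s) 0 := contDiffAt_id.pow s
  rw [iteratedDeriv_fun_mul hp hy, Finset.sum_eq_single s]
  · rw [iteratedDeriv_fun_pow_zero]
    simp
  · intro i _ hi
    rw [iteratedDeriv_fun_pow_zero, if_neg hi]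
    simp
  · simp

/-- The s-th ϱ-derivative at 0, after removal of the polynomial part and division by s!, gives α.
Subtracting the solution with this α kills the one coefficient left free by the recursion, hence all
of them. -/
theorem IsAnalyticSolution.exists_eq (hs : 1 ≤ s) (hV : IsOpen V) (hH : AnalyticOnNhd ℝ H V)
    (h0 : ∀ z ∈ V, (xLap^[s] H) z = 0) (hh : IsAnalyticSolution (2 * s) V H h) :
    ∃ α : Z d p → ℝ, AnalyticOnNhd ℝ α V ∧
      ∀ z ∈ V, ∀ᶠ q in 𝓝 ((0 : ℝ), z), h q.1 q.2 = evenAnalyticSol s H α q.1 q.2 := by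
  set g₁ : ℝ → Z d p → ℝ := fun r z => h r z + -1 * lapSeries (evenCoeff s) H r z with hg₁
  set α : Z d p → ℝ := fun z => (s ! : ℝ)⁻¹ * rhoDeriv g₁ s z with hα
  have hg₁A : ∀ z ∈ V, AnalyticAt ℝ (Function.uncurry g₁) (0, z) := fun z hz =>
    (hh z hz).1.add (analyticAt_const.mul ((factorialDecay_evenCoeff s).analyticAt (hH z hz)))
  have hαA : AnalyticOnNhd ℝ α V := fun z hz =>
    analyticAt_const.mul (analyticAt_rhoDeriv (hg₁A z hz) s)
  have hS := isAnalyticSolution_evenAnalyticSol hs hV hH h0 hαA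
  refine ⟨α, hαA, fun z hz => ?_⟩
  set g : ℝ → Z d p → ℝ := fun r w => h r w + -1 * evenAnalyticSol s H α r w with hg
  have hgA : ∀ z ∈ V, AnalyticAt ℝ (Function.uncurry g) (0, z) := fun z hz =>
    (hh z hz).1.add (analyticAt_const.mul (hS z hz).1)
  have hVq : ∀ᶠ q in 𝓝 ((0 : ℝ), z), q.2 ∈ V :=
    (continuous_snd.tendsto ((0 : ℝ), z)).eventually (hV.mem_nhds hz)
  have h1 := (hh z hz).2.1
  have h2 := (hS z hz).2.1
  rw [← nhds_prod_eq] at h1 h2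
  have hrec := eventually_rhoDeriv_succ (β := 2 - (2 * s : ℕ)) (g := g) (z₀ := z) (by
    filter_upwards [(hgA z hz).eventually_analyticAt, (hh z hz).1.eventually_analyticAt,
      (hS z hz).1.eventually_analyticAt, h1, h2, hVq] with q a0 a1 a2 e1 e2 hq
    exact ⟨a0.contDiffAt, radialOp_sub_of_pdeAt (hH _ hq).contDiffAt a1.contDiffAt a2.contDiffAt e1 e2⟩)
  have hcoef : ∀ w ∈ V, rhoDeriv g s w = 0 := by
    intro w hw
    have hsm : ∀ {f : ℝ → Z d p → ℝ}, AnalyticAt ℝ (Function.uncurry f) (0, w) →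
        ∀ᶠ q in 𝓝 ((0 : ℝ), w), ContDiffAt ℝ ∞ (Function.uncurry f) q := fun hf =>
      hf.eventually_analyticAt.mono fun q hq => hq.contDiffAt
    have hL : ContDiffAt ℝ s (fun r => lapSeries (fun k => (plusDen (2 * s) k)⁻¹) α r w) 0 :=
      contDiffAt_slice_left (q := ((0 : ℝ), w))
        ((factorialDecay_plusDen (2 * s)).analyticAt (hαA w hw)).contDiffAt
    have hg₁s : ContDiffAt ℝ s (fun r => g₁ r w) 0 :=
      contDiffAt_slice_left (q := ((0 : ℝ), w)) (hg₁A w hw).contDiffAt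
    have e1 : (fun r => g r w) = fun r => g₁ r w -
        r ^ s * lapSeries (fun k => (plusDen (2 * s) k)⁻¹) α r w := by
      funext r
      simp only [hg, hg₁, evenAnalyticSol]
      ring
    have hp : ContDiffAt ℝ s (fun r : ℝ => r ^ s) 0 := contDiffAt_id.pow s
    rw [rhoDeriv_eq_iteratedDeriv (hsm (hgA w hw)), e1,
      iteratedDeriv_fun_sub hg₁s (hp.mul hL), iteratedDeriv_pow_mul_zero hL,
      ← rhoDeriv_eq_iteratedDeriv (hsm (hg₁A w hw)), lapSeries_zero_left, plusDen_zero, hα]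
    field_simp
    simp
  have h3 := eventually_eq_zero_of_rhoDeriv (g := g) (z₀ := z) (by
    filter_upwards [(hgA z hz).eventually_analyticAt] with q a0
    exact ⟨a0.contDiffAt, AnalyticAt.comp (f := fun r => (r, q.2)) a0
      (analyticAt_id.prod analyticAt_const)⟩) (by
    obtain ⟨U, hUs, hU, hzU⟩ := mem_nhds_iff.1 (hrec.and (hV.mem_nhds hz))
    filter_upwards [hU.mem_nhds hzU] with w hw k
    refine eqOn_zero_of_recursion hU (fun w hw => (hUs hw).1) (fun w hw => ?_) (fun k hk w hw => ?_) k w hw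
    · simp [hg, (hh w (hUs hw).2).2.2, (hS w (hUs hw).2).2.2]
    · have h4 : ((k + 1 : ℕ) : ℝ) = s := by push_cast at hk ⊢; linarith
      have h5 : k + 1 = s := by exact_mod_cast h4
      rw [h5]
      exact hcoef w (hUs hw).2)
  filter_upwards [h3] with q hq
  simp only [hg] at hq
  linarith

end AnalyticSolutions

/-- By Tonelli the sum of the norms has finite integral, hence is finite almost everywhere. -/
theorem ae_summable_norm_of_summable_integral_norm {X : Type*} [MeasurableSpace X]
    {μ : Measure X} {F : ℕ → X → ℝ} (hF : ∀ i, Integrable (F i) μ)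
    (hs : Summable fun i => ∫ x, ‖F i x‖ ∂μ) :
    (∀ᵐ x ∂μ, Summable fun i => ‖F i x‖) ∧ Integrable (fun x => ∑' i, F i x) μ := by
  have h1 : ∫⁻ x, ∑' i, ‖F i x‖ₑ ∂μ < ⊤ := by
    rw [lintegral_tsum fun i => (hF i).1.enorm]
    have h2 : ∀ i, ∫⁻ x, ‖F i x‖ₑ ∂μ = ENNReal.ofReal (∫ x, ‖F i x‖ ∂μ) := fun i =>
      (ofReal_integral_norm_eq_lintegral_enorm (hF i)).symm
    simp only [h2]
    rw [← ENNReal.ofReal_tsum_of_nonneg (fun i => integral_nonneg fun x => norm_nonneg _) hs]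
    exact ENNReal.ofReal_lt_top
  have h3 : ∀ᵐ x ∂μ, Summable fun i => ‖F i x‖ := by
    filter_upwards [ae_lt_top' (AEMeasurable.tsum fun i => (hF i).1.enorm) h1.ne] with x hx
    have h4 : ∑' i, ((‖F i x‖₊ : NNReal) : ENNReal) ≠ ⊤ := hx.ne
    exact NNReal.summable_coe.2 (ENNReal.tsum_coe_ne_top_iff_summable.1 h4)
  refine ⟨h3, ?_, ?_⟩
  · refine aestronglyMeasurable_of_tendsto_ae (u := atTop)
      (f := fun (n : ℕ) x => ∑ i ∈ Finset.range n, F i x)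
      (fun n => Finset.aestronglyMeasurable_fun_sum _ fun i _ => (hF i).1) ?_
    filter_upwards [h3] with x hx
    exact hx.of_norm.hasSum.tendsto_sum_nat
  · refine lt_of_le_of_lt (lintegral_mono_ae ?_) h1
    filter_upwards [h3] with x hx
    exact enorm_tsum_le_tsum_enorm

/-! ### Convolution in x, the Laplacian, and the series -/

section Convolution

variable {d p : ℕ} {V : Set (Z d p)} {Q f : Z d p → ℝ}

theorem xConv_eq_integral (Q f : Z d p → ℝ) (z : Z d p) :
    xConv Q f z = ∫ y, convKernel Q f y z := rfl

theorem AnalyticConvolvable.smoothConvolvable (h : AnalyticConvolvable V Q f) :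
    SmoothConvolvable V Q f := by
  refine ⟨h.1, fun z hz k => ?_⟩
  obtain ⟨C, R, g, hg, hb⟩ := h.2 z hz
  exact ⟨g k, (hg k).1, hb.mono fun w hw y => hw k y⟩

theorem SmoothConvolvable.dominatedFamily (h : SmoothConvolvable V Q f) :
    DominatedFamily volume V (convKernel Q f) :=
  ⟨h.1.2.1, h.1.2.2, h.2⟩

theorem convKernel_zero_left (f : Z d p → ℝ) (y : EuclideanSpace ℝ (Fin d)) :
    convKernel (fun _ => 0) f y = fun _ => 0 := by
  funext z; simp [convKernel]

theorem iteratedFDeriv_zero_function {E : Type*} [NormedAddCommGroup E] [NormedSpace ℝ E] (k : ℕ)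
    (z : E) : iteratedFDeriv ℝ k (fun _ : E => (0 : ℝ)) z = 0 := by
  have := iteratedFDeriv_fun_zero (𝕜 := ℝ) (E := E) (F := ℝ) (n := k)
  exact congrFun this z

theorem analyticConvolvable_zero (V : Set (Z d p)) (f : Z d p → ℝ) :
    AnalyticConvolvable V (fun _ => 0) f := by
  refine ⟨⟨fun z _ y h => absurd rfl h, fun z _ y => ?_, fun z _ k => ?_⟩, fun z _ => ?_⟩
  · rw [convKernel_zero_left]; exact contDiffAt_const
  · simp only [convKernel_zero_left]; exact aestronglyMeasurable_const
  · refine ⟨0, 0, fun _ _ => 0, fun k => ⟨integrable_zero _ _ _, by simp⟩,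
      Eventually.of_forall fun w k y => ?_⟩
    rw [convKernel_zero_left, iteratedFDeriv_zero_function, norm_zero]

theorem xConv_zero_left (f : Z d p → ℝ) (z : Z d p) : xConv (fun _ => 0) f z = 0 := by
  simp [xConv_eq_integral, convKernel_zero_left]

/-- The Laplacian acts at fixed u, where Q(y, u) is a constant factor and the rest is a translate.
Regularity of g is needed only where this factor is nonzero. -/
theorem xLap_convKernel {g : Z d p → ℝ} {z : Z d p} {y : EuclideanSpace ℝ (Fin d)}
    (hg : Q (y, z.2) ≠ 0 → ContDiffAt ℝ 2 g (z.1 - y, z.2)) :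
    xLap (convKernel Q g y) z = convKernel Q (xLap g) y z := by
  unfold xLap convKernel
  simp only
  by_cases hQ : Q (y, z.2) = 0
  · simp [hQ]
  · have h1 : ContDiffAt ℝ 2 (fun x : EuclideanSpace ℝ (Fin d) => g (x, z.2)) (z.1 - y) :=
      ContDiffAt.comp (g := g) (z.1 - y) (hg hQ) (contDiffAt_id.prodMk contDiffAt_const)
    have h2 : ContDiffAt ℝ 2 (fun x : EuclideanSpace ℝ (Fin d) => g (x - y, z.2)) z.1 :=
      ContDiffAt.comp (g := fun x : EuclideanSpace ℝ (Fin d) => g (x, z.2)) z.1 h1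
        (contDiffAt_id.sub contDiffAt_const)
    have h3 := InnerProductSpace.laplacian_smul (f := fun x => g (x - y, z.2)) (Q (y, z.2)) h2
    refine h3.trans ?_
    rw [smul_eq_mul, InnerProductSpace.laplacian_eq_iteratedFDeriv_orthonormalBasis _
      (EuclideanSpace.basisFun (Fin d) ℝ), InnerProductSpace.laplacian_eq_iteratedFDeriv_orthonormalBasis _
      (EuclideanSpace.basisFun (Fin d) ℝ)]
    simp only [iteratedFDeriv_comp_sub (f := fun x : EuclideanSpace ℝ (Fin d) => g (x, z.2))]

theorem xLap_iterate_convKernel (hV : IsOpen V)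
    (hs : ∀ z ∈ V, ∀ y, Q (y, z.2) ≠ 0 → (z.1 - y, z.2) ∈ V) (hf : ContDiffOn ℝ ∞ f V) (k : ℕ)
    (y : EuclideanSpace ℝ (Fin d)) :
    EqOn (xLap^[k] (convKernel Q f y)) (convKernel Q (xLap^[k] f) y) V := by
  induction k with
  | zero => exact fun _ _ => rfl
  | succ k ih =>
    intro z hz
    rw [Function.iterate_succ_apply', xLap_eqOn hV ih hz, xLap_convKernel fun hQ =>
      (contDiffAt_xLap_iterate (hf.contDiffAt (hV.mem_nhds (hs z hz y hQ))) k).of_le two_le_infty,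
      Function.iterate_succ_apply']

theorem SmoothConvolvable.contDiffOn_xConv (h : SmoothConvolvable V Q f) (hV : IsOpen V) :
    ContDiffOn ℝ ∞ (xConv Q f) V :=
  h.dominatedFamily.contDiffOn hV

/-- The Laplacian of a convolution. -/
theorem SmoothConvolvable.xLap_iterate_xConv (h : SmoothConvolvable V Q f) (hV : IsOpen V)
    (hf : ContDiffOn ℝ ∞ f V) (k : ℕ) :
    EqOn (xLap^[k] (xConv Q f)) (xConv Q (xLap^[k] f)) V := by
  intro z hz
  refine (h.dominatedFamily.xLap_iterate_integral hV k hz).trans (integral_congr_ae ?_)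
  exact Eventually.of_forall fun y => xLap_iterate_convKernel hV h.1.1 hf k y hz

theorem AnalyticConvolvable.exists_bound (h : AnalyticConvolvable V Q f) {z : Z d p} (hz : z ∈ V) :
    ∃ (C R : ℝ) (g : ℕ → EuclideanSpace ℝ (Fin d) → ℝ), 0 ≤ C ∧ 0 ≤ R ∧
      (∀ k, Integrable (g k) ∧ ∫ y, g k y ≤ C * R ^ k * (k ! : ℝ)) ∧
      ∀ᶠ w in 𝓝 z, ∀ k y, ‖iteratedFDeriv ℝ k (convKernel Q f y) w‖ ≤ g k y := by
  obtain ⟨C, R, g, hg, hb⟩ := h.2 z hz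
  refine ⟨|C|, |R|, g, abs_nonneg _, abs_nonneg _, fun k => ⟨(hg k).1, (hg k).2.trans ?_⟩, hb⟩
  rw [← abs_pow, ← abs_mul]
  gcongr
  exact le_abs_self _

theorem AnalyticConvolvable.analyticOnNhd_xConv (h : AnalyticConvolvable V Q f) (hV : IsOpen V) :
    AnalyticOnNhd ℝ (xConv Q f) V := by
  intro z hz
  obtain ⟨C, R, g, hC, hR, hg, hb⟩ := h.exists_bound hz
  obtain ⟨U, hUs, hU, hzU⟩ := mem_nhds_iff.1 (hb.and (hV.mem_nhds hz))
  have hD := h.smoothConvolvable.dominatedFamily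
  refine CauchyOn.analyticAt hU (C := C) ⟨(hD.contDiffOn hV).mono fun w hw => (hUs hw).2,
    fun w hw k => ?_⟩ hR hzU
  have e := hD.iteratedFDeriv_integral hV (hUs hw).2 k
  have e2 : iteratedFDeriv ℝ k (xConv Q f) w = ∫ y, iteratedFDeriv ℝ k (convKernel Q f y) w := e
  change ‖iteratedFDeriv ℝ k (xConv Q f) w‖ ≤ _
  rw [e2]
  exact (norm_integral_le_of_norm_le (hg k).1 (Eventually.of_forall fun y => (hUs hw).1 k y)).trans
    (hg k).2

/-- Convolution with `Q` can be interchanged with the summation of the series `∑ ϱ^k Δ^k f`. -/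
theorem AnalyticConvolvable.eventually_series (h : AnalyticConvolvable V Q f) (hV : IsOpen V)
    (hf : ContDiffOn ℝ ∞ f V) (n : ℕ) {z₀ : Z d p} (hz₀ : z₀ ∈ V) :
    ∀ᶠ q in 𝓝 ((0 : ℝ), z₀),
      (∀ᵐ y, Q (y, q.2.2) ≠ 0 → Summable (fun k : ℕ =>
        (xLap^[k] f) (q.2.1 - y, q.2.2) / plusDen n k * q.1 ^ k)) ∧
      Integrable (fun y => Q (y, q.2.2) *
        ∑' k : ℕ, (xLap^[k] f) (q.2.1 - y, q.2.2) / plusDen n k * q.1 ^ k) ∧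
      ∫ y, Q (y, q.2.2) * ∑' k : ℕ, (xLap^[k] f) (q.2.1 - y, q.2.2) / plusDen n k * q.1 ^ k =
        lapSeries (fun k => (plusDen n k)⁻¹) (xConv Q f) q.1 q.2 := by
  obtain ⟨C, R, g, hC, hR, hg, hb⟩ := h.exists_bound hz₀
  have hD := h.smoothConvolvable.dominatedFamily
  have hc := (continuous_snd.tendsto ((0 : ℝ), z₀))
  have hr : ∀ᶠ q in 𝓝 ((0 : ℝ), z₀), 4 * d * R ^ 2 * |q.1| < 1 := by
    have : Continuous fun q : ℝ × Z d p => 4 * d * R ^ 2 * |q.1| := by fun_prop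
    have h0 := this.tendsto ((0 : ℝ), z₀)
    simp only [abs_zero, mul_zero] at h0
    exact h0.eventually (gt_mem_nhds one_pos)
  filter_upwards [hc.eventually hb, hc.eventually (hV.mem_nhds hz₀), hr] with q hbq hqV hqr
  set F : ℕ → EuclideanSpace ℝ (Fin d) → ℝ := fun k y =>
    Q (y, q.2.2) * ((xLap^[k] f) (q.2.1 - y, q.2.2) / plusDen n k * q.1 ^ k) with hF
  have hFe : ∀ k y, F k y = q.1 ^ k / plusDen n k * xLap^[k] (convKernel Q f y) q.2 := fun k y => by
    rw [xLap_iterate_convKernel hV h.1.1 hf k y hqV, hF, convKernel]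
    ring
  have hFi : ∀ k, Integrable (F k) := fun k => by
    simp only [funext (hFe k)]
    exact ((hD.xLap_iterate hV k).integrable_apply hqV).const_mul _
  -- The k-th Laplacian of the kernel is controlled by its derivative of order 2k, dominated by g
  -- (2k).
  have hFb : ∀ k y, ‖F k y‖ ≤ |q.1| ^ k * (plusDen n k)⁻¹ * d ^ k * g (2 * k) y := fun k y => by
    have h1 := norm_iteratedFDeriv_xLap_iterate_le (hD.contDiffAt q.2 hqV y) 0 k
    rw [norm_iteratedFDeriv_zero, zero_add] at h1
    have hp := plusDen_pos n k
    rw [hFe, norm_mul, norm_div, norm_pow, Real.norm_eq_abs, Real.norm_of_nonneg hp.le,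
      div_eq_mul_inv, mul_assoc (_ * _) _ (g _ _)]
    gcongr
    exact h1.trans (mul_le_mul_of_nonneg_left (hbq (2 * k) y) (by positivity))
  -- The Cauchy bound on the integral of g (2k) contains (2k)!, which `plusDen` absorbs; the result
  -- is geometric with ratio 4dR²|ϱ| < 1.
  have hFs : Summable fun k => ∫ y, ‖F k y‖ := by
    refine Summable.of_nonneg_of_le (fun k => integral_nonneg fun y => norm_nonneg _)
      (fun k => ?_) ((summable_geometric_of_lt_one (by positivity) hqr).mul_left C)
    have hp := plusDen_pos n k
    have h3 : (0 : ℝ) < (2 * k)! := by positivity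
    calc _ ≤ ∫ y, |q.1| ^ k * (plusDen n k)⁻¹ * d ^ k * g (2 * k) y :=
          integral_mono (hFi k).norm ((hg _).1.const_mul _) (hFb k)
      _ = |q.1| ^ k * (plusDen n k)⁻¹ * d ^ k * ∫ y, g (2 * k) y := integral_const_mul _ _
      _ ≤ |q.1| ^ k * (plusDen n k)⁻¹ * d ^ k * (C * R ^ (2 * k) * ((2 * k)! : ℝ)) := by
        gcongr
        exact (hg (2 * k)).2
      _ ≤ |q.1| ^ k * (4 ^ k / (2 * k)!) * d ^ k * (C * R ^ (2 * k) * ((2 * k)! : ℝ)) := by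
        gcongr
        exact inv_plusDen_le n k
      _ = _ := by
        rw [pow_mul, mul_pow, mul_pow, mul_pow]
        field_simp
  obtain ⟨h1, h2⟩ := ae_summable_norm_of_summable_integral_norm hFi hFs
  have e : (fun y => ∑' k, F k y) = fun y => Q (y, q.2.2) *
      ∑' k : ℕ, (xLap^[k] f) (q.2.1 - y, q.2.2) / plusDen n k * q.1 ^ k := by
    funext y
    exact tsum_mul_left
  refine ⟨?_, ?_, ?_⟩
  · filter_upwards [h1] with y hy hQ
    exact (summable_mul_left_iff hQ).1 hy.of_norm
  · rwa [e] at h2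
  · have h3 := integral_tsum_of_summable_integral_norm hFi hFs
    rw [e] at h3
    rw [← h3, lapSeries, rhoSeries]
    refine tsum_congr fun k => ?_
    simp only [hFe]
    have h4 : xLap^[k] (xConv Q f) q.2 = ∫ y, xLap^[k] (convKernel Q f y) q.2 :=
      hD.xLap_iterate_integral hV k hqV
    rw [integral_const_mul, h4]
    ring

end Convolution

/-! ### Expansions in the sense of convergent series -/

section Expansions

variable {d p n s : ℕ} {V : Set (Z d p)} {H α Q : Z d p → ℝ} {l : Filter ℝ}
  {h : ℝ → Z d p → ℝ}

theorem eventually_prod_of_nhds (hl : l ≤ 𝓝 0) {z : Z d p} {P : ℝ × Z d p → Prop}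
    (h : ∀ᶠ q in 𝓝 ((0 : ℝ), z), P q) : ∀ᶠ q in l ×ˢ 𝓝 z, P q := by
  rw [nhds_prod_eq] at h
  exact h.filter_mono (prod_mono_left _ hl)

theorem contDiffOn_of_analyticOnNhd (hH : AnalyticOnNhd ℝ H V) : ContDiffOn ℝ ∞ H V :=
  fun z hz => (hH z hz).contDiffAt.contDiffWithinAt

theorem FactorialDecay.eventually_hasSum {c : ℕ → ℝ} (hc : FactorialDecay c) {z₀ : Z d p}
    (hα : AnalyticAt ℝ α z₀) : ∀ᶠ q in 𝓝 ((0 : ℝ), z₀),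
      HasSum (fun k : ℕ => c k * (xLap^[k] α) q.2 * q.1 ^ k) (lapSeries c α q.1 q.2) :=
  (hc.geometricCauchy hα).eventually_hasSum

theorem eventually_hasSum_plusDen (n : ℕ) {z₀ : Z d p} (hα : AnalyticAt ℝ α z₀) :
    ∀ᶠ q in 𝓝 ((0 : ℝ), z₀), HasSum (fun k : ℕ => (xLap^[k] α) q.2 / plusDen n k * q.1 ^ k)
      (lapSeries (fun k => (plusDen n k)⁻¹) α q.1 q.2) := by
  filter_upwards [(factorialDecay_plusDen n).eventually_hasSum hα] with q hq
  refine hq.congr_fun fun k => ?_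
  ring

/-- All series converge near points of V by analyticity, and sums are unique, so the existential
expansion amounts to equality with a closed expression. -/
theorem hasOddExpansion_iff (hn : Odd n) (hl : l ≤ 𝓝 0) (hH : AnalyticOnNhd ℝ H V)
    (hα : AnalyticOnNhd ℝ α V) : HasOddExpansion n V H α l h ↔
      ∀ z ∈ V, ∀ᶠ q in l ×ˢ 𝓝 z, h q.1 q.2 = oddSol n H α q.1 q.2 := by
  have key : ∀ z ∈ V, ∀ᶠ q in l ×ˢ 𝓝 z,
      HasSum (fun k : ℕ => (xLap^[k + 1] H) q.2 / minusDen n (k + 1) * q.1 ^ (k + 1))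
        (lapSeries (oddCoeff n) H q.1 q.2) ∧
      HasSum (fun k : ℕ => (xLap^[k] α) q.2 / plusDen n k * q.1 ^ k)
        (lapSeries (fun k => (plusDen n k)⁻¹) α q.1 q.2) := by
    intro z hz
    refine eventually_prod_of_nhds hl ?_
    filter_upwards [eventually_hasSum_plusDen n (hα z hz),
      (factorialDecay_oddCoeff hn).eventually_hasSum (hH z hz)] with q h1 h2
    refine ⟨?_, h1⟩
    have h3 := (hasSum_nat_add_iff' 1).2 h2
    simp only [Finset.range_one, Finset.sum_singleton, oddCoeff, if_true, zero_mul, sub_zero,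
      Nat.add_eq_zero_iff, one_ne_zero, and_false, if_false] at h3
    refine HasSum.congr_fun (f := _) h3 fun k => ?_
    ring
  constructor
  · intro hE z hz
    filter_upwards [hE z hz, key z hz] with q ⟨A, B, hA, hB, e⟩ ⟨hA', hB'⟩
    rw [e, hA.unique hA', hB.unique hB', oddSol]
  · intro hE z hz
    filter_upwards [hE z hz, key z hz] with q e ⟨hA', hB'⟩
    exact ⟨_, _, hA', hB', e⟩

/-- Subtracting the particular solution with α = 0 reduces the direct implication to the homogeneous
classification. -/
theorem isSolution_iff_of_odd (hn : Odd n) (hV : IsOpen V) (hH : AnalyticOnNhd ℝ H V) :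
    IsSolution n V H h ↔ ∃ α : Z d p → ℝ, AnalyticOnNhd ℝ α V ∧
      HasOddExpansion n V H α (𝓝[>] 0) h := by
  constructor
  · intro hs
    have h0 := isSolution_oddSol hn hH (analyticOnNhd_const (v := (0 : ℝ)))
    obtain ⟨α, hα, he⟩ := (hs.sub hV (contDiffOn_of_analyticOnNhd hH) h0).exists_eq_lapSeries hn.pos hV
    refine ⟨α, hα, (hasOddExpansion_iff hn nhdsWithin_le_nhds hH hα).2 fun z hz => ?_⟩
    filter_upwards [he z hz] with q hq
    rw [oddSol, ← hq, oddSol, lapSeries_zero_right]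
    ring
  · rintro ⟨α, hα, hE⟩
    exact (isSolution_oddSol hn hH hα).congr ((hasOddExpansion_iff hn nhdsWithin_le_nhds hH hα).1 hE)

theorem exists_hasOddExpansion (hn : Odd n) (hH : AnalyticOnNhd ℝ H V)
    (hα : AnalyticOnNhd ℝ α V) : ∃ h, HasOddExpansion n V H α (𝓝[>] 0) h :=
  ⟨_, (hasOddExpansion_iff hn nhdsWithin_le_nhds hH hα).2 fun _ _ => Eventually.of_forall fun _ => rfl⟩

theorem isRhoAnalyticSolution_iff_of_odd (hn : Odd n) (hV : IsOpen V) (hH : AnalyticOnNhd ℝ H V) :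
    IsRhoAnalyticSolution n V H h ↔ HasOddExpansion n V H (fun _ => 0) (𝓝 0) h := by
  have h0 := isRhoAnalyticSolution_oddSeries hn hH
  have e : ∀ q : ℝ × Z d p, oddSol n H (fun _ => 0) q.1 q.2 = lapSeries (oddCoeff n) H q.1 q.2 :=
    fun q => by rw [oddSol, lapSeries_zero_right, mul_zero, add_zero]
  rw [hasOddExpansion_iff hn le_rfl hH analyticOnNhd_const]
  simp only [e, ← nhds_prod_eq]
  exact ⟨fun hs => hs.eventuallyEq hn hV (contDiffOn_of_analyticOnNhd hH) h0, fun hE => h0.congr hE⟩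

theorem lapSeries_evenCoeff (s : ℕ) (H : Z d p → ℝ) (r : ℝ) (z : Z d p) :
    lapSeries (evenCoeff s) H r z =
      ∑ k ∈ Finset.Icc 1 (s - 1), (xLap^[k] H) z / minusDen (2 * s) k * r ^ k := by
  rw [lapSeries, rhoSeries, tsum_eq_sum (s := Finset.Icc 1 (s - 1))]
  · refine Finset.sum_congr rfl fun k hk => ?_
    rw [Finset.mem_Icc] at hk
    rw [evenCoeff, if_neg (by omega)]
    ring
  · intro k hk
    rw [Finset.mem_Icc] at hk
    rw [evenCoeff, if_pos (by omega), zero_mul, zero_mul]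

/-- Interchanging convolution with summation turns the Q-term into the series of c_n Q ∗ Δ^s H, so
it merely shifts α. -/
theorem hasEvenExpansion_iff (hV : IsOpen V) (hl : l ≤ 𝓝 0) (hH : AnalyticOnNhd ℝ H V)
    (hα : AnalyticOnNhd ℝ α V) (hQ : AnalyticConvolvable V Q (xLap^[s] H)) :
    HasEvenExpansion s V H α Q l h ↔ ∀ z ∈ V, ∀ᶠ q in l ×ˢ 𝓝 z, h q.1 q.2 =
      evenSol s H (fun w => α w + cConst s * xConv Q (xLap^[s] H) w) q.1 q.2 := by
  have hf : AnalyticOnNhd ℝ (xLap^[s] H) V := fun z hz => analyticAt_xLap_iterate (hH z hz) s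
  have hG := hQ.analyticOnNhd_xConv hV
  have hit : ∀ k, xLap^[s + k] H = xLap^[k] (xLap^[s] H) := fun k => by
    rw [add_comm, Function.iterate_add_apply]
  have key : ∀ z ∈ V, ∀ᶠ q in l ×ˢ 𝓝 z,
      HasSum (fun k : ℕ => (xLap^[k] α) q.2 / plusDen (2 * s) k * q.1 ^ k)
        (lapSeries (fun k => (plusDen (2 * s) k)⁻¹) α q.1 q.2) ∧
      HasSum (fun k : ℕ => (Real.log q.1 - qConst (2 * s) k) *
        ((xLap^[s + k] H) q.2 / plusDen (2 * s) k) * q.1 ^ k)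
        (logSeries (2 * s) (xLap^[s] H) q.1 q.2) ∧
      (∀ᵐ y, Q (y, q.2.2) ≠ 0 → Summable (fun k : ℕ =>
        (xLap^[s + k] H) (q.2.1 - y, q.2.2) / plusDen (2 * s) k * q.1 ^ k)) ∧
      ConvolutionExistsAt (fun y => Q (y, q.2.2)) (fun y => tailSum s H q.1 (y, q.2.2)) q.2.1
        (ContinuousLinearMap.mul ℝ ℝ) volume ∧
      xConv Q (tailSum s H q.1) q.2 =
        lapSeries (fun k => (plusDen (2 * s) k)⁻¹) (xConv Q (xLap^[s] H)) q.1 q.2 ∧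
      lapSeries (fun k => (plusDen (2 * s) k)⁻¹) (fun w => α w + cConst s * xConv Q (xLap^[s] H) w)
        q.1 q.2 = lapSeries (fun k => (plusDen (2 * s) k)⁻¹) α q.1 q.2 +
        cConst s * lapSeries (fun k => (plusDen (2 * s) k)⁻¹) (xConv Q (xLap^[s] H)) q.1 q.2 := by
    intro z hz
    refine eventually_prod_of_nhds hl ?_
    have hVq : ∀ᶠ q in 𝓝 ((0 : ℝ), z), q.2 ∈ V :=
      (continuous_snd.tendsto ((0 : ℝ), z)).eventually (hV.mem_nhds hz)
    filter_upwards [eventually_hasSum_plusDen (2 * s) (hα z hz),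
      eventually_hasSum_plusDen (2 * s) (hG z hz), eventually_hasSum_plusDen (2 * s) (hf z hz),
      (factorialDecay_qConst (2 * s)).eventually_hasSum (hf z hz),
      hQ.eventually_series hV (contDiffOn_of_analyticOnNhd hf) (2 * s) hz, hVq,
      eventually_hasSum_plusDen (2 * s) ((hα z hz).add (analyticAt_const.mul (hG z hz)))]
      with q h1 h2 h3 h4 h5 hq h6
    refine ⟨h1, ?_, ?_, ?_, ?_, ?_⟩
    · refine HasSum.congr_fun ((h3.mul_left (Real.log q.1)).sub h4) fun k => ?_
      rw [hit]
      ring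
    · simpa only [hit] using h5.1
    · simpa only [ConvolutionExistsAt, tailSum, hit, ContinuousLinearMap.mul_apply'] using h5.2.1
    · rw [← h5.2.2]
      simp only [xConv_eq_integral, convKernel, tailSum, hit]
    · refine h6.unique (HasSum.congr_fun (h1.add (h2.mul_left (cConst s))) fun k => ?_)
      have e1 := xLap_iterate_add (hα _ hq).contDiffAt
        (contDiffAt_const (c := cConst s).mul (hG _ hq).contDiffAt) k
      have e2 := xLap_iterate_const_mul (hG _ hq).contDiffAt (cConst s) k
      simp only [Pi.add_def, Pi.mul_def]
      rw [e1, e2]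
      ring
  constructor
  · intro hE z hz
    filter_upwards [hE z hz, key z hz] with q ⟨B, L, hB, hL, _, _, e⟩ ⟨hB', hL', _, _, e1, e2⟩
    rw [e, hB.unique hB', hL.unique hL', e1, evenSol, e2, lapSeries_evenCoeff]
    ring
  · intro hE z hz
    filter_upwards [hE z hz, key z hz] with q e ⟨hB', hL', h3, h4, e1, e2⟩
    refine ⟨_, _, hB', hL', h3, h4, ?_⟩
    rw [e, e1, evenSol, e2, lapSeries_evenCoeff]
    ring

/-- Since Q only shifts α, the choice Q = 0 represents every solution; conversely any admissible Q
gives an analytic shift. -/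
theorem isSolution_iff_of_even (hs1 : 1 ≤ s) (hV : IsOpen V) (hH : AnalyticOnNhd ℝ H V) :
    IsSolution (2 * s) V H h ↔ ∃ α Q : Z d p → ℝ, AnalyticOnNhd ℝ α V ∧
      AnalyticConvolvable V Q (xLap^[s] H) ∧ HasEvenExpansion s V H α Q (𝓝[>] 0) h := by
  constructor
  · intro hs
    have h0 := isSolution_evenSol hs1 hH (analyticOnNhd_const (v := (0 : ℝ)))
    obtain ⟨α, hα, he⟩ :=
      (hs.sub hV (contDiffOn_of_analyticOnNhd hH) h0).exists_eq_lapSeries (by omega) hV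
    have hQ := analyticConvolvable_zero V (xLap^[s] H)
    refine ⟨α, fun _ => 0, hα, hQ,
      (hasEvenExpansion_iff hV nhdsWithin_le_nhds hH hα hQ).2 fun z hz => ?_⟩
    filter_upwards [he z hz] with q hq
    have e : ((2 * s : ℕ) : ℝ) / 2 = (s : ℕ) := by push_cast; ring
    rw [e, Real.rpow_natCast] at hq
    simp only [xConv_zero_left, mul_zero, add_zero]
    have h1 := lapSeries_zero_right (d := d) (p := p) (fun k => (plusDen (2 * s) k)⁻¹) q.1 q.2
    simp only [evenSol] at hq ⊢
    rw [h1] at hq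
    linarith
  · rintro ⟨α, Q, hα, hQ, hE⟩
    refine (isSolution_evenSol hs1 hH ?_).congr
      ((hasEvenExpansion_iff hV nhdsWithin_le_nhds hH hα hQ).1 hE)
    exact fun z hz => (hα z hz).add (analyticAt_const.mul (hQ.analyticOnNhd_xConv hV z hz))

theorem exists_hasEvenExpansion (hV : IsOpen V) (hl : l ≤ 𝓝 0) (hH : AnalyticOnNhd ℝ H V)
    (hα : AnalyticOnNhd ℝ α V) (hQ : AnalyticConvolvable V Q (xLap^[s] H)) :
    ∃ h, HasEvenExpansion s V H α Q l h :=
  ⟨_, (hasEvenExpansion_iff hV hl hH hα hQ).2 fun _ _ => Eventually.of_forall fun _ => rfl⟩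

theorem isAnalyticSolution_iff_of_even (hs1 : 1 ≤ s) (hV : IsOpen V) (hH : AnalyticOnNhd ℝ H V)
    (h0 : ∀ z ∈ V, (xLap^[s] H) z = 0) :
    IsAnalyticSolution (2 * s) V H h ↔ ∃ α : Z d p → ℝ, AnalyticOnNhd ℝ α V ∧
      HasEvenExpansion s V H α (fun _ => 0) (𝓝 0) h := by
  have hQ := analyticConvolvable_zero V (xLap^[s] H)
  have e : ∀ α : Z d p → ℝ, ∀ z ∈ V, ∀ r : ℝ, evenSol s H α r z = evenAnalyticSol s H α r z := by
    intro α z hz r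
    rw [evenSol, evenAnalyticSol, logSeries, lapSeries_congr hV (α' := fun _ => 0) h0 _ r hz,
      lapSeries_congr hV (α' := fun _ => 0) h0 _ r hz, lapSeries_zero_right, lapSeries_zero_right]
    ring
  have e2 : ∀ α : Z d p → ℝ, AnalyticOnNhd ℝ α V →
      (HasEvenExpansion s V H α (fun _ => 0) (𝓝 0) h ↔
        ∀ z ∈ V, ∀ᶠ q in 𝓝 ((0 : ℝ), z), h q.1 q.2 = evenAnalyticSol s H α q.1 q.2) := by
    intro α hα
    rw [hasEvenExpansion_iff hV le_rfl hH hα hQ]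
    simp only [xConv_zero_left, mul_zero, add_zero, ← nhds_prod_eq]
    refine forall₂_congr fun z hz => eventually_congr ?_
    filter_upwards [(continuous_snd.tendsto ((0 : ℝ), z)).eventually (hV.mem_nhds hz)] with q hq
    rw [e α q.2 hq]
  constructor
  · intro hh
    obtain ⟨α, hα, hE⟩ := hh.exists_eq hs1 hV hH h0
    exact ⟨α, hα, (e2 α hα).2 hE⟩
  · rintro ⟨α, hα, hE⟩
    exact (isAnalyticSolution_evenAnalyticSol hs1 hV hH h0 hα).congr ((e2 α hα).1 hE)

/-- Convergence at one r₀ ≠ 0 bounds |c_k| |r₀|^k, so the series is dominated geometrically for |r|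
< |r₀|/2 and tends to its constant term. -/
theorem eq_zero_of_hasSum_zero {c : ℕ → ℝ} (hc : ∀ᶠ r in 𝓝[≠] (0 : ℝ), HasSum (fun k => c k * r ^ k) 0) :
    c 0 = 0 := by
  obtain ⟨r₀, hr₀, hr₀0⟩ := (hc.and self_mem_nhdsWithin).exists
  have hr0 : 0 < |r₀| := abs_pos.2 hr₀0
  obtain ⟨M, hM⟩ := hr₀.summable.tendsto_atTop_zero.norm.bddAbove_range
  have hM' : ∀ k, |c k| * |r₀| ^ k ≤ M := fun k => by
    have := hM ⟨k, rfl⟩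
    simpa [abs_mul, abs_pow] using this
  have hlim := tendsto_tsum_of_dominated_convergence (𝓕 := 𝓝[≠] (0 : ℝ))
    (bound := fun k : ℕ => M * (1 / 2) ^ k) (f := fun r k => c k * r ^ k)
    (g := fun k => c k * 0 ^ k)
    (summable_geometric_two.mul_left M)
    (fun k => ((continuous_const.mul (continuous_pow k)).tendsto 0).mono_left nhdsWithin_le_nhds)
    (by
      have h1 : ∀ᶠ r in 𝓝[≠] (0 : ℝ), |r| < |r₀| / 2 :=
        nhdsWithin_le_nhds ((continuous_abs.tendsto' 0 0 abs_zero).eventually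
          (gt_mem_nhds (half_pos hr0)))
      filter_upwards [h1] with r hr k
      rw [norm_mul, norm_pow, Real.norm_eq_abs, Real.norm_eq_abs]
      calc |c k| * |r| ^ k ≤ |c k| * (|r₀| / 2) ^ k := by gcongr
        _ = |c k| * |r₀| ^ k * (1 / 2) ^ k := by rw [div_eq_mul_one_div, mul_pow]; ring
        _ ≤ M * (1 / 2) ^ k := by gcongr; exact hM' k)
  rw [tsum_eq_single 0 fun k hk => by simp [hk]] at hlim
  have h2 : Tendsto (fun r => ∑' k, c k * r ^ k) (𝓝[≠] (0 : ℝ)) (𝓝 0) :=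
    tendsto_const_nhds.congr' (by filter_upwards [hc] with r hr using hr.tsum_eq.symm)
  simpa using tendsto_nhds_unique hlim h2

/-- The expansion determines `α`. -/
theorem HasEvenExpansion.eqOn {β : Z d p → ℝ} (h0 : ∀ z ∈ V, (xLap^[s] H) z = 0) (hV : IsOpen V)
    (h1 : HasEvenExpansion s V H α (fun _ => 0) (𝓝 0) h)
    (h2 : HasEvenExpansion s V H β (fun _ => 0) (𝓝 0) h) : EqOn α β V := by
  intro z hz
  have hs : Tendsto (fun r : ℝ => (r, z)) (𝓝[≠] 0) (𝓝 0 ×ˢ 𝓝 z) :=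
    (tendsto_id.mono_left nhdsWithin_le_nhds).prodMk (tendsto_const_nhds)
  have hz0 : ∀ k, (xLap^[s + k] H) z = 0 := fun k => by
    rw [add_comm, Function.iterate_add_apply,
      xLap_iterate_eqOn hV (g := fun _ => 0) (fun w hw => h0 w hw) k hz, xLap_iterate_zero]
  have h3 : (xLap^[0] α) z / plusDen (2 * s) 0 - (xLap^[0] β) z / plusDen (2 * s) 0 = 0 := by
    refine eq_zero_of_hasSum_zero
      (c := fun k => (xLap^[k] α) z / plusDen (2 * s) k - (xLap^[k] β) z / plusDen (2 * s) k) ?_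
    filter_upwards [hs.eventually (h1 z hz), hs.eventually (h2 z hz), self_mem_nhdsWithin]
      with r ⟨B, L, hB, hL, _, _, e⟩ ⟨B', L', hB', hL', _, _, e'⟩ hr
    -- The logarithmic sums vanish with Δ^s H, the polynomial parts coincide, and r^s can be
    -- cancelled as r ≠ 0.
    simp only [hz0, zero_div, mul_zero, zero_mul] at hL hL'
    have hL0 := hL.unique hasSum_zero
    have hL0' := hL'.unique hasSum_zero
    subst hL0 hL0'
    rw [e, xConv_zero_left] at e'
    have hr' : r ^ s ≠ 0 := pow_ne_zero s hr
    have hBB : B = B' := mul_left_cancel₀ hr' (by linarith)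
    have h4 := hB.sub hB'
    rw [hBB, sub_self] at h4
    refine h4.congr_fun fun k => ?_
    ring
  simpa [plusDen_zero, sub_eq_zero] using h3

end Expansions

/-! ### Formal series: the indicial recursion and uniqueness -/

section FormalSeries

variable {d p n : ℕ} {V : Set (Z d p)} {H α : Z d p → ℝ} {a b : FormalSeries d p} {μ : ℝ}
  {C : ℕ → Z d p → ℝ} {i : ℕ}

/-- The coefficients of `ϱ (2 ϱ a'' + (2 - n) a')`. -/
def formalOp (n : ℕ) (a : FormalSeries d p) (m : ℝ) (j : ℕ) (z : Z d p) : ℝ :=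
  m * (2 * m - n) * a m j z + (j + 1) * (4 * m - n) * a m (j + 1) z +
    2 * (j + 1) * (j + 2) * a m (j + 2) z

/-- Multiplied by ϱ, the operator is θ(2θ - n) with θ = ϱ∂. With P(m) = m(2m - n) it keeps the power
of the logarithm with factor P(m), lowers it by one through P'(m) = 4m - n, and by two through P''/2
= 2. -/
theorem isFormalSolution_iff : IsFormalSolution n V H a ↔ IsLogSeries V a ∧
    (∀ r ≤ 0, ∀ j, ∀ z ∈ V, a r j z = 0) ∧ ∀ m j, ∀ z ∈ V,
      formalOp n a m j z = xLap (fun w => formalConst H (m - 1) j w + a (m - 1) j w) z := by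
  have key : ∀ m j z, 2 * formalMulRho (formalDeriv (formalDeriv a)) (m - 1) j z +
      (2 - (n : ℝ)) * formalDeriv a (m - 1) j z = formalOp n a m j z := by
    intro m j z
    simp only [formalMulRho, formalDeriv, formalOp, sub_add_cancel]
    push_cast
    ring_nf
  refine and_congr_right fun _ => and_congr_right fun _ => ⟨fun h m j z hz => ?_, fun h r j z hz => ?_⟩
  · have h1 := h (m - 1) j z hz
    rw [key] at h1
    linarith
  · have h1 := h (r + 1) j z hz
    rw [← key, add_sub_cancel_right] at h1
    linarith

theorem IsFormalSolution.congr (hV : IsOpen V) (hb : IsFormalSolution n V H b)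
    (h : ∀ r j, ∀ z ∈ V, a r j z = b r j z) : IsFormalSolution n V H a := by
  rw [isFormalSolution_iff] at hb ⊢
  obtain ⟨⟨h1, h2, h3⟩, h4, h5⟩ := hb
  refine ⟨⟨fun r j => (h1 r j).congr (h r j), h2.mono ?_, fun r => ?_⟩, fun r hr j z hz => ?_,
    fun m j z hz => ?_⟩
  · rintro r ⟨j, z, hz, hne⟩
    exact ⟨j, z, hz, by rwa [← h r j z hz]⟩
  · obtain ⟨J, hJ⟩ := h3 r
    exact ⟨J, fun j hj z hz => (h r j z hz).trans (hJ j hj z hz)⟩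
  · rw [h r j z hz, h4 r hr j z hz]
  · rw [xLap_eqOn hV (g := fun w => formalConst H (m - 1) j w + b (m - 1) j w)
      (fun w hw => by simp only [h _ _ w hw]) hz, ← h5 m j z hz]
    simp only [formalOp, h _ _ z hz]

/-- A formal solution is determined by its coefficient at `ϱ^(n/2)`. -/
theorem IsFormalSolution.eqOn (hn : 1 ≤ n) (hV : IsOpen V) (ha : IsFormalSolution n V H a)
    (hb : IsFormalSolution n V H b) (h : ∀ z ∈ V, a ((n : ℝ) / 2) 0 z = b ((n : ℝ) / 2) 0 z) :
    ∀ r j, ∀ z ∈ V, a r j z = b r j z := by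
  rw [isFormalSolution_iff] at ha hb
  obtain ⟨⟨-, a2, a3⟩, a4, a5⟩ := ha
  obtain ⟨⟨-, b2, b3⟩, b4, b5⟩ := hb
  set S : Set ℝ := {r | ∃ j, ∃ z ∈ V, a r j z ≠ b r j z} with hS
  have hwf : S.IsWF := by
    refine ((a2.union b2).mono ?_).isWF
    rintro r ⟨j, z, hz, hne⟩
    by_cases h0 : a r j z = 0
    · exact Or.inr ⟨j, z, hz, fun h1 => hne (h0.trans h1.symm)⟩
    · exact Or.inl ⟨j, z, hz, h0⟩
  by_contra! hcon
  obtain ⟨r, j, z, hz, hne⟩ := hcon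
  have hSne : S.Nonempty := ⟨r, j, z, hz, hne⟩
  set m := hwf.min hSne with hm
  obtain ⟨j₁, z₁, hz₁, hne₁⟩ : m ∈ S := hwf.min_mem hSne
  -- By minimality of m the two series agree at m - 1, so their Laplacians contribute equally at
  -- exponent m.
  have hlt : ∀ j, ∀ z ∈ V, a (m - 1) j z = b (m - 1) j z := fun j z hz => by
    by_contra h0
    exact hwf.not_lt_min hSne ⟨j, z, hz, h0⟩ (by linarith)
  have hm0 : 0 < m := by
    by_contra! h0
    exact hne₁ (by rw [a4 m h0 j₁ z₁ hz₁, b4 m h0 j₁ z₁ hz₁])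
  have hop : ∀ j, ∀ z ∈ V, formalOp n a m j z = formalOp n b m j z := fun j z hz => by
    rw [a5 m j z hz, b5 m j z hz]
    exact xLap_eqOn hV (fun w hw => by simp only [hlt j w hw]) hz
  obtain ⟨J, hJ⟩ := a3 m
  obtain ⟨J', hJ'⟩ := b3 m
  have hbase : ∀ j, max J J' ≤ j → a m j z₁ = b m j z₁ := fun j hj => by
    rw [hJ j ((le_max_left _ _).trans hj) z₁ hz₁, hJ' j ((le_max_right _ _).trans hj) z₁ hz₁]
  by_cases h2m : 2 * m = n
  · have hmn : m = (n : ℝ) / 2 := by linarith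
    have hn' : (0 : ℝ) < n := by linarith
    -- At m = n/2 the factor P(m) vanishes and the equation for (log ϱ)^j determines the coefficient
    -- of (log ϱ)^(j+1) through 4m - n = n. Descent from the top logarithm leaves only j = 0, which
    -- is given.
    have key : ∀ i j, max J J' ≤ j + i → a m (j + 1) z₁ = b m (j + 1) z₁ := by
      intro i
      induction i with
      | zero => exact fun j hj => hbase (j + 1) (by omega)
      | succ i ih =>
        intro j hj
        have h1 := ih (j + 1) (by omega)
        have h2 := hop j z₁ hz₁
        simp only [formalOp, h2m, sub_self, mul_zero, zero_mul, zero_add] at h2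
        rw [show j + 2 = j + 1 + 1 by ring, h1] at h2
        have h3 : ((j : ℝ) + 1) * (4 * m - n) ≠ 0 := by
          have : 4 * m - n = n := by linarith
          rw [this]
          positivity
        exact mul_left_cancel₀ h3 (by linarith)
    rcases j₁ with _ | j
    · exact hne₁ (by rw [hmn]; exact h z₁ hz₁)
    · exact hne₁ (key (max J J') j (by omega))
  · have hc : m * (2 * m - n) ≠ 0 := mul_ne_zero hm0.ne' (sub_ne_zero.2 h2m)
    -- Off the resonance P(m) ≠ 0, and the descent in the power of the logarithm reaches j = 0 as
    -- well.
    have key : ∀ i j, max J J' ≤ j + i → a m j z₁ = b m j z₁ := by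
      intro i
      induction i with
      | zero => exact fun j hj => hbase j (by omega)
      | succ i ih =>
        intro j hj
        have h2 := hop j z₁ hz₁
        simp only [formalOp] at h2
        rw [ih (j + 1) (by omega), ih (j + 2) (by omega)] at h2
        exact mul_left_cancel₀ hc (by linarith)
    exact hne₁ (key (max J J') j₁ (by omega))

theorem powerSeriesAt_apply (μ : ℝ) (i : ℕ) (C : ℕ → Z d p → ℝ) (k : ℕ) :
    powerSeriesAt μ i C (μ + k) i = C k := by
  funext z
  simp [powerSeriesAt]

theorem powerSeriesAt_of_ne {r : ℝ} (hr : ∀ k : ℕ, r ≠ μ + k) (j : ℕ) :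
    powerSeriesAt μ i C r j = fun _ => 0 := by
  funext z
  rw [powerSeriesAt, if_neg]
  rintro ⟨-, k, hk⟩
  exact hr k hk

theorem powerSeriesAt_of_log_ne {j : ℕ} (hj : j ≠ i) (r : ℝ) :
    powerSeriesAt μ i C r j = fun _ => 0 := by
  funext z
  rw [powerSeriesAt, if_neg fun h => hj h.1]

theorem isPWO_range_add_natCast (μ : ℝ) : (range fun k : ℕ => μ + k).IsPWO := by
  rw [← image_univ]
  exact (Set.IsWF.isPWO wellFounded_lt.wellFoundedOn).image_of_monotone
    fun a b hab => by simpa using hab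

theorem isLogSeries_powerSeriesAt (μ : ℝ) (i : ℕ) (hC : ∀ k, ContDiffOn ℝ ∞ (C k) V) :
    IsLogSeries V (powerSeriesAt μ i C) := by
  refine ⟨fun r j => ?_, (isPWO_range_add_natCast μ).mono ?_, fun r => ⟨i + 1, fun j hj z _ => ?_⟩⟩
  · by_cases hj : j = i
    · by_cases hr : ∃ k : ℕ, r = μ + k
      · obtain ⟨k, rfl⟩ := hr
        rw [hj, powerSeriesAt_apply]
        exact hC k
      · rw [powerSeriesAt_of_ne (not_exists.1 hr)]
        exact contDiffOn_const
    · rw [powerSeriesAt_of_log_ne hj]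
      exact contDiffOn_const
  · rintro r ⟨j, z, -, hne⟩
    by_contra hr
    refine hne ?_
    rw [powerSeriesAt_of_ne fun k hk => hr ⟨k, hk.symm⟩]
  · rw [powerSeriesAt_of_log_ne (by omega)]

theorem IsLogSeries.add (ha : IsLogSeries V a) (hb : IsLogSeries V b) : IsLogSeries V (a + b) := by
  refine ⟨fun r j => (ha.1 r j).add (hb.1 r j), (ha.2.1.union hb.2.1).mono ?_, fun r => ?_⟩
  · rintro r ⟨j, z, hz, hne⟩
    by_cases h0 : a r j z = 0
    · refine Or.inr ⟨j, z, hz, fun h1 => hne ?_⟩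
      simp [h0, h1]
    · exact Or.inl ⟨j, z, hz, h0⟩
  · obtain ⟨J, hJ⟩ := ha.2.2 r
    obtain ⟨J', hJ'⟩ := hb.2.2 r
    refine ⟨max J J', fun j hj z hz => ?_⟩
    simp [hJ j ((le_max_left _ _).trans hj) z hz, hJ' j ((le_max_right _ _).trans hj) z hz]

theorem powerSeriesAt_of_nonpos (hμ : 0 < μ) {r : ℝ} (hr : r ≤ 0) (j : ℕ) (z : Z d p) :
    powerSeriesAt μ i C r j z = 0 := by
  rw [powerSeriesAt_of_ne fun k hk => ?_]
  have : (0 : ℝ) ≤ k := Nat.cast_nonneg k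
  linarith

/-- The coefficients of `ϱ (2 ϱ a'' + (2 - n) a' - Δ a)`. -/
def formalRes (n : ℕ) (a : FormalSeries d p) (m : ℝ) (j : ℕ) (z : Z d p) : ℝ :=
  formalOp n a m j z - xLap (a (m - 1) j) z

theorem formalRes_add {z : Z d p} {m : ℝ} {j : ℕ} (ha : ContDiffAt ℝ 2 (a (m - 1) j) z)
    (hb : ContDiffAt ℝ 2 (b (m - 1) j) z) :
    formalRes n (a + b) m j z = formalRes n a m j z + formalRes n b m j z := by
  have h := xLap_add ha hb
  change xLap ((a + b) (m - 1) j) z = _ at h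
  rw [formalRes, h, formalRes, formalRes]
  simp only [formalOp, Pi.add_apply]
  ring

theorem powerSeriesAt_sub_one_zero (μ : ℝ) (i : ℕ) (C : ℕ → Z d p → ℝ) :
    powerSeriesAt μ i C (μ + (0 : ℕ) - 1) i = fun _ => 0 :=
  powerSeriesAt_of_ne (fun k hk => by
    have : (0 : ℝ) ≤ k := Nat.cast_nonneg k
    push_cast at hk
    linarith) i

theorem powerSeriesAt_sub_one_succ (μ : ℝ) (i : ℕ) (C : ℕ → Z d p → ℝ) (k : ℕ) :
    powerSeriesAt μ i C (μ + (k + 1 : ℕ) - 1) i = C k := by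
  have h : μ + (k + 1 : ℕ) - 1 = μ + k := by push_cast; ring
  rw [h, powerSeriesAt_apply]

theorem ne_add_natCast_sub_one {m : ℝ} (hm : ∀ k : ℕ, m ≠ μ + k) (k : ℕ) : m - 1 ≠ μ + k :=
  fun h => hm (k + 1) (by push_cast; linarith)

/-- The coefficients of `ϱ ∑ ϱ^k Δ C_k`. -/
def lapShift (C : ℕ → Z d p → ℝ) : ℕ → Z d p → ℝ
  | 0 => fun _ => 0
  | k + 1 => xLap (C k)

/-- `formalRes` of a series without logarithms. -/
theorem formalRes_powerSeriesAt_zero (n : ℕ) (μ : ℝ) (C : ℕ → Z d p → ℝ) (m : ℝ) (j : ℕ)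
    (z : Z d p) : formalRes n (powerSeriesAt μ 0 C) m j z =
      powerSeriesAt μ 0 (fun k z => (μ + k) * (2 * (μ + k) - n) * C k z -
        lapShift C k z) m j z := by
  have hne : ∀ j, j + 1 ≠ 0 := fun j => Nat.succ_ne_zero j
  rcases j with _ | j
  · by_cases hm : ∃ k : ℕ, m = μ + k
    · obtain ⟨k, rfl⟩ := hm
      rw [powerSeriesAt_apply]
      simp only [formalRes, formalOp, powerSeriesAt_apply, powerSeriesAt_of_log_ne (hne _)]
      rcases k with _ | k
      · rw [powerSeriesAt_sub_one_zero, xLap_zero, lapShift]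
        ring
      · rw [powerSeriesAt_sub_one_succ, lapShift]
        ring
    · rw [not_exists] at hm
      simp only [formalRes, formalOp, powerSeriesAt_of_ne hm,
        powerSeriesAt_of_ne (ne_add_natCast_sub_one hm), xLap_zero]
      ring
  · simp only [formalRes, formalOp, powerSeriesAt_of_log_ne (hne _), xLap_zero]
    ring

/-- `formalRes` of a series with one logarithm. -/
theorem formalRes_powerSeriesAt_one (n : ℕ) (μ : ℝ) (C : ℕ → Z d p → ℝ) (m : ℝ) (j : ℕ)
    (z : Z d p) : formalRes n (powerSeriesAt μ 1 C) m j z =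
      powerSeriesAt μ 1 (fun k z => (μ + k) * (2 * (μ + k) - n) * C k z -
        lapShift C k z) m j z +
      powerSeriesAt μ 0 (fun k z => (4 * (μ + k) - n) * C k z) m j z := by
  have h01 : (0 : ℕ) ≠ 1 := by omega
  have h21 : (2 : ℕ) ≠ 1 := by omega
  have h10 : (1 : ℕ) ≠ 0 := by omega
  by_cases hm : ∃ k : ℕ, m = μ + k
  · obtain ⟨k, rfl⟩ := hm
    rcases j with _ | _ | j
    · simp only [formalRes, formalOp, powerSeriesAt_apply, powerSeriesAt_of_log_ne h01,
        powerSeriesAt_of_log_ne h21, xLap_zero, zero_add]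
      push_cast
      ring
    · simp only [formalRes, formalOp, zero_add, powerSeriesAt_apply, powerSeriesAt_of_log_ne h10,
        powerSeriesAt_of_log_ne (show 1 + 1 ≠ 1 by omega),
        powerSeriesAt_of_log_ne (show 1 + 2 ≠ 1 by omega)]
      rcases k with _ | k
      · rw [powerSeriesAt_sub_one_zero, xLap_zero, lapShift]
        ring
      · rw [powerSeriesAt_sub_one_succ, lapShift]
        ring
    · simp only [formalRes, formalOp, powerSeriesAt_of_log_ne (show j + 1 + 1 ≠ 1 by omega),
        powerSeriesAt_of_log_ne (show j + 1 + 1 + 1 ≠ 1 by omega),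
        powerSeriesAt_of_log_ne (show j + 1 + 1 + 2 ≠ 1 by omega),
        powerSeriesAt_of_log_ne (show j + 1 + 1 ≠ 0 by omega), xLap_zero]
      ring
  · rw [not_exists] at hm
    simp only [formalRes, formalOp, powerSeriesAt_of_ne hm,
      powerSeriesAt_of_ne (ne_add_natCast_sub_one hm), xLap_zero]
    ring

theorem powerSeriesAt_eq_zero {z : Z d p} (hC : ∀ k, C k z = 0) (r : ℝ) (j : ℕ) :
    powerSeriesAt μ i C r j z = 0 := by
  unfold powerSeriesAt
  split_ifs
  · exact hC _
  · rfl

theorem powerSeriesAt_congr {C' : ℕ → Z d p → ℝ} {z : Z d p} (hC : ∀ k, C k z = C' k z) (r : ℝ)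
    (j : ℕ) : powerSeriesAt μ i C r j z = powerSeriesAt μ i C' r j z := by
  unfold powerSeriesAt
  split_ifs
  · exact hC _
  · rfl

theorem powerSeriesAt_add {C' : ℕ → Z d p → ℝ} (r : ℝ) (j : ℕ) (z : Z d p) :
    powerSeriesAt μ i C r j z + powerSeriesAt μ i C' r j z =
      powerSeriesAt μ i (fun k z => C k z + C' k z) r j z := by
  unfold powerSeriesAt
  split_ifs
  · rfl
  · exact add_zero 0

open Classical in
theorem powerSeriesAt_single (k₀ : ℕ) {z : Z d p} (hC : ∀ k, k ≠ k₀ → C k z = 0) (r : ℝ) (j : ℕ) :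
    powerSeriesAt μ i C r j z = if r = μ + k₀ ∧ j = i then C k₀ z else 0 := by
  by_cases hj : j = i
  · by_cases hr : ∃ k : ℕ, r = μ + k
    · obtain ⟨k, rfl⟩ := hr
      rw [hj, powerSeriesAt_apply]
      by_cases hk : k = k₀
      · simp [hk]
      · rw [hC k hk, if_neg]
        rintro ⟨h, -⟩
        exact hk (by exact_mod_cast add_left_cancel h)
    · rw [powerSeriesAt_of_ne (not_exists.1 hr), if_neg]
      rintro ⟨h, -⟩
      exact hr ⟨_, h⟩
  · rw [powerSeriesAt_of_log_ne hj, if_neg fun h => hj h.2]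

open Classical in
theorem xLap_formalConst_sub_one (H : Z d p → ℝ) (m : ℝ) (j : ℕ) (z : Z d p) :
    xLap (formalConst H (m - 1) j) z = if m = 1 ∧ j = 0 then xLap H z else 0 := by
  have e : formalConst H (m - 1) j = if m = 1 ∧ j = 0 then H else fun _ => 0 := by
    funext w
    simp only [formalConst, sub_eq_zero]
    split_ifs <;> rfl
  rw [e]
  split_ifs
  · rfl
  · rw [xLap_zero]

open Classical in
theorem isFormalSolution_of_formalRes (hV : IsOpen V) (hH : ContDiffOn ℝ ∞ H V)
    (ha : IsLogSeries V a) (h0 : ∀ r ≤ 0, ∀ j, ∀ z ∈ V, a r j z = 0)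
    (h : ∀ m j, ∀ z ∈ V, formalRes n a m j z = if m = 1 ∧ j = 0 then xLap H z else 0) :
    IsFormalSolution n V H a := by
  refine isFormalSolution_iff.2 ⟨ha, h0, fun m j z hz => ?_⟩
  have h1 : ContDiffAt ℝ 2 (formalConst H (m - 1) j) z := by
    have e : formalConst H (m - 1) j = if m - 1 = 0 ∧ j = 0 then H else fun _ => 0 := by
      funext w
      simp only [formalConst]
      split_ifs <;> rfl
    rw [e]
    split_ifs
    · exact (hH.contDiffAt (hV.mem_nhds hz)).of_le two_le_infty
    · exact contDiffAt_const
  have h2 : ContDiffAt ℝ 2 (a (m - 1) j) z :=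
    ((ha.1 (m - 1) j).contDiffAt (hV.mem_nhds hz)).of_le two_le_infty
  rw [xLap_add h1 h2, xLap_formalConst_sub_one, ← h m j z hz, formalRes]
  ring

end FormalSeries

/-! ### Explicit formal solutions -/

section ExplicitFormalSolutions

variable {d p n s : ℕ} {V : Set (Z d p)} {H α β Q : Z d p → ℝ} {a : FormalSeries d p}

/-- The formal series `∑ c_k Δ^k β ϱ^(μ + k) (log ϱ)^i`. -/
def lapFormal (μ : ℝ) (i : ℕ) (c : ℕ → ℝ) (β : Z d p → ℝ) : FormalSeries d p :=
  powerSeriesAt μ i fun k z => c k * xLap^[k] β z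

/-- The recursion that is solved by the coefficients of formal solutions. -/
def recRes (n : ℕ) (μ : ℝ) (c : ℕ → ℝ) (k : ℕ) : ℝ :=
  (μ + k) * (2 * (μ + k) - n) * c k - if k = 0 then 0 else c (k - 1)

theorem contDiffOn_lapFormal_coeff (hV : IsOpen V) (hβ : ContDiffOn ℝ ∞ β V) (c : ℕ → ℝ) (k : ℕ) :
    ContDiffOn ℝ ∞ (fun z => c k * xLap^[k] β z) V := fun _ hz =>
  (contDiffAt_const.mul (contDiffAt_xLap_iterate (hβ.contDiffAt (hV.mem_nhds hz)) k)).contDiffWithinAt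

theorem isLogSeries_lapFormal (hV : IsOpen V) (hβ : ContDiffOn ℝ ∞ β V) (μ : ℝ) (i : ℕ)
    (c : ℕ → ℝ) : IsLogSeries V (lapFormal μ i c β) :=
  isLogSeries_powerSeriesAt μ i (contDiffOn_lapFormal_coeff hV hβ c)

theorem lapShift_coeff (hV : IsOpen V) (hβ : ContDiffOn ℝ ∞ β V) (c : ℕ → ℝ) (k : ℕ) {z : Z d p}
    (hz : z ∈ V) : lapShift (fun k z => c k * xLap^[k] β z) k z =
      (if k = 0 then 0 else c (k - 1)) * xLap^[k] β z := by
  rcases k with _ | k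
  · simp [lapShift]
  · rw [lapShift, xLap_const_mul ((contDiffAt_xLap_iterate
      (hβ.contDiffAt (hV.mem_nhds hz)) k).of_le two_le_infty), ← Function.iterate_succ_apply' xLap]
    simp

theorem formalRes_lapFormal_zero (hV : IsOpen V) (hβ : ContDiffOn ℝ ∞ β V) (μ : ℝ) (c : ℕ → ℝ)
    (m : ℝ) (j : ℕ) {z : Z d p} (hz : z ∈ V) : formalRes n (lapFormal μ 0 c β) m j z =
      lapFormal μ 0 (recRes n μ c) β m j z := by
  rw [lapFormal, formalRes_powerSeriesAt_zero]
  refine powerSeriesAt_congr (fun k => ?_) m j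
  rw [lapShift_coeff hV hβ c k hz, recRes]
  ring

theorem formalRes_lapFormal_one (hV : IsOpen V) (hβ : ContDiffOn ℝ ∞ β V) (μ : ℝ) (c : ℕ → ℝ)
    (m : ℝ) (j : ℕ) {z : Z d p} (hz : z ∈ V) : formalRes n (lapFormal μ 1 c β) m j z =
      lapFormal μ 1 (recRes n μ c) β m j z +
        lapFormal μ 0 (fun k => (4 * (μ + k) - n) * c k) β m j z := by
  rw [lapFormal, formalRes_powerSeriesAt_one]
  refine congrArg₂ (· + ·) (powerSeriesAt_congr (fun k => ?_) m j)
    (powerSeriesAt_congr (fun k => ?_) m j)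
  · rw [lapShift_coeff hV hβ c k hz, recRes]
    ring
  · ring

theorem recRes_const_mul (n : ℕ) (μ b : ℝ) (c : ℕ → ℝ) (k : ℕ) :
    recRes n μ (fun k => b * c k) k = b * recRes n μ c k := by
  unfold recRes
  split_ifs <;> ring

theorem recRes_factor {μ : ℝ} (hμ : 2 * μ = n) (k : ℕ) :
    (μ + ((k : ℝ) + 1)) * (2 * (μ + (k + 1)) - n) = (k + 1) * (2 * (k + 1) + n) := by
  rw [← hμ]
  ring

theorem recRes_plusDen {μ : ℝ} (hμ : 2 * μ = n) (k : ℕ) :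
    recRes n μ (fun k => (plusDen n k)⁻¹) k = 0 := by
  rcases k with _ | k
  · simp [recRes, hμ]
  · have h1 := plusDen_pos n k
    have h2 : (0 : ℝ) < (k + 1) * (2 * (k + 1) + n) := by positivity
    rw [recRes, if_neg (Nat.succ_ne_zero k), Nat.add_sub_cancel, plusDen_succ]
    push_cast
    rw [recRes_factor hμ k]
    field_simp
    ring

/-- Formal counterpart of `eventually_logSeries`: the term from differentiating the logarithm and
the q-series cancel, except for n at k = 0. -/
theorem recRes_qConst {μ : ℝ} (hμ : 2 * μ = n) (k : ℕ) :
    (4 * (μ + k) - n) * (plusDen n k)⁻¹ +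
      recRes n μ (fun k => -qConst n k * (plusDen n k)⁻¹) k = if k = 0 then (n : ℝ) else 0 := by
  rcases k with _ | k
  · simp only [recRes, qConst_zero, plusDen_zero, if_true]
    push_cast
    linarith
  · have h1 := plusDen_pos n k
    have h2 : (0 : ℝ) < (k + 1) * (2 * (k + 1) + n) := by positivity
    have h3 : (0 : ℝ) < (n : ℝ) + 2 * (k + 1) := by positivity
    rw [recRes, if_neg (Nat.succ_ne_zero k), if_neg (Nat.succ_ne_zero k), Nat.add_sub_cancel,
      plusDen_succ, qConst_succ]
    push_cast
    have h4 : 4 * (μ + ((k : ℝ) + 1)) - n = n + 4 * (k + 1) := by rw [← hμ]; ring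
    rw [recRes_factor hμ k, h4, add_comm (2 * ((k : ℝ) + 1))]
    field_simp
    ring

theorem recRes_minusDen (hn : Odd n) (k : ℕ) :
    recRes n 1 (fun k => (minusDen n (k + 1))⁻¹) k = if k = 0 then 1 else 0 := by
  have h0 : ∀ k, minusDen n k ≠ 0 := fun k => minusDen_ne_zero fun i _ _ h => by
    obtain ⟨m, rfl⟩ := hn
    omega
  have h1 : (2 * ((k : ℝ) + 1) - n) ≠ 0 := by
    have := two_mul_sub_ne_zero_of_odd hn k
    intro h
    exact this (by linarith)
  have h2 : ((k : ℝ) + 1) ≠ 0 := by positivity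
  have h3 := h0 k
  have key : (1 + (k : ℝ)) * (2 * (1 + k) - n) * (minusDen n (k + 1))⁻¹ = (minusDen n k)⁻¹ := by
    rw [minusDen_succ, add_comm (1 : ℝ), mul_inv, mul_comm (minusDen n k)⁻¹,
      mul_inv_cancel_left₀ (mul_ne_zero h2 h1)]
  rw [recRes, key]
  rcases k with _ | k
  · simp [minusDen_zero]
  · simp

/-- This is `evenCoeff_recursion` for a series starting at ϱ^1; the default 0 before its first
coefficient matches `evenCoeff s 0 = 0`. -/
theorem recRes_evenCoeff (hs : 1 ≤ s) (k : ℕ) :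
    recRes (2 * s) 1 (fun k => evenCoeff s (k + 1)) k =
      (if k = 0 then 1 else 0) - if k = s - 1 then (minusDen (2 * s) (s - 1))⁻¹ else 0 := by
  rw [← evenCoeff_recursion hs k, recRes]
  rcases k with _ | k
  · simp only [if_true, evenCoeff]
    push_cast
    simp
  · rw [if_neg (Nat.succ_ne_zero k), Nat.add_sub_cancel]
    push_cast
    ring

theorem lapFormal_of_nonpos {μ : ℝ} (hμ : 0 < μ) {i : ℕ} {c : ℕ → ℝ} {r : ℝ} (hr : r ≤ 0) (j : ℕ)
    (z : Z d p) : lapFormal μ i c β r j z = 0 :=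
  powerSeriesAt_of_nonpos hμ hr j z

theorem lapFormal_eq_zero {c : ℕ → ℝ} (hc : ∀ k, c k = 0) (μ : ℝ) (i : ℕ) (r : ℝ) (j : ℕ)
    (z : Z d p) : lapFormal μ i c β r j z = 0 :=
  powerSeriesAt_eq_zero (fun k => by rw [hc, zero_mul]) r j

open Classical in
theorem lapFormal_single (μ : ℝ) (i k₀ : ℕ) (b : ℝ) (r : ℝ) (j : ℕ) (z : Z d p) :
    lapFormal μ i (fun k => if k = k₀ then b else 0) β r j z =
      if r = μ + k₀ ∧ j = i then b * xLap^[k₀] β z else 0 := by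
  rw [lapFormal, powerSeriesAt_single k₀ fun k hk => by rw [if_neg hk, zero_mul]]
  simp

theorem lapFormal_add (μ : ℝ) (i : ℕ) (c c' : ℕ → ℝ) (r : ℝ) (j : ℕ) (z : Z d p) :
    lapFormal μ i c β r j z + lapFormal μ i c' β r j z =
      lapFormal μ i (fun k => c k + c' k) β r j z := by
  rw [lapFormal, lapFormal, powerSeriesAt_add]
  exact powerSeriesAt_congr (fun k => by ring) r j

theorem lapFormal_congr {c c' : ℕ → ℝ} (h : ∀ k, c k = c' k) (μ : ℝ) (i : ℕ) :
    lapFormal μ i c β = lapFormal μ i c' β := by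
  rw [funext h]

theorem contDiffOn_xLap (hV : IsOpen V) (hH : ContDiffOn ℝ ∞ H V) : ContDiffOn ℝ ∞ (xLap H) V :=
  fun _ hz => (contDiffAt_xLap (hH.contDiffAt (hV.mem_nhds hz))).contDiffWithinAt

theorem contDiffOn_xLap_iterate (hV : IsOpen V) (hH : ContDiffOn ℝ ∞ H V) (k : ℕ) :
    ContDiffOn ℝ ∞ (xLap^[k] H) V :=
  fun _ hz => (contDiffAt_xLap_iterate (hH.contDiffAt (hV.mem_nhds hz)) k).contDiffWithinAt

theorem oddFormal_eq (n : ℕ) (H α : Z d p → ℝ) : oddFormal n H α =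
    lapFormal 1 0 (fun k => (minusDen n (k + 1))⁻¹) (xLap H) +
      lapFormal ((n : ℝ) / 2) 0 (fun k => (plusDen n k)⁻¹) α := by
  simp only [oddFormal, lapFormal, div_eq_inv_mul (xLap^[_] _ _), Function.iterate_succ_apply]

theorem IsLogSeries.contDiffAt {V : Set (Z d p)} (ha : IsLogSeries V a) (hV : IsOpen V) {z : Z d p}
    (hz : z ∈ V) (r : ℝ) (j : ℕ) : ContDiffAt ℝ 2 (a r j) z :=
  ((ha.1 r j).contDiffAt (hV.mem_nhds hz)).of_le two_le_infty

theorem isFormalSolution_oddFormal (hn : Odd n) (hV : IsOpen V) (hH : ContDiffOn ℝ ∞ H V)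
    (hα : ContDiffOn ℝ ∞ α V) : IsFormalSolution n V H (oddFormal n H α) := by
  classical
  have hn0 : (0 : ℝ) < (n : ℝ) / 2 := by
    have : (0 : ℝ) < n := by exact_mod_cast hn.pos
    positivity
  have hH1 := contDiffOn_xLap hV hH
  rw [oddFormal_eq]
  have l1 := isLogSeries_lapFormal hV hH1 1 0 fun k => (minusDen n (k + 1))⁻¹
  have l2 := isLogSeries_lapFormal hV hα ((n : ℝ) / 2) 0 fun k => (plusDen n k)⁻¹
  refine isFormalSolution_of_formalRes hV hH (l1.add l2) (fun r hr j _ _ => ?_) fun m j z hz => ?_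
  · simp [lapFormal_of_nonpos one_pos hr, lapFormal_of_nonpos hn0 hr]
  · rw [formalRes_add (l1.contDiffAt hV hz _ _) (l2.contDiffAt hV hz _ _),
      formalRes_lapFormal_zero hV hH1 _ _ _ _ hz, formalRes_lapFormal_zero hV hα _ _ _ _ hz,
      lapFormal_congr (recRes_minusDen hn), lapFormal_single,
      lapFormal_eq_zero (recRes_plusDen (by ring))]
    simp

theorem isFormalSolution_iff_of_odd (hn : Odd n) (hV : IsOpen V) (hH : ContDiffOn ℝ ∞ H V) :
    IsFormalSolution n V H a ↔ ∃ α : Z d p → ℝ, ContDiffOn ℝ ∞ α V ∧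
      ∀ r j, ∀ z ∈ V, a r j z = oddFormal n H α r j z := by
  constructor
  · intro ha
    have hα : ContDiffOn ℝ ∞ (a ((n : ℝ) / 2) 0) V := ha.1.1 _ _
    refine ⟨_, hα, ha.eqOn hn.pos hV (isFormalSolution_oddFormal hn hV hH hα) fun z _ => ?_⟩
    -- For odd n the exponent n/2 is not an integer, so the H-series does not contribute there and α
    -- is read off directly.
    have h1 : lapFormal 1 0 (fun k => (minusDen n (k + 1))⁻¹) (xLap H) ((n : ℝ) / 2) 0 =
        fun _ => 0 := powerSeriesAt_of_ne (fun k hk => by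
      have h2 : (n : ℝ) = (2 * (1 + k) : ℕ) := by push_cast; linarith
      have h3 : n = 2 * (1 + k) := by exact_mod_cast h2
      exact Nat.not_even_iff_odd.2 hn ⟨1 + k, by omega⟩) 0
    have h2 := congrFun (powerSeriesAt_apply ((n : ℝ) / 2) 0
      (fun k z => (plusDen n k)⁻¹ * xLap^[k] (a ((n : ℝ) / 2) 0) z) 0) z
    simp only [Nat.cast_zero, add_zero] at h2
    rw [oddFormal_eq, Pi.add_apply, Pi.add_apply, Pi.add_apply, h1, lapFormal, h2, plusDen_zero]
    simp
  · rintro ⟨α, hα, h⟩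
    exact (isFormalSolution_oddFormal hn hV hH hα).congr hV h

/-- The formal solutions for `n = 2s`. -/
def evenLapFormal (s : ℕ) (H α : Z d p → ℝ) : FormalSeries d p :=
  lapFormal 1 0 (fun k => evenCoeff s (k + 1)) (xLap H) +
    lapFormal s 0 (fun k => (plusDen (2 * s) k)⁻¹) α +
    lapFormal s 1 (fun k => cConst s * (plusDen (2 * s) k)⁻¹) (xLap^[s] H) +
    lapFormal s 0 (fun k => cConst s * (-qConst (2 * s) k * (plusDen (2 * s) k)⁻¹)) (xLap^[s] H)

theorem isFormalSolution_evenLapFormal (hs : 1 ≤ s) (hV : IsOpen V) (hH : ContDiffOn ℝ ∞ H V)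
    (hα : ContDiffOn ℝ ∞ α V) : IsFormalSolution (2 * s) V H (evenLapFormal s H α) := by
  classical
  have hs0 : (0 : ℝ) < s := by exact_mod_cast hs
  have h2s : 2 * (s : ℝ) = (2 * s : ℕ) := by push_cast; ring
  have hH1 := contDiffOn_xLap hV hH
  have hHs := contDiffOn_xLap_iterate hV hH s
  have l1 := isLogSeries_lapFormal hV hH1 1 0 fun k => evenCoeff s (k + 1)
  have l2 := isLogSeries_lapFormal hV hα s 0 fun k => (plusDen (2 * s) k)⁻¹
  have l3 := isLogSeries_lapFormal hV hHs s 1 fun k => cConst s * (plusDen (2 * s) k)⁻¹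
  have l4 := isLogSeries_lapFormal hV hHs s 0
    fun k => cConst s * (-qConst (2 * s) k * (plusDen (2 * s) k)⁻¹)
  have l12 := l1.add l2
  have l123 := l12.add l3
  refine isFormalSolution_of_formalRes hV hH (l123.add l4) (fun r hr j _ _ => ?_) fun m j z hz => ?_
  · simp [evenLapFormal, lapFormal_of_nonpos one_pos hr, lapFormal_of_nonpos hs0 hr]
  -- The truncated polynomial yields the required source ΔH at exponent 1 and an unwanted term at
  -- exponent s.
  · have e1 : lapFormal 1 0 (recRes (2 * s) 1 fun k => evenCoeff s (k + 1)) (xLap H) m j z =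
        (if m = 1 ∧ j = 0 then xLap H z else 0) +
          if m = s ∧ j = 0 then -(minusDen (2 * s) (s - 1))⁻¹ * xLap^[s] H z else 0 := by
      have h1 : ∀ k, recRes (2 * s) 1 (fun k => evenCoeff s (k + 1)) k =
          (if k = 0 then 1 else 0) + if k = s - 1 then -(minusDen (2 * s) (s - 1))⁻¹ else 0 :=
        fun k => by rw [recRes_evenCoeff hs]; split_ifs <;> ring
      have h2 : (1 : ℝ) + (s - 1 : ℕ) = s := by rw [Nat.cast_sub hs]; push_cast; ring
      have h3 : xLap^[s - 1] (xLap H) z = xLap^[s] H z := by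
        rw [← Function.iterate_succ_apply, Nat.succ_eq_add_one, Nat.sub_add_cancel hs]
      rw [lapFormal_congr h1, ← lapFormal_add, lapFormal_single, lapFormal_single, h2,
        h3]
      simp
    -- The logarithmic series and the q-series leave, at exponent s only, c_n n Δ^s H, which cancels
    -- that unwanted term.
    have e34 : lapFormal s 0 (fun k => (4 * ((s : ℝ) + k) - (2 * s : ℕ)) *
          (cConst s * (plusDen (2 * s) k)⁻¹)) (xLap^[s] H) m j z +
        lapFormal s 0 (recRes (2 * s) s fun k => cConst s * (-qConst (2 * s) k *
          (plusDen (2 * s) k)⁻¹)) (xLap^[s] H) m j z =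
        if m = s ∧ j = 0 then (minusDen (2 * s) (s - 1))⁻¹ * xLap^[s] H z else 0 := by
      have h1 : ∀ k, (4 * ((s : ℝ) + k) - (2 * s : ℕ)) * (cConst s * (plusDen (2 * s) k)⁻¹) +
          recRes (2 * s) s (fun k => cConst s * (-qConst (2 * s) k * (plusDen (2 * s) k)⁻¹)) k =
          if k = 0 then (minusDen (2 * s) (s - 1))⁻¹ else 0 := fun k => by
        rw [recRes_const_mul, mul_left_comm, ← mul_add, recRes_qConst h2s, ← cConst_mul hs]
        split_ifs <;> ring
      rw [lapFormal_add, lapFormal_congr h1, lapFormal_single]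
      simp
    have e3 : ∀ k, recRes (2 * s) s (fun k => cConst s * (plusDen (2 * s) k)⁻¹) k = 0 := fun k => by
      rw [recRes_const_mul, recRes_plusDen h2s, mul_zero]
    rw [evenLapFormal, formalRes_add (l123.contDiffAt hV hz _ _) (l4.contDiffAt hV hz _ _),
      formalRes_add (l12.contDiffAt hV hz _ _) (l3.contDiffAt hV hz _ _),
      formalRes_add (l1.contDiffAt hV hz _ _) (l2.contDiffAt hV hz _ _),
      formalRes_lapFormal_zero hV hH1 _ _ _ _ hz, formalRes_lapFormal_zero hV hα _ _ _ _ hz,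
      formalRes_lapFormal_one hV hHs _ _ _ _ hz, formalRes_lapFormal_zero hV hHs _ _ _ _ hz,
      lapFormal_eq_zero (recRes_plusDen h2s), lapFormal_eq_zero e3, e1]
    rw [add_zero, zero_add, add_assoc, e34]
    split_ifs <;> ring

theorem evenFormal_eq (hV : IsOpen V) (hH : ContDiffOn ℝ ∞ H V) (hα : ContDiffOn ℝ ∞ α V)
    (hQ : SmoothConvolvable V Q (xLap^[s] H)) (r : ℝ) (j : ℕ) {z : Z d p} (hz : z ∈ V) :
    evenFormal s H α Q r j z =
      evenLapFormal s H (fun w => α w + cConst s * xConv Q (xLap^[s] H) w) r j z := by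
  have hit : ∀ k, xLap^[s + k] H = xLap^[k] (xLap^[s] H) := fun k => by
    rw [add_comm, Function.iterate_add_apply]
  have hG := hQ.contDiffOn_xConv hV
  have hHs := contDiffOn_xLap_iterate hV hH s
  simp only [evenFormal, evenLapFormal, Pi.add_apply, lapFormal]
  have e1 : powerSeriesAt (1 : ℝ) 0 (fun k z => if k + 1 ≤ s - 1 then
      (xLap^[k + 1] H) z / minusDen (2 * s) (k + 1) else 0) r j z =
      powerSeriesAt 1 0 (fun k z => evenCoeff s (k + 1) * xLap^[k] (xLap H) z) r j z := by
    refine powerSeriesAt_congr (fun k => ?_) r j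
    rw [evenCoeff, ← Function.iterate_succ_apply]
    by_cases hk : k + 1 ≤ s - 1
    · rw [if_pos hk, if_neg (by omega), div_eq_inv_mul]
    · rw [if_neg hk, if_pos (by omega), zero_mul]
  have e2 : powerSeriesAt (s : ℝ) 0 (fun k z => (plusDen (2 * s) k)⁻¹ *
      xLap^[k] (fun w => α w + cConst s * xConv Q (xLap^[s] H) w) z) r j z =
      powerSeriesAt (s : ℝ) 0 (fun k z => (xLap^[k] α) z / plusDen (2 * s) k) r j z +
      powerSeriesAt (s : ℝ) 0 (fun k z =>
        cConst s * (xConv Q (xLap^[s + k] H) z / plusDen (2 * s) k)) r j z := by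
    rw [powerSeriesAt_add]
    refine powerSeriesAt_congr (fun k => ?_) r j
    have hGz := hG.contDiffAt (hV.mem_nhds hz)
    rw [xLap_iterate_add (hα.contDiffAt (hV.mem_nhds hz)) (contDiffAt_const.mul hGz),
      xLap_iterate_const_mul hGz, hQ.xLap_iterate_xConv hV hHs k hz, hit]
    ring
  have e3 : powerSeriesAt (s : ℝ) 1 (fun k z =>
      cConst s * ((xLap^[s + k] H) z / plusDen (2 * s) k)) r j z =
      powerSeriesAt s 1 (fun k z => cConst s * (plusDen (2 * s) k)⁻¹ * xLap^[k] (xLap^[s] H) z) r j z :=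
    powerSeriesAt_congr (fun k => by rw [hit]; ring) r j
  have e4 : powerSeriesAt (s : ℝ) 0 (fun k z =>
      cConst s * (-qConst (2 * s) k) * ((xLap^[s + k] H) z / plusDen (2 * s) k)) r j z =
      powerSeriesAt s 0 (fun k z => cConst s * (-qConst (2 * s) k * (plusDen (2 * s) k)⁻¹) *
        xLap^[k] (xLap^[s] H) z) r j z :=
    powerSeriesAt_congr (fun k => by rw [hit]; ring) r j
  rw [e1, e2, e3, e4]
  ring

theorem isFormalSolution_iff_of_even (hs : 1 ≤ s) (hV : IsOpen V) (hH : ContDiffOn ℝ ∞ H V) :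
    IsFormalSolution (2 * s) V H a ↔ ∃ α Q : Z d p → ℝ, ContDiffOn ℝ ∞ α V ∧
      SmoothConvolvable V Q (xLap^[s] H) ∧ ∀ r j, ∀ z ∈ V, a r j z = evenFormal s H α Q r j z := by
  constructor
  · intro ha
    have hα : ContDiffOn ℝ ∞ (a s 0) V := ha.1.1 _ _
    have hQ := (analyticConvolvable_zero V (xLap^[s] H)).smoothConvolvable
    have e : ((2 * s : ℕ) : ℝ) / 2 = s := by push_cast; ring
    -- At ϱ^s without logarithm the H-part is silent: the polynomial stops at s - 1 and q_0 = 0.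
    -- With Q = 0 the coefficient there is exactly α.
    refine ⟨a s 0, fun _ => 0, hα, hQ, fun r j z hz => ?_⟩
    rw [evenFormal_eq hV hH hα hQ r j hz]
    simp only [xConv_zero_left, mul_zero, add_zero]
    refine ha.eqOn (by omega) hV (isFormalSolution_evenLapFormal hs hV hH hα) (fun z _ => ?_) r j z hz
    rw [e]
    have hp : ∀ c : ℕ → ℝ, ∀ β : Z d p → ℝ, lapFormal s 0 c β s 0 z = c 0 * β z := fun c β => by
      have h2 := congrFun (powerSeriesAt_apply (s : ℝ) 0 (fun k z => c k * xLap^[k] β z) 0) z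
      simpa [lapFormal] using h2
    have h1 : lapFormal 1 0 (fun k => evenCoeff s (k + 1)) (xLap H) s 0 z = 0 := by
      have e2 : (s : ℝ) = 1 + (s - 1 : ℕ) := by rw [Nat.cast_sub hs]; push_cast; ring
      rw [lapFormal, e2, powerSeriesAt_apply, evenCoeff, if_pos (by omega), zero_mul]
    have h3 : lapFormal s 1 (fun k => cConst s * (plusDen (2 * s) k)⁻¹) (xLap^[s] H) s 0 z = 0 := by
      rw [lapFormal, powerSeriesAt_of_log_ne (by omega)]
    simp only [evenLapFormal, Pi.add_apply, hp, h1, h3, plusDen_zero, qConst_zero]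
    ring
  · rintro ⟨α, Q, hα, hQ, h⟩
    have hα' : ContDiffOn ℝ ∞ (fun w => α w + cConst s * xConv Q (xLap^[s] H) w) V :=
      hα.add (contDiffOn_const.mul (hQ.contDiffOn_xConv hV))
    exact (isFormalSolution_evenLapFormal hs hV hH hα').congr hV fun r j z hz =>
      (h r j z hz).trans (evenFormal_eq hV hH hα hQ r j hz)

end ExplicitFormalSolutions

end PPWave

end

/-! ### The theorem -/

open PPWave in
theorem mainTheorem8 (n p : ℕ) (hp : 1 ≤ p) (hpn : 2 * p ≤ n)
    (V : Set (Z (n - 2 * p) p)) (hV : IsOpen V)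
    (H : Z (n - 2 * p) p → ℝ) (hH : ContDiffOn ℝ ∞ H V) :
    -- `n` odd
    (Odd n →
      -- formal solutions, `H` and `α` smooth
      (∀ a : FormalSeries (n - 2 * p) p, IsFormalSolution n V H a ↔
        ∃ α : Z (n - 2 * p) p → ℝ, ContDiffOn ℝ ∞ α V ∧
          ∀ r j, ∀ z ∈ V, a r j z = oddFormal n H α r j z) ∧
      (AnalyticOnNhd ℝ H V →
        -- solutions for small `ϱ > 0`
        (∀ h : ℝ → Z (n - 2 * p) p → ℝ, IsSolution n V H h ↔
          ∃ α : Z (n - 2 * p) p → ℝ, AnalyticOnNhd ℝ α V ∧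
            HasOddExpansion n V H α (𝓝[>] 0) h) ∧
        (∀ α : Z (n - 2 * p) p → ℝ, AnalyticOnNhd ℝ α V →
          ∃ h, HasOddExpansion n V H α (𝓝[>] 0) h) ∧
        -- the unique solution that is analytic in `ϱ`
        (∃ h, IsRhoAnalyticSolution n V H h) ∧
        (∀ h : ℝ → Z (n - 2 * p) p → ℝ, IsRhoAnalyticSolution n V H h ↔
          HasOddExpansion n V H (fun _ => 0) (𝓝 0) h))) ∧
    -- `n = 2s` even
    (∀ s : ℕ, n = 2 * s →
      -- formal solutions, `H` and `α` smooth
      (∀ a : FormalSeries (n - 2 * p) p, IsFormalSolution n V H a ↔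
        ∃ α Q : Z (n - 2 * p) p → ℝ, ContDiffOn ℝ ∞ α V ∧
          SmoothConvolvable V Q (xLap^[s] H) ∧
          ∀ r j, ∀ z ∈ V, a r j z = evenFormal s H α Q r j z) ∧
      -- solutions for small `ϱ > 0`
      (AnalyticOnNhd ℝ H V →
        (∀ h : ℝ → Z (n - 2 * p) p → ℝ, IsSolution n V H h ↔
          ∃ α Q : Z (n - 2 * p) p → ℝ, AnalyticOnNhd ℝ α V ∧
            AnalyticConvolvable V Q (xLap^[s] H) ∧
            HasEvenExpansion s V H α Q (𝓝[>] 0) h) ∧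
        (∀ α Q : Z (n - 2 * p) p → ℝ, AnalyticOnNhd ℝ α V →
          AnalyticConvolvable V Q (xLap^[s] H) →
          ∃ h, HasEvenExpansion s V H α Q (𝓝[>] 0) h)) ∧
      -- solutions that are analytic in `ϱ` exist only if `Δ^s H = 0`
      ((∃ h, IsRhoAnalyticSolution n V H h) ↔ ∀ z ∈ V, (xLap^[s] H) z = 0) ∧
      -- the analytic solutions are then parametrized by the analytic functions `α`
      (AnalyticOnNhd ℝ H V → (∀ z ∈ V, (xLap^[s] H) z = 0) →
        (∀ h : ℝ → Z (n - 2 * p) p → ℝ, IsAnalyticSolution n V H h ↔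
          ∃ α : Z (n - 2 * p) p → ℝ, AnalyticOnNhd ℝ α V ∧
            HasEvenExpansion s V H α (fun _ => 0) (𝓝 0) h) ∧
        (∀ α : Z (n - 2 * p) p → ℝ, AnalyticOnNhd ℝ α V →
          ∃ h, HasEvenExpansion s V H α (fun _ => 0) (𝓝 0) h) ∧
        (∀ (α β : Z (n - 2 * p) p → ℝ) (h : ℝ → Z (n - 2 * p) p → ℝ),
          HasEvenExpansion s V H α (fun _ => 0) (𝓝 0) h →
          HasEvenExpansion s V H β (fun _ => 0) (𝓝 0) h → EqOn α β V))) := by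
  refine ⟨fun hn => ⟨fun a => isFormalSolution_iff_of_odd hn hV hH, fun hHa =>
    ⟨fun h => isSolution_iff_of_odd hn hV hHa, fun α hα => exists_hasOddExpansion hn hHa hα,
      ⟨_, isRhoAnalyticSolution_oddSeries hn hHa⟩,
      fun h => isRhoAnalyticSolution_iff_of_odd hn hV hHa⟩⟩, ?_⟩
  rintro s rfl
  -- From 1 ≤ p and 2p ≤ 2s.
  have hs : 1 ≤ s := by omega
  exact ⟨fun a => isFormalSolution_iff_of_even hs hV hH, fun hHa =>
    ⟨fun h => isSolution_iff_of_even hs hV hHa,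
      fun α Q hα hQ => exists_hasEvenExpansion hV nhdsWithin_le_nhds hHa hα hQ⟩,
    ⟨fun ⟨h, hh⟩ => hh.xLap_iterate_eq_zero hs hV hH,
      fun h0 => ⟨_, isRhoAnalyticSolution_polynomial hs hV hH h0⟩⟩,
    fun hHa h0 => ⟨fun h => isAnalyticSolution_iff_of_even hs hV hHa h0,
      fun α hα => exists_hasEvenExpansion hV le_rfl hHa hα (analyticConvolvable_zero _ _),
      fun α β h h1 h2 => HasEvenExpansion.eqOn h0 hV h1 h2⟩⟩
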